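/- \textbf{Theorem (Infinite volume).} Let $d\ge 0$. For every $\beta>0$ let $0<c_\beta(0)\le c_\beta(1)\le\dots\le c_\beta(2d)$, and let $\Gamma_0\le\Gamma_1\le\dots\le\Gamma_d$ be real numbers such that $$\lim_{\beta\to\infty}\frac1\beta\ln c_\beta(n)=-\Gamma_{d-n}\quad(0\le n\le d),\qquad \lim_{\beta\to\infty}\frac1\beta\ln c_\beta(n)=0\quad(d\le n\le 2d)$$ (in particular $\Gamma_0=0$). Attach to the sites of $\mathbb Z^d$ independent Poisson processes of rate one, with arrival times $\tau(x,i)$, and random variables $U(x,i)$ uniform on $[0,1]$, $x\in\mathbb Z^d$, $i\ge1$, independent of each other and of the Poisson processes. For a finite $\Lambda\subset\mathbb Z^d$, the growth process $(\sigma_{\Lambda,t})_{t\ge0}$ with values in $\{0,1\}^{\Lambda}$ starts from the empty configuration $\sigma_{\Lambda,0}\equiv 0$, and changes only as follows: at each arrival time $t=\tau(x,i)$ with $x\in\Lambda$ and $x$ empty before $t$, the site $x$ becomes occupied (takes the value $1$) if $U(x,i)\le c_\beta(N)$, where $N$ is the number of sites $y\in\Lambda$ with $|x-y|=1$ that are occupied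 just before time $t$; occupied sites remain occupied forever. Let $(\sigma_t)_{t\ge0}$ be the infinite-volume process on $\mathbb Z^d$, the limit of $(\sigma_{\Lambda,t})_{t\ge0}$ as $\Lambda\uparrow\mathbb Z^d$. Define $\kappa_0=\Gamma_0$ and $$\kappa_i=\max\Big(\Gamma_{i-1},\ \frac{\Gamma_i+i\,\kappa_{i-1}}{i+1}\Big),\qquad 1\le i\le d .$$ Let $\kappa>0$ and $\tau_\beta=\exp(\beta\kappa)$. $\bullet$ If $\kappa<\kappa_d$, then $\displaystyle\lim_{\beta\to\infty}\mathbb P\big(\sigma_{\tau_\beta}(0)=1\big)=0$. $\bullet$ If $\kappa>\kappa_d$, then $\displaystyle\lim_{\beta\to\infty}\mathbb P\big(\sigma_{\tau_\beta}(0)=0\big)=0$. -/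

import Mathlib

open MeasureTheory ProbabilityTheory Filter Topology

noncomputable section

namespace IrrevGrowth

/-- The sites of the lattice `ℤ^d`. -/
abbrev Site (d : ℕ) : Type := Fin d → ℤ

/-- `N(x, η)`: the number of sites of the finite occupied set `η` at distance one from `x`. For
lattice points, Euclidean distance one is the same as `ℓ¹` distance one. -/
def numNbrs {d : ℕ} (x : Site d) (η : Finset (Site d)) : ℕ :=
  (η.filter (fun y => ∑ j, |x j - y j| = 1)).card

/-- The random input of the graphical construction: `gap x i` are the successive waiting times of
the rate-one Poisson process attached to the site `x` and `U x i` the mark of its arrival number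
`i` (numbered from `0`). All waiting times are exponential of parameter one, all marks are uniform
on `[0,1]`, and all these variables together are independent. -/
structure IsGraphicalInput {d : ℕ} {Ω : Type*} [MeasurableSpace Ω] (P : Measure Ω)
    (gap U : Site d → ℕ → Ω → ℝ) : Prop where
  gap_law : ∀ x i, HasLaw (gap x i) (expMeasure 1) P
  mark_law : ∀ x i, HasLaw (U x i) (volume.restrict (Set.Icc (0 : ℝ) 1)) P
  indep : iIndepFun
    (Sum.elim (fun p : Site d × ℕ => gap p.1 p.2) (fun p : Site d × ℕ => U p.1 p.2)) P

/-- The arrival times of the Poisson processes, from the waiting times. -/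
def arrival {d : ℕ} (gap : Site d → ℕ → ℝ) (p : Site d × ℕ) : ℝ :=
  ∑ j ∈ Finset.range (p.2 + 1), gap p.1 j

/-- The arrivals at the sites of `Λ` up to time `t`. -/
def arrivalsUpTo {d : ℕ} (gap : Site d → ℕ → ℝ) (Λ : Finset (Site d)) (t : ℝ) :
    Set (Site d × ℕ) :=
  {p | p.1 ∈ Λ ∧ arrival gap p ≤ t}

open Classical in
/-- The arrivals at the sites of the finite set `Λ` up to time `t`, in increasing order of time.
Almost surely they are finite in number, at distinct times, so that this list is unambiguous; the
value on the exceptional null event is irrelevant. -/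
def orderedArrivals {d : ℕ} (gap : Site d → ℕ → ℝ) (Λ : Finset (Site d)) (t : ℝ) :
    List (Site d × ℕ) :=
  if h : (arrivalsUpTo gap Λ t).Finite then
    h.toFinset.toList.insertionSort (fun p q => arrival gap p ≤ arrival gap q)
  else []

open Classical in
/-- The update at the arrival `p = (x, i)` when the occupied set is `η`: the site `x` becomes
occupied if `U x i ≤ c (N(x, η))`; occupied sites remain occupied. -/
def update {d : ℕ} (c : ℕ → ℝ) (U : Site d → ℕ → ℝ) (η : Finset (Site d)) (p : Site d × ℕ) :
    Finset (Site d) :=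
  if U p.1 p.2 ≤ c (numNbrs p.1 η) then insert p.1 η else η

/-- The set of occupied sites at time `t` for the process in the finite set `Λ`, started from the
empty configuration: the updates are made successively at the arrivals in `Λ` up to time `t`. -/
def finiteVolume {d : ℕ} (c : ℕ → ℝ) (gap U : Site d → ℕ → ℝ) (Λ : Finset (Site d)) (t : ℝ) :
    Finset (Site d) :=
  (orderedArrivals gap Λ t).foldl (update c U) ∅

/-- The set of occupied sites at time `t` for the infinite-volume process in `ℤ^d`, the limit of
the finite-volume processes as `Λ ↑ ℤ^d`. For non-decreasing rates the finite-volume processes are,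
almost surely, non-decreasing in `Λ`, so that the limit exists; a site is empty if it is not in
this set. -/
def infiniteVolume {d : ℕ} (c : ℕ → ℝ) (gap U : Site d → ℕ → ℝ) (t : ℝ) : Set (Site d) :=
  {x | ∀ᶠ Λ : Finset (Site d) in atTop, x ∈ finiteVolume c gap U Λ t}

/-- The hypothesis on the rates `c β n`, `0 ≤ n ≤ 2d`, with activation energies
`Γ 0 ≤ ⋯ ≤ Γ d`. -/
structure RateHypothesis (d : ℕ) (c : ℝ → ℕ → ℝ) (Γ : ℕ → ℝ) : Prop where
  pos : ∀ β, 0 < β → ∀ n, n ≤ 2 * d → 0 < c β n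
  mono : ∀ β, 0 < β → ∀ m n, m ≤ n → n ≤ 2 * d → c β m ≤ c β n
  lim_low : ∀ n, n ≤ d →
    Tendsto (fun β : ℝ => (1 / β) * Real.log (c β n)) atTop (𝓝 (-Γ (d - n)))
  lim_high : ∀ n, d ≤ n → n ≤ 2 * d →
    Tendsto (fun β : ℝ => (1 / β) * Real.log (c β n)) atTop (𝓝 0)
  energy_mono : ∀ i j, i ≤ j → j ≤ d → Γ i ≤ Γ j

/-- The critical constants `κ_i`. -/
def kappaCrit (Γ : ℕ → ℝ) : ℕ → ℝ
  | 0 => Γ 0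
  | i + 1 => max (Γ i) ((Γ (i + 1) + ((i + 1 : ℕ) : ℝ) * kappaCrit Γ i) / (((i + 1 : ℕ) : ℝ) + 1))

end IrrevGrowth

end

open MeasureTheory ProbabilityTheory Filter Topology

noncomputable section

namespace IrrevGrowth

/-! Give every arrival its requirement, the number of occupied neighbours it needs to be effective.
Arrivals of requirement at most `d - i` have density of order exp(-βΓ_i). Both halves follow the
growth in `n` free directions, the other `d - n` directions contributing one occupied neighbour
each, and proceed by induction on `n`.

Why κ_n. A cube of dimension `n` and side exp(βL) contains a nucleus after a time exp(β(Γ_n - nL)).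
A nucleus grows by covering its faces, and a face is a problem of dimension `n - 1`, since the
nucleus supplies one more occupied neighbour. Large faces are covered in a time exp(βκ_{n-1}), so a
radius exp(βL) is reached in a time exp(β(L + κ_{n-1})). Equating the two exponents gives (Γ_n +
nκ_{n-1})/(n+1). The first faces are of bounded size and cost exp(βΓ_{n-1}), whence the maximum.

Above κ_d this heuristic is followed directly: `whp_nucleates` provides nuclei everywhere,
`fill_of_scales` lets a nucleus grow through finitely many scales of faces, and `whp_fill` carries
the induction.

Below κ_d, `Conf` is the inductive claim: over a time exp(βK_n), the growth in `n` directions is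
covered by separated boxes with at most `k` = exp(βε) nuclei each. Time is cut into windows of the
length of level `n - 1`. Within a window each box is dominated by the half-spaces supporting its
faces (`run_subset_fat`). The growth out of a half-space is compared with a process of dimension `n
- 1`, in which all layers are collapsed into one: over a covering box of that process, each new
layer consumes a nucleus, so the height is at most `k` (`run_halfspace_subset`). Boxes that come
close are merged, and the scarcity of nuclei keeps at most `k` of them in each (`exists_merge`,
`exists_cover`, `conf_of_sparse`). If K_n < Γ_{n-1}, points able to start a layer are so rare that
they are counted as nuclei themselves, and half-spaces then stand still. In dimension `d` an
occupied origin forces a point of requirement zero nearby (`exists_nucleation`), which is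
improbable.

Finite speed of propagation (`zero_mem_run_filter`) restricts the lower bound to a box of
exponential size, uniformly in the volume. Exponential moments of the number of effective arrivals
(`measure_many_le`, `measure_none_le`) give doubly exponentially small probabilities, which survive
union bounds over exponentially many space-time boxes. -/

/-- The neighbour of `x` in the direction `q = (j, ±)`. -/
def nbr {d : ℕ} (x : Site d) (q : Fin d × Bool) : Site d :=
  Function.update x q.1 (x q.1 + if q.2 then 1 else -1)

open Classical in
/-- The number of occupied neighbours of `x` in the directions of `I`. -/
def nbCount {d : ℕ} (I : Finset (Fin d)) (x : Site d) (η : Set (Site d)) : ℕ :=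
  ((I ×ˢ (Finset.univ : Finset Bool)).filter (fun q => nbr x q ∈ η)).card

/-- The sites which agree with `x` on the coordinates of `I`. -/
def cyl {d : ℕ} (I : Finset (Fin d)) (x : Site d) : Set (Site d) := {y | ∀ j ∈ I, y j = x j}

open Classical in
/-- The update at the point `p` of the growth process in the directions of `I`, where `m`
neighbours in the other directions are counted as occupied. -/
def growStep {d : ℕ} (I : Finset (Fin d)) (m : ℕ) (req : Site d × ℕ → ℕ) (η : Set (Site d))
    (p : Site d × ℕ) : Set (Site d) :=
  if req p ≤ nbCount I p.1 η + m then η ∪ cyl I p.1 else η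

/-- The growth process run over a list of points. -/
def run {d : ℕ} (I : Finset (Fin d)) (m : ℕ) (req : Site d × ℕ → ℕ) (l : List (Site d × ℕ))
    (η : Set (Site d)) : Set (Site d) :=
  l.foldl (growStep I m req) η

/-! ### Growth along a list of points: monotonicity and splitting in time -/

section deterministic

variable {d : ℕ} {I : Finset (Fin d)} {m : ℕ} {req : Site d × ℕ → ℕ}

lemma nbCount_mono {x : Site d} {η η' : Set (Site d)}
    (h : ∀ q : Fin d × Bool, q.1 ∈ I → nbr x q ∈ η → nbr x q ∈ η') :
    nbCount I x η ≤ nbCount I x η' := by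
  classical
  unfold nbCount
  apply Finset.card_le_card
  intro q hq
  simp only [Finset.mem_filter, Finset.mem_product, Finset.mem_univ, and_true] at hq ⊢
  exact ⟨hq.1, h q hq.1 hq.2⟩

lemma exists_nbr_of_nbCount_pos {x : Site d} {η : Set (Site d)} (h : 0 < nbCount I x η) :
    ∃ q : Fin d × Bool, q.1 ∈ I ∧ nbr x q ∈ η := by
  classical
  unfold nbCount at h
  obtain ⟨q, hq⟩ := Finset.card_pos.1 h
  simp only [Finset.mem_filter, Finset.mem_product, Finset.mem_univ, and_true] at hq
  exact ⟨q, hq⟩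

lemma exists_nbr_of_nbCount_lt {x : Site d} {η η' : Set (Site d)}
    (h : nbCount I x η' < nbCount I x η) :
    ∃ q : Fin d × Bool, q.1 ∈ I ∧ nbr x q ∈ η ∧ nbr x q ∉ η' := by
  by_contra! hc
  exact absurd (nbCount_mono hc) (not_le.2 h)

lemma mem_cyl_self (x : Site d) : x ∈ cyl I x := fun _ _ => rfl

lemma nbCount_univ_le (x : Site d) (η : Set (Site d)) : nbCount Finset.univ x η ≤ 2 * d := by
  classical
  unfold nbCount
  refine (Finset.card_filter_le _ _).trans ?_
  simp [mul_comm]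

lemma mem_growStep {η : Set (Site d)} {p : Site d × ℕ} {x : Site d} :
    x ∈ growStep I m req η p ↔ x ∈ η ∨ (req p ≤ nbCount I p.1 η + m ∧ x ∈ cyl I p.1) := by
  unfold growStep
  split_ifs with h <;> simp [h]

lemma growStep_mono {η η' : Set (Site d)} (h : η ⊆ η') (p : Site d × ℕ) :
    growStep I m req η p ⊆ growStep I m req η' p := by
  intro x hx
  rw [mem_growStep] at hx ⊢
  rcases hx with hx | ⟨h1, h2⟩
  · exact Or.inl (h hx)
  · exact Or.inr ⟨h1.trans (by gcongr; exact nbCount_mono fun q _ hq => h hq), h2⟩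

@[simp] lemma run_nil (η : Set (Site d)) : run I m req [] η = η := rfl

lemma run_append (l l' : List (Site d × ℕ)) (η : Set (Site d)) :
    run I m req (l ++ l') η = run I m req l' (run I m req l η) := by
  simp [run]

lemma run_cons (p : Site d × ℕ) (l : List (Site d × ℕ)) (η : Set (Site d)) :
    run I m req (p :: l) η = run I m req l (growStep I m req η p) := rfl

lemma run_concat (l : List (Site d × ℕ)) (p : Site d × ℕ) (η : Set (Site d)) :
    run I m req (l ++ [p]) η = growStep I m req (run I m req l η) p := by
  simp [run]

lemma mem_run_concat {l : List (Site d × ℕ)} {p : Site d × ℕ} {η : Set (Site d)} {x : Site d} :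
    x ∈ run I m req (l ++ [p]) η ↔ x ∈ run I m req l η ∨
      (req p ≤ nbCount I p.1 (run I m req l η) + m ∧ x ∈ cyl I p.1) := by
  rw [run_concat, mem_growStep]

lemma subset_run (l : List (Site d × ℕ)) (η : Set (Site d)) : η ⊆ run I m req l η := by
  induction l using List.reverseRecOn with
  | nil => simp
  | append_singleton l p ih =>
    intro x hx
    rw [mem_run_concat]
    exact Or.inl (ih hx)

lemma run_mono (l : List (Site d × ℕ)) {η η' : Set (Site d)} (h : η ⊆ η') :
    run I m req l η ⊆ run I m req l η' := by
  induction l using List.reverseRecOn with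
  | nil => simpa
  | append_singleton l p ih =>
    rw [run_concat, run_concat]
    exact growStep_mono ih p

/-- The process is made of full cylinders. -/
lemma cyl_subset_run (l : List (Site d × ℕ)) {η : Set (Site d)}
    (hη : ∀ x ∈ η, cyl I x ⊆ η) : ∀ x ∈ run I m req l η, cyl I x ⊆ run I m req l η := by
  induction l using List.reverseRecOn with
  | nil => simpa
  | append_singleton l p ih =>
    intro x hx y hy
    rw [mem_run_concat] at hx ⊢
    rcases hx with hx | ⟨h1, h2⟩
    · exact Or.inl (ih x hx hy)
    · exact Or.inr ⟨h1, fun j hj => (hy j hj).trans (h2 j hj)⟩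

/-- A point whose requirement is met by the initial configuration is occupied at the end. -/
lemma mem_run_of_mem {l : List (Site d × ℕ)} {p : Site d × ℕ} (hp : p ∈ l) {η : Set (Site d)}
    (h : req p ≤ nbCount I p.1 η + m) : p.1 ∈ run I m req l η := by
  obtain ⟨l₁, l₂, rfl⟩ := List.append_of_mem hp
  rw [run_append, run_cons]
  apply subset_run
  rw [mem_growStep]
  refine Or.inr ⟨h.trans ?_, mem_cyl_self _⟩
  gcongr
  exact nbCount_mono fun q _ hq => subset_run _ _ hq

/-- A list sorted by time splits at a time `s`. -/
lemma filter_le_append_filter {α : Type*} {τ : α → ℝ} {l : List α}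
    (hl : l.Pairwise (fun p q => τ p ≤ τ q)) {s t : ℝ} (hst : s ≤ t) :
    l.filter (fun p => τ p ≤ t) =
      l.filter (fun p => τ p ≤ s) ++ l.filter (fun p => s < τ p ∧ τ p ≤ t) := by
  induction l with
  | nil => simp
  | cons p l ih =>
    rw [List.pairwise_cons] at hl
    have ih := ih hl.2
    by_cases h1 : τ p ≤ s
    · have h2 : τ p ≤ t := h1.trans hst
      have h3 : ¬ s < τ p := not_lt.2 h1
      simp only [List.filter_cons, h1, h2, h3, decide_true, if_true, false_and, decide_false,
        Bool.false_eq_true, if_false, List.cons_append, ih]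
    · have h0 : ∀ q ∈ l, ¬ τ q ≤ s := fun q hq h => h1 ((hl.1 q hq).trans h)
      have h4 : (p :: l).filter (fun q => decide (τ q ≤ s)) = [] := by
        rw [List.filter_eq_nil_iff]
        intro q hq
        rcases List.mem_cons.1 hq with rfl | hq
        · simpa using h1
        · simpa using h0 q hq
      rw [h4, List.nil_append]
      apply List.filter_congr
      intro q hq
      have : s < τ q := by
        rcases List.mem_cons.1 hq with rfl | hq
        · simpa using h1
        · simpa using h0 q hq
      simp [this]

end deterministic

/-! ### Separated boxes and growth out of half-spaces -/

/-- A box together with a finite set of points. -/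
structure Blob (d : ℕ) where
  lo : Site d
  hi : Site d
  pts : Finset (Site d × ℕ)

/-- The sites of the box, constrained only in the coordinates of `I`. -/
def Blob.box {d : ℕ} (I : Finset (Fin d)) (E : Blob d) : Set (Site d) :=
  {x | ∀ j ∈ I, E.lo j ≤ x j ∧ x j ≤ E.hi j}

/-- In some direction of `I`, the boxes are more than `g` apart. -/
def Blob.Sep {d : ℕ} (I : Finset (Fin d)) (g : ℤ) (E E' : Blob d) : Prop :=
  ∃ j ∈ I, E.hi j + g < E'.lo j ∨ E'.hi j + g < E.lo j

/-- The box enlarged by `h` on all sides. -/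
def Blob.fat {d : ℕ} (h : ℤ) (E : Blob d) : Blob d :=
  ⟨fun j => E.lo j - h, fun j => E.hi j + h, E.pts⟩

/-- The sign of a direction. -/
def sg (b : Bool) : ℤ := if b then 1 else -1

section deterministic

variable {d : ℕ} {I : Finset (Fin d)} {m : ℕ} {req : Site d × ℕ → ℕ}

lemma nbr_apply_self (x : Site d) (q : Fin d × Bool) : nbr x q q.1 = x q.1 + sg q.2 := by
  simp [nbr, sg]

lemma nbr_apply_of_ne (x : Site d) (q : Fin d × Bool) {j : Fin d} (h : j ≠ q.1) :
    nbr x q j = x j := by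
  simp [nbr, h]

lemma abs_nbr_sub_le (x : Site d) (q : Fin d × Bool) (j : Fin d) : |nbr x q j - x j| ≤ 1 := by
  by_cases h : j = q.1
  · subst h
    rw [nbr_apply_self]
    cases q.2 <;> simp [sg]
  · simp [nbr_apply_of_ne x q h]

lemma Blob.cyl_subset_box {E : Blob d} {x : Site d} (hx : x ∈ E.box I) : cyl I x ⊆ E.box I := by
  intro y hy j hj
  rw [hy j hj]
  exact hx j hj

lemma Blob.box_subset_fat {E : Blob d} {h : ℕ} : E.box I ⊆ (E.fat h).box I := by
  intro x hx j hj
  have := hx j hj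
  simp only [Blob.fat]
  omega

lemma Blob.not_sep_of_near {E E' : Blob d} {g : ℤ} {x y : Site d} (hx : x ∈ E.box I)
    (hy : y ∈ E'.box I) (hxy : ∀ j, |x j - y j| ≤ g) : ¬ E.Sep I g E' := by
  rintro ⟨j, hj, h⟩
  have h1 := hx j hj
  have h2 := hy j hj
  have h3 := abs_le.1 (hxy j)
  omega

lemma Blob.sep_of_fat {E E' : Blob d} {g : ℤ} (h : ℤ) (hs : E.Sep I (2 * h + g) E') :
    (E.fat h).Sep I g (E'.fat h) := by
  obtain ⟨j, hj, hh⟩ := hs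
  refine ⟨j, hj, ?_⟩
  simp only [Blob.fat]
  omega

lemma Blob.Sep.mono {E E' : Blob d} {g g' : ℤ} (hs : E.Sep I g E') (hg : g' ≤ g) :
    E.Sep I g' E' := by
  obtain ⟨j, hj, hh⟩ := hs
  exact ⟨j, hj, by omega⟩

/-- Separated boxes grow independently of each other, each of them as long as it grows inside
half-spaces. -/
lemma run_subset_fat (𝓕 : Set (Blob d)) (h r : ℕ) (hmr : m ≤ r)
    (hsep : ∀ E ∈ 𝓕, ∀ E' ∈ 𝓕, E ≠ E' → E.Sep I (2 * h + 2) E')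
    (w : List (Site d × ℕ))
    (hnuc : ∀ p ∈ w, req p ≤ r → p.1 ∈ ⋃ E ∈ 𝓕, E.box I)
    (H : ∀ j ∈ I, ∀ (b : Bool) (a : ℤ),
      run I m req (w.filter (fun p => r < req p)) {x | sg b * x j ≤ a} ⊆
        {x | sg b * x j ≤ a + h}) :
    run I m req w (⋃ E ∈ 𝓕, E.box I) ⊆ ⋃ E ∈ 𝓕, (E.fat h).box I := by
  -- After enlargement by `h` the boxes are still more than 2 apart. Two neighbours of one site are
  -- at distance at most 2, so all occupied neighbours of a site lie in a single enlarged box.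
  have huniq : ∀ E ∈ 𝓕, ∀ E' ∈ 𝓕, ∀ x ∈ (E.fat h).box I, ∀ y ∈ (E'.fat h).box I,
      (∀ j, |x j - y j| ≤ 2) → E = E' := by
    intro E hE E' hE' x hx y hy hxy
    by_contra hne
    exact Blob.not_sep_of_near hx hy hxy (Blob.sep_of_fat _ (hsep E hE E' hE' hne))
  set η₀ : Set (Site d) := ⋃ E ∈ 𝓕, E.box I with hη₀
  -- The half-space containing `E` and bounded by its face in the direction `(j, b)`. The invariant
  -- compares the process inside the enlarged box with the process started from each of these
  -- half-spaces.
  set half : Blob d → Fin d → Bool → Set (Site d) := fun E j b =>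
    {x | sg b * x j ≤ if b then E.hi j else - E.lo j} with hhalf
  have hbh : ∀ E : Blob d, ∀ j ∈ I, ∀ b, E.box I ⊆ half E j b := by
    intro E j hj b x hx
    have := hx j hj
    cases b <;> simp [hhalf, sg] <;> omega
  have key : ∀ v, v <+: w → run I m req v η₀ ⊆ (⋃ E ∈ 𝓕, (E.fat h).box I) ∧
      ∀ E ∈ 𝓕, ∀ j ∈ I, ∀ b, ∀ x ∈ run I m req v η₀, x ∈ (E.fat h).box I →
        x ∈ run I m req (v.filter (fun p => r < req p)) (half E j b) := by
    intro v
    induction v using List.reverseRecOn with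
    | nil =>
      intro _
      refine ⟨?_, ?_⟩
      · simp only [run_nil]
        exact Set.iUnion₂_mono fun E _ => Blob.box_subset_fat
      · intro E hE j hj b x hx hxE
        simp only [run_nil, List.filter_nil] at hx ⊢
        simp only [hη₀, Set.mem_iUnion] at hx
        obtain ⟨E', hE', hx'⟩ := hx
        have := huniq E hE E' hE' x hxE x (Blob.box_subset_fat hx') (by simp)
        subst this
        exact hbh E j hj b hx'
    | append_singleton v p ih =>
      intro hpre
      have hv : v <+: w := (List.prefix_append v [p]).trans hpre
      obtain ⟨ihA, ihB⟩ := ih hv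
      have hpw : p ∈ w := hpre.subset (by simp)
      have main : ∀ x ∈ run I m req (v ++ [p]) η₀, ∃ E ∈ 𝓕, x ∈ (E.fat h).box I ∧
          ∀ j ∈ I, ∀ b, x ∈ run I m req ((v ++ [p]).filter (fun p => r < req p)) (half E j b) := by
        intro x hx
        rw [mem_run_concat] at hx
        rcases hx with hx | ⟨hN, hxc⟩
        · obtain ⟨E, hE, hxE⟩ := Set.mem_iUnion₂.1 (ihA hx)
          refine ⟨E, hE, hxE, fun j hj b => ?_⟩
          rw [List.filter_append, run_append]
          exact subset_run _ _ (ihB E hE j hj b x hx hxE)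
        · by_cases hreq : req p ≤ r
          · obtain ⟨E, hE, hpE⟩ := Set.mem_iUnion₂.1 (hnuc p hpw hreq)
            have hxE := Blob.cyl_subset_box hpE hxc
            exact ⟨E, hE, Blob.box_subset_fat hxE, fun j hj b =>
              subset_run _ _ (hbh E j hj b hxE)⟩
          -- The requirement exceeds `r ≥ m`, so the `m` neighbours granted for free do not suffice
          -- and some neighbour in a direction of `I` is occupied.
          · have hpos : 0 < nbCount I p.1 (run I m req v η₀) := by omega
            obtain ⟨q, hqI, hq⟩ := exists_nbr_of_nbCount_pos hpos
            obtain ⟨E, hE, hqE⟩ := Set.mem_iUnion₂.1 (ihA hq)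
            have hall : ∀ q' : Fin d × Bool, nbr p.1 q' ∈ run I m req v η₀ →
                nbr p.1 q' ∈ (E.fat h).box I := by
              intro q' hq'
              obtain ⟨E', hE', hqE'⟩ := Set.mem_iUnion₂.1 (ihA hq')
              have := huniq E hE E' hE' _ hqE _ hqE' (by
                intro j
                have h1 := abs_le.1 (abs_nbr_sub_le p.1 q j)
                have h2 := abs_le.1 (abs_nbr_sub_le p.1 q' j)
                rw [abs_le]; omega)
              rwa [this]
            have hhalfx : ∀ j ∈ I, ∀ b, x ∈
                run I m req ((v ++ [p]).filter (fun p => r < req p)) (half E j b) := by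
              intro j hj b
              have hf : [p].filter (fun p => decide (r < req p)) = [p] := by
                simp; omega
              rw [List.filter_append, hf, mem_run_concat]
              refine Or.inr ⟨hN.trans ?_, hxc⟩
              gcongr
              exact nbCount_mono fun q' _ hq' => ihB E hE j hj b _ hq' (hall q' hq')
            refine ⟨E, hE, ?_, hhalfx⟩
            intro j hj
            have hin : ∀ b, x ∈ {x : Site d |
                sg b * x j ≤ (if b then E.hi j else - E.lo j) + h} := by
              intro b
              apply H j hj b
              obtain ⟨t, rfl⟩ := hpre
              rw [List.filter_append, run_append]
              exact subset_run _ _ (hhalfx j hj b)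
            have h1 := hin true
            have h2 := hin false
            simp only [sg, Set.mem_ofPred_eq, if_true, Bool.false_eq_true, if_false] at h1 h2
            simp only [Blob.fat]
            omega
      refine ⟨fun x hx => ?_, ?_⟩
      · obtain ⟨E, hE, hxE, -⟩ := main x hx
        exact Set.mem_iUnion₂.2 ⟨E, hE, hxE⟩
      · intro E hE j hj b x hx hxE
        obtain ⟨E', hE', hxE', hh⟩ := main x hx
        have := huniq E hE E' hE' x hxE x hxE' (by simp)
        subst this
        exact hh j hj b
  exact (key w List.prefix_rfl).1

/-- The final configuration of the process started from the empty configuration is covered by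
separated boxes, of sides at most `D`, each with at most `k` nucleation points. -/
def Conf (I : Finset (Fin d)) (m : ℕ) (req : Site d × ℕ → ℕ) (l : List (Site d × ℕ)) (k : ℕ)
    (D : ℤ) : Prop :=
  ∃ 𝓕 : Set (Blob d), (∀ E ∈ 𝓕, ∀ E' ∈ 𝓕, E ≠ E' → E.Sep I 1 E') ∧
    run I m req l ∅ ⊆ (⋃ E ∈ 𝓕, E.box I) ∧
    ∀ E ∈ 𝓕, (∀ j ∈ I, E.hi j - E.lo j ≤ D) ∧
      ∀ S : Finset (Site d × ℕ), (∀ p ∈ S, p ∈ l ∧ p.1 ∈ E.box I ∧ req p ≤ m) → S.card ≤ k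

lemma sg_mul_nbr_same (x : Site d) (j : Fin d) (b : Bool) :
    sg b * nbr x (j, b) j = sg b * x j + 1 := by
  have := nbr_apply_self x (j, b)
  simp only at this
  rw [this]
  cases b
  · simp [sg]
    ring
  · simp [sg]

lemma sg_mul_nbr_opp (x : Site d) (j : Fin d) (b : Bool) :
    sg b * nbr x (j, !b) j = sg b * x j - 1 := by
  have := nbr_apply_self x (j, !b)
  simp only at this
  rw [this]
  cases b <;> simp [sg] <;> ring

lemma nbr_mem_cyl {x : Site d} {q : Fin d × Bool} (hq : q.1 ∉ I) : nbr x q ∈ cyl I x :=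
  fun _ hi => nbr_apply_of_ne x q (fun h => hq (h ▸ hi))

/-- The growth out of a half-space reaches a height at most `h`, if the process seen along the
boundary is covered by separated boxes with fewer than `h` nucleation points each. -/
lemma run_halfspace_subset {j : Fin d} (hj : j ∉ I) (b : Bool) (a : ℤ) {w : List (Site d × ℕ)}
    (hw : w.Nodup) {h k : ℕ} {D : ℤ} (hk : k < h) (hnon : ∀ p ∈ w, m < req p)
    (hconf : Conf I (m + 1) req
      (w.filter (fun p => a < sg b * p.1 j ∧ sg b * p.1 j ≤ a + h)) k D) :
    run (insert j I) m req w {x | sg b * x j ≤ a} ⊆ {x | sg b * x j ≤ a + h} := by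
  classical
  obtain ⟨𝓕, hsep, hcov, hE⟩ := hconf
  set slab : Site d × ℕ → Bool :=
    fun p => decide (a < sg b * p.1 j ∧ sg b * p.1 j ≤ a + h) with hslab
  set H₀ : Set (Site d) := {x | sg b * x j ≤ a} with hH₀
  have hH₀c : ∀ x ∈ H₀, cyl (insert j I) x ⊆ H₀ := by
    intro x hx y hy
    have := hy j (Finset.mem_insert_self j I)
    simp only [hH₀, Set.mem_ofPred_eq] at hx ⊢
    rwa [this]
  -- Sets of nuclei over `E` of the collapsed process, which counts `m + 1` free neighbours: their
  -- number will bound the height reached over `E`.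
  set good : List (Site d × ℕ) → Blob d → Finset (Site d × ℕ) → Prop := fun v E S =>
    ∀ p ∈ S, p ∈ v.filter slab ∧ p.1 ∈ E.box I ∧ req p ≤ m + 1 with hgood
  -- Two invariants, proved together: outside the initial half-space the growth lies in the
  -- collapsed process in the directions of `I`, and the height over a box is at most the number of
  -- some of its nuclei.
  have key : ∀ v, v <+: w →
      (∀ x ∈ run (insert j I) m req v H₀, x ∉ H₀ → x ∈ run I (m + 1) req (v.filter slab) ∅) ∧
      (∀ E ∈ 𝓕, ∀ x ∈ run (insert j I) m req v H₀, x ∈ E.box I →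
        ∃ S, good v E S ∧ sg b * x j - a ≤ S.card) := by
    intro v
    induction v using List.reverseRecOn with
    | nil =>
      intro _
      refine ⟨fun x hx hx' => absurd hx hx', fun E _ x hx _ => ⟨∅, by simp [hgood], ?_⟩⟩
      simp only [run_nil, hH₀, Set.mem_ofPred_eq] at hx
      simp only [Finset.card_empty]
      omega
    | append_singleton v p ih =>
      intro hpre
      have hv : v <+: w := (List.prefix_append v [p]).trans hpre
      obtain ⟨ih2, ih3⟩ := ih hv
      have hpw : p ∈ w := hpre.subset (by simp)
      have hpv : p ∉ v := by
        have := hpre.sublist.nodup hw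
        rw [List.nodup_append] at this
        intro hp
        exact this.2.2 p hp p (by simp) rfl
      set σ := run (insert j I) m req v H₀ with hσ
      set σ' := run I (m + 1) req (v.filter slab) ∅ with hσ'
      have hσ'c : ∀ x ∈ σ', cyl I x ⊆ σ' := cyl_subset_run _ (by simp)
      have hσ'f : σ' ⊆ ⋃ E ∈ 𝓕, E.box I := by
        refine Set.Subset.trans ?_ hcov
        obtain ⟨t, rfl⟩ := hv
        rw [List.filter_append, run_append]
        exact subset_run _ _
      have hgm : ∀ E S, good v E S → good (v ++ [p]) E S := by
        intro E S hS q hq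
        obtain ⟨h1, h2, h3⟩ := hS q hq
        refine ⟨?_, h2, h3⟩
        rw [List.filter_append]
        exact List.mem_append_left _ h1
      have hSk : ∀ E ∈ 𝓕, ∀ S, good v E S → S.card ≤ k := by
        intro E hEF S hS
        refine (hE E hEF).2 S fun q hq => ?_
        obtain ⟨h1, h2, h3⟩ := hS q hq
        refine ⟨?_, h2, h3⟩
        obtain ⟨t, rfl⟩ := hv
        rw [List.filter_append]
        exact List.mem_append_left _ h1
      have hheight : ∀ x ∈ σ, sg b * x j - a ≤ k := by
        intro x hx
        by_cases hxH : x ∈ H₀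
        · simp only [hH₀, Set.mem_ofPred_eq] at hxH
          omega
        · obtain ⟨E, hEF, hxE⟩ := Set.mem_iUnion₂.1 (hσ'f (ih2 x hx hxH))
          obtain ⟨S, hS, hle⟩ := ih3 E hEF x hx hxE
          have := hSk E hEF S hS
          omega
      by_cases hold : ∀ x ∈ run (insert j I) m req (v ++ [p]) H₀, x ∈ σ ∨ x ∈ H₀
      · have hold' : ∀ x ∈ run (insert j I) m req (v ++ [p]) H₀, x ∈ σ := fun x hx =>
          (hold x hx).elim id fun hh => subset_run _ _ hh
        refine ⟨fun x hx hxH => ?_, fun E hEF x hx hxE => ?_⟩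
        · rw [List.filter_append, run_append]
          exact subset_run _ _ (ih2 x (hold' x hx) hxH)
        · obtain ⟨S, hS, hle⟩ := ih3 E hEF x (hold' x hx) hxE
          exact ⟨S, hgm E S hS, hle⟩
      push Not at hold
      obtain ⟨x₀, hx₀, hx₀σ, hx₀H⟩ := hold
      rw [mem_run_concat] at hx₀
      obtain ⟨hN, hx₀c⟩ := hx₀.resolve_left hx₀σ
      rw [← hσ] at hN
      have hx₀j : x₀ j = p.1 j := hx₀c j (Finset.mem_insert_self j I)
      have hu : a < sg b * p.1 j := by
        simp only [hH₀, Set.mem_ofPred_eq, not_le] at hx₀H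
        rwa [hx₀j] at hx₀H
      have hpos : 0 < nbCount (insert j I) p.1 σ := by
        have := hnon p hpw
        omega
      have hlat : ∀ q : Fin d × Bool, q.1 ∈ I → nbr p.1 q j = p.1 j := fun q hq =>
        nbr_apply_of_ne _ _ (fun hh => hj (hh ▸ hq))
      have hlatσ' : ∀ q : Fin d × Bool, q.1 ∈ I → nbr p.1 q ∈ σ → nbr p.1 q ∈ σ' := by
        intro q hq hqσ
        refine ih2 _ hqσ ?_
        simp only [hH₀, Set.mem_ofPred_eq, hlat q hq]
        omega
      have hcase : ∀ q : Fin d × Bool, q.1 ∈ insert j I → q.1 ∈ I ∨ q = (j, b) ∨ q = (j, !b) := by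
        rintro ⟨i, b'⟩ hq
        rcases Finset.mem_insert.1 hq with hq | hq
        · simp only at hq
          subst hq
          right
          cases b <;> cases b' <;> simp
        · exact Or.inl hq
      -- Occupied neighbours have height at most `k`, so `p` has height at most `k + 1 ≤ h` and is
      -- seen by the process restricted to the slab. This is the role of `k < h`.
      have hslabp : slab p = true := by
        simp only [hslab, decide_eq_true_eq]
        refine ⟨hu, ?_⟩
        obtain ⟨q, hq, hqσ⟩ := exists_nbr_of_nbCount_pos hpos
        have hh := hheight _ hqσ
        rcases hcase q hq with hq | rfl | rfl
        · rw [hlat q hq] at hh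
          omega
        · rw [sg_mul_nbr_same] at hh
          omega
        · rw [sg_mul_nbr_opp] at hh
          omega
      have hfilt : (v ++ [p]).filter slab = v.filter slab ++ [p] := by
        rw [List.filter_append]
        simp [hslabp]
      have hpnew : p.1 ∈ run I (m + 1) req ((v ++ [p]).filter slab) ∅ := by
        rw [hfilt]
        by_cases hpσ' : p.1 ∈ σ'
        · rw [run_append]
          exact subset_run _ _ hpσ'
        rw [mem_run_concat]
        refine Or.inr ⟨?_, mem_cyl_self _⟩
        -- Beyond the lateral neighbours only the one towards the half-space can count, which is the
        -- extra unit in `m + 1`. An occupied neighbour on the far side would already put the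
        -- cylinder of `p` into the collapsed process.
        have hle : nbCount (insert j I) p.1 σ ≤ nbCount I p.1 σ' + 1 := by
          unfold nbCount
          refine le_trans (Finset.card_le_card (t := insert (j, !b)
            ((I ×ˢ (Finset.univ : Finset Bool)).filter (fun q => nbr p.1 q ∈ σ'))) ?_)
            (Finset.card_insert_le _ _)
          intro q hq
          simp only [Finset.mem_filter, Finset.mem_product, Finset.mem_univ, and_true] at hq
          rw [Finset.mem_insert]
          rcases hcase q hq.1 with hq' | rfl | rfl
          · right
            simp only [Finset.mem_filter, Finset.mem_product, Finset.mem_univ, and_true]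
            exact ⟨hq', hlatσ' q hq' hq.2⟩
          · exfalso
            have h1 : nbr p.1 (j, b) ∈ σ' := by
              refine ih2 _ hq.2 ?_
              simp only [hH₀, Set.mem_ofPred_eq, sg_mul_nbr_same]
              omega
            refine hpσ' (hσ'c _ h1 fun i hi => ?_)
            exact ((nbr_mem_cyl (q := (j, b)) hj) i hi).symm
          · exact Or.inl rfl
        rw [← hσ']
        omega
      refine ⟨fun x hx hxH => ?_, fun E hEF x hx hxE => ?_⟩
      · rw [mem_run_concat] at hx
        rcases hx with hx | ⟨-, hxc⟩
        · rw [hfilt, run_append]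
          exact subset_run _ _ (ih2 x hx hxH)
        · exact cyl_subset_run _ (by simp) _ hpnew
            fun i hi => hxc i (Finset.mem_insert_of_mem hi)
      · rw [mem_run_concat] at hx
        rcases hx with hx | ⟨-, hxc⟩
        · obtain ⟨S, hS, hle⟩ := ih3 E hEF x hx hxE
          exact ⟨S, hgm E S hS, hle⟩
        have hpE : p.1 ∈ E.box I := Blob.cyl_subset_box hxE
          fun i hi => (hxc i (Finset.mem_insert_of_mem hi)).symm
        rw [hxc j (Finset.mem_insert_self j I)]
        -- If the nuclei found so far already account for the height of `p` there is nothing to add.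
        -- Otherwise `p` opens a new layer over `E`, and must be shown to be a nucleus.
        by_cases hex : ∃ S, good v E S ∧ sg b * p.1 j - a ≤ S.card
        · obtain ⟨S, hS, hle⟩ := hex
          exact ⟨S, hgm E S hS, hle⟩
        -- By separation an occupied lateral neighbour lies over the same box, at the height of `p`;
        -- one on the far side is higher still. Either would have made the height of `p` accounted
        -- for. So `p` has a single occupied neighbour, and its requirement is at most `m + 1`.
        have honly : ∀ q : Fin d × Bool, q.1 ∈ insert j I → nbr p.1 q ∈ σ → q = (j, !b) := by
          intro q hq hqσ
          rcases hcase q hq with hq' | rfl | rfl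
          · exfalso
            obtain ⟨E', hE', hqE'⟩ := Set.mem_iUnion₂.1 (hσ'f (hlatσ' q hq' hqσ))
            have hEE : E' = E := by
              by_contra hne
              exact Blob.not_sep_of_near hqE' hpE (abs_nbr_sub_le p.1 q) (hsep E' hE' E hEF hne)
            subst hEE
            obtain ⟨S, hS, hle⟩ := ih3 E' hE' _ hqσ hqE'
            rw [hlat q hq'] at hle
            exact hex ⟨S, hS, hle⟩
          · exfalso
            obtain ⟨S, hS, hle⟩ := ih3 E hEF _ hqσ
              (Blob.cyl_subset_box hpE (nbr_mem_cyl (q := (j, b)) hj))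
            rw [sg_mul_nbr_same] at hle
            exact hex ⟨S, hS, by omega⟩
          · rfl
        have hN1 : nbCount (insert j I) p.1 σ ≤ 1 := by
          unfold nbCount
          rw [Finset.card_le_one]
          intro q hq q' hq'
          simp only [Finset.mem_filter, Finset.mem_product, Finset.mem_univ, and_true] at hq hq'
          rw [honly q hq.1 hq.2, honly q' hq'.1 hq'.2]
        obtain ⟨q, hq, hqσ⟩ := exists_nbr_of_nbCount_pos hpos
        have := honly q hq hqσ
        subst this
        obtain ⟨S, hS, hle⟩ := ih3 E hEF _ hqσ
          (Blob.cyl_subset_box hpE (nbr_mem_cyl (q := (j, !b)) hj))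
        rw [sg_mul_nbr_opp] at hle
        refine ⟨insert p S, ?_, ?_⟩
        · intro q hq
          rcases Finset.mem_insert.1 hq with rfl | hq
          · refine ⟨?_, hpE, by omega⟩
            rw [hfilt]
            simp
          · exact hgm E S hS q hq
        · have hpS : p ∉ S := fun hp => hpv (List.mem_of_mem_filter (hS p hp).1)
          rw [Finset.card_insert_of_notMem hpS]
          push_cast
          omega
  obtain ⟨k2, k3⟩ := key w List.prefix_rfl
  intro x hx
  by_cases hxH : x ∈ H₀
  · simp only [hH₀, Set.mem_ofPred_eq] at hxH ⊢
    omega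
  · obtain ⟨E, hEF, hxE⟩ := Set.mem_iUnion₂.1 (hcov (k2 x hx hxH))
    obtain ⟨S, hS, hle⟩ := k3 E hEF x hx hxE
    have := (hE E hEF).2 S hS
    simp only [Set.mem_ofPred_eq]
    omega

end deterministic

/-! ### Merging boxes and covering the growth window by window -/

/-- The points of the blob are points of `L` in the box, of requirement at most `r`; they are at
most `k` in number, and the sides of the box are controlled by their number. -/
def Blob.Controlled {d : ℕ} (I : Finset (Fin d)) (req : Site d × ℕ → ℕ) (L : List (Site d × ℕ))
    (r k : ℕ) (g A : ℤ) (E : Blob d) : Prop :=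
  E.pts.Nonempty ∧ (∀ p ∈ E.pts, p ∈ L ∧ req p ≤ r ∧ p.1 ∈ E.box I) ∧ E.pts.card ≤ k ∧
    ∀ j ∈ I, E.hi j - E.lo j + g ≤ E.pts.card * A

/-- Each box with sides at most `D` contains at most `k` points of `L` of requirement at most
`r`. -/
def SparseIn {d : ℕ} (I : Finset (Fin d)) (req : Site d × ℕ → ℕ) (L : List (Site d × ℕ))
    (r k : ℕ) (D : ℤ) : Prop :=
  ∀ E : Blob d, (∀ j ∈ I, E.hi j - E.lo j ≤ D) →
    (∀ p ∈ E.pts, p ∈ L ∧ req p ≤ r ∧ p.1 ∈ E.box I) → E.pts.card ≤ k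

section deterministic

variable {d : ℕ} {I : Finset (Fin d)} {m : ℕ} {req : Site d × ℕ → ℕ}

/-- Boxes which are not separated are merged. -/
lemma exists_merge {L : List (Site d × ℕ)} {r k : ℕ} {g A D : ℤ} (hg : 0 ≤ g)
    (hA : 0 ≤ A) (hD : 2 * k * A ≤ D) (hL : SparseIn I req L r k D) (n : ℕ) :
    ∀ 𝓕 : Finset (Blob d), 𝓕.card = n → (∀ E ∈ 𝓕, E.Controlled I req L r k g A) →
      (∀ E ∈ 𝓕, ∀ E' ∈ 𝓕, E ≠ E' → Disjoint E.pts E'.pts) →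
      ∃ 𝓕' : Finset (Blob d), (∀ E ∈ 𝓕', E.Controlled I req L r k g A) ∧
        (∀ E ∈ 𝓕', ∀ E' ∈ 𝓕', E ≠ E' → Disjoint E.pts E'.pts) ∧
        (∀ E ∈ 𝓕', ∀ E' ∈ 𝓕', E ≠ E' → E.Sep I g E') ∧
        (∀ E ∈ 𝓕', ∀ p ∈ E.pts, ∃ E' ∈ 𝓕, p ∈ E'.pts) ∧
        (⋃ E ∈ 𝓕, E.box I) ⊆ ⋃ E ∈ 𝓕', E.box I := by
  classical
  induction n using Nat.strong_induction_on with
  | _ n ih =>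
  intro 𝓕 hcard hok hdis
  by_cases hsep : ∀ E ∈ 𝓕, ∀ E' ∈ 𝓕, E ≠ E' → E.Sep I g E'
  · exact ⟨𝓕, hok, hdis, hsep, fun E hE p hp => ⟨E, hE, hp⟩, le_rfl⟩
  push Not at hsep
  obtain ⟨E, hE, E', hE', hne, hns⟩ := hsep
  set N : Blob d := ⟨fun j => min (E.lo j) (E'.lo j), fun j => max (E.hi j) (E'.hi j),
    E.pts ∪ E'.pts⟩ with hN
  have hEN : E.box I ⊆ N.box I := fun x hx j hj =>
    ⟨(min_le_left _ _).trans (hx j hj).1, (hx j hj).2.trans (le_max_left _ _)⟩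
  have hEN' : E'.box I ⊆ N.box I := fun x hx j hj =>
    ⟨(min_le_right _ _).trans (hx j hj).1, (hx j hj).2.trans (le_max_right _ _)⟩
  obtain ⟨⟨p, hp⟩, hEp, hEk, hEs⟩ := hok E hE
  obtain ⟨⟨p', hp'⟩, hEp', hEk', hEs'⟩ := hok E' hE'
  have hNpts : ∀ p ∈ N.pts, p ∈ L ∧ req p ≤ r ∧ p.1 ∈ N.box I := by
    intro q hq
    rcases Finset.mem_union.1 hq with hq | hq
    · exact ⟨(hEp q hq).1, (hEp q hq).2.1, hEN (hEp q hq).2.2⟩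
    · exact ⟨(hEp' q hq).1, (hEp' q hq).2.1, hEN' (hEp' q hq).2.2⟩
  have hNcard : N.pts.card = E.pts.card + E'.pts.card :=
    Finset.card_union_of_disjoint (hdis E hE E' hE' hne)
  -- The side of the hull of two boxes with gap at most `g` is at most the sum of their sides plus
  -- `g`. Hence side plus `g` is subadditive under merging, like the number of points.
  have hNside : ∀ j ∈ I, N.hi j - N.lo j + g ≤ N.pts.card * A := by
    intro j hj
    have h1 := hEs j hj
    have h2 := hEs' j hj
    have h3 := (hEp p hp).2.2 j hj
    have h4 := (hEp' p' hp').2.2 j hj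
    have h5 : ¬ (E.hi j + g < E'.lo j ∨ E'.hi j + g < E.lo j) := fun hh => hns ⟨j, hj, hh⟩
    rw [hNcard]
    push_cast
    rw [add_mul]
    simp only [hN]
    omega
  -- A priori the union has up to `2 * k` points, so its sides are at most `2 * k * A ≤ D`.
  -- Sparseness at the scale `D` then brings the number of points back to `k`.
  have hNk : N.pts.card ≤ k := by
    refine hL N (fun j hj => ?_) hNpts
    have h1 := hNside j hj
    have h2 : (N.pts.card : ℤ) * A ≤ (2 * k) * A := by
      refine mul_le_mul_of_nonneg_right ?_ hA
      rw [hNcard]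
      push_cast
      omega
    omega
  have hNok : N.Controlled I req L r k g A :=
    ⟨⟨p, Finset.mem_union_left _ hp⟩, hNpts, hNk, hNside⟩
  set 𝓖 := insert N ((𝓕.erase E).erase E') with h𝓖
  have hE'2 : E' ∈ 𝓕.erase E := Finset.mem_erase.2 ⟨hne.symm, hE'⟩
  have hlt : 𝓖.card < n := by
    have h1 := Finset.card_insert_le N ((𝓕.erase E).erase E')
    rw [Finset.card_erase_of_mem hE'2, Finset.card_erase_of_mem hE] at h1
    rw [← h𝓖] at h1
    have h2 : 1 < 𝓕.card := Finset.one_lt_card.2 ⟨E, hE, E', hE', hne⟩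
    omega
  have hmem : ∀ F ∈ 𝓖, F = N ∨ (F ∈ 𝓕 ∧ F ≠ E ∧ F ≠ E') := by
    intro F hF
    simp only [h𝓖, Finset.mem_insert, Finset.mem_erase] at hF
    tauto
  have hNdis : ∀ F ∈ 𝓕, F ≠ E → F ≠ E' → Disjoint N.pts F.pts := by
    intro F hF h1 h2
    simp only [hN, Finset.disjoint_union_left]
    exact ⟨hdis E hE F hF h1.symm, hdis E' hE' F hF h2.symm⟩
  obtain ⟨𝓕', h1, h2, h3, h4, h5⟩ := ih 𝓖.card hlt 𝓖 rfl (by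
      intro F hF
      rcases hmem F hF with rfl | ⟨hF, -, -⟩
      · exact hNok
      · exact hok F hF) (by
      intro F hF F' hF' hFF
      rcases hmem F hF with rfl | ⟨hF, hF1, hF2⟩
      · rcases hmem F' hF' with rfl | ⟨hF', hF1', hF2'⟩
        · exact absurd rfl hFF
        · exact hNdis F' hF' hF1' hF2'
      · rcases hmem F' hF' with rfl | ⟨hF', hF1', hF2'⟩
        · exact (hNdis F hF hF1 hF2).symm
        · exact hdis F hF F' hF' hFF)
  refine ⟨𝓕', h1, h2, h3, ?_, ?_⟩
  · intro F hF q hq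
    obtain ⟨F', hF', hq'⟩ := h4 F hF q hq
    rcases hmem F' hF' with rfl | ⟨hF', -, -⟩
    · rcases Finset.mem_union.1 hq' with hq' | hq'
      · exact ⟨E, hE, hq'⟩
      · exact ⟨E', hE', hq'⟩
    · exact ⟨F', hF', hq'⟩
  · refine Set.Subset.trans ?_ h5
    intro x hx
    obtain ⟨F, hF, hxF⟩ := Set.mem_iUnion₂.1 hx
    by_cases hFE : F = E
    · subst hFE
      exact Set.mem_iUnion₂.2 ⟨N, by simp [h𝓖], hEN hxF⟩
    by_cases hFE' : F = E'
    · subst hFE'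
      exact Set.mem_iUnion₂.2 ⟨N, by simp [h𝓖], hEN' hxF⟩
    · exact Set.mem_iUnion₂.2 ⟨F, by simp [h𝓖, hF, hFE, hFE'], hxF⟩

/-- The process started from the empty configuration is covered by separated boxes whose sides are
controlled by the number of their points of requirement at most `r`, if in each of the successive
windows `ws` a half-space grows by at most `h`. -/
lemma exists_cover {L : List (Site d × ℕ)} {r k h : ℕ} {D : ℤ} (hmr : m ≤ r) (hk : 0 < k)
    (ws : List (List (Site d × ℕ))) (hnd : ws.flatten.Nodup) (hsub : ws.flatten ⊆ L)
    (hD : 2 * k * (2 * h + 2 + 2 * h * (ws.length : ℤ)) ≤ D) (hL : SparseIn I req L r k D)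
    (H : ∀ w ∈ ws, ∀ j ∈ I, ∀ (b : Bool) (a : ℤ),
      run I m req (w.filter (fun p => r < req p)) {x | sg b * x j ≤ a} ⊆
        {x | sg b * x j ≤ a + h}) :
    ∃ 𝓕 : Finset (Blob d),
      (∀ E ∈ 𝓕, E.Controlled I req L r k (2 * h + 2) (2 * h + 2 + 2 * h * (ws.length : ℤ)) ∧
        ∀ p ∈ E.pts, p ∈ ws.flatten) ∧
      (∀ E ∈ 𝓕, ∀ E' ∈ 𝓕, E ≠ E' → Disjoint E.pts E'.pts) ∧
      (∀ E ∈ 𝓕, ∀ E' ∈ 𝓕, E ≠ E' → E.Sep I 2 E') ∧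
      run I m req ws.flatten ∅ ⊆ ⋃ E ∈ 𝓕, E.box I := by
  classical
  induction ws using List.reverseRecOn with
  | nil => exact ⟨∅, by simp⟩
  | append_singleton ws w ih =>
    simp only [List.flatten_append, List.flatten_cons, List.flatten_nil, List.append_nil,
      List.length_append, List.length_cons, List.length_nil] at hnd hsub hD ⊢
    set A : ℤ := 2 * h + 2 + 2 * h * (ws.length : ℤ) with hAdef
    have hA : 0 ≤ A := by positivity
    have hA' : (2 * h + 2 + 2 * h * ((ws.length + (0 + 1) : ℕ) : ℤ)) = A + 2 * h := by
      push_cast [hAdef]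
      ring
    rw [hA'] at hD ⊢
    have hkh : (0 : ℤ) ≤ 2 * k * (2 * h) := by positivity
    have hDA : 2 * (k : ℤ) * A ≤ D := by linarith
    rw [List.nodup_append] at hnd
    obtain ⟨𝓕, hok, hdis, -, hcov⟩ := ih hnd.1
      (fun p hp => hsub (List.mem_append_left _ hp)) hDA
      (fun v hv => H v (List.mem_append_left _ hv))
    -- The points of requirement at most `r` of the new window enter as one-site boxes already at
    -- the start of the window; by monotonicity this can only enlarge the process.
    set sing : Site d × ℕ → Blob d := fun p => ⟨p.1, p.1, {p}⟩ with hsing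
    set 𝓢 : Finset (Blob d) := (w.toFinset.filter (fun p => req p ≤ r)).image sing with h𝓢
    have h𝓢mem : ∀ E ∈ 𝓢, ∃ p ∈ w, req p ≤ r ∧ E = sing p := by
      intro E hE
      simp only [h𝓢, Finset.mem_image, Finset.mem_filter, List.mem_toFinset] at hE
      obtain ⟨p, ⟨h1, h2⟩, h3⟩ := hE
      exact ⟨p, h1, h2, h3.symm⟩
    have hcross : ∀ E ∈ 𝓕, ∀ E' ∈ 𝓢, Disjoint E.pts E'.pts := by
      intro E hE E' hE'
      obtain ⟨p, hp, -, rfl⟩ := h𝓢mem E' hE'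
      simp only [hsing, Finset.disjoint_singleton_right]
      exact fun hpE => hnd.2.2 p ((hok E hE).2 p hpE) p hp rfl
    obtain ⟨𝓖, g1, g2, g3, g4, g5⟩ := exists_merge (I := I) (req := req) (L := L) (r := r) (k := k)
      (g := 2 * h + 2) (A := A) (D := D) (by positivity) hA hDA hL _ (𝓕 ∪ 𝓢) rfl (by
        intro E hE
        rcases Finset.mem_union.1 hE with hE | hE
        · exact (hok E hE).1
        · obtain ⟨p, hp, hpr, rfl⟩ := h𝓢mem E hE
          refine ⟨by simp [hsing], ?_, ?_, ?_⟩
          · intro q hq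
            simp only [hsing, Finset.mem_singleton] at hq
            subst hq
            exact ⟨hsub (List.mem_append_right _ hp), hpr, fun j _ => ⟨le_rfl, le_rfl⟩⟩
          · simp only [hsing, Finset.card_singleton]
            omega
          · intro j _
            have : (0 : ℤ) ≤ 2 * h * (ws.length : ℤ) := by positivity
            simp only [hsing, Finset.card_singleton, hAdef]
            push_cast
            linarith) (by
        intro E hE E' hE' hne
        rcases Finset.mem_union.1 hE with hE | hE <;> rcases Finset.mem_union.1 hE' with hE' | hE'
        · exact hdis E hE E' hE' hne
        · exact hcross E hE E' hE'
        · exact (hcross E' hE' E hE).symm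
        · obtain ⟨p, hp, -, rfl⟩ := h𝓢mem E hE
          obtain ⟨q, hq, -, rfl⟩ := h𝓢mem E' hE'
          simp only [hsing, Finset.disjoint_singleton]
          rintro rfl
          exact hne rfl)
    have hgrow := run_subset_fat (I := I) (m := m) (req := req) (𝓖 : Set (Blob d)) h r hmr
      (fun E hE E' hE' hne => g3 E hE E' hE' hne) w (by
        intro p hp hpr
        simp only [Finset.mem_coe]
        apply g5
        refine Set.mem_iUnion₂.2 ⟨sing p, Finset.mem_union_right _ ?_, fun j _ => ⟨le_rfl, le_rfl⟩⟩
        simp only [h𝓢, Finset.mem_image, Finset.mem_filter, List.mem_toFinset]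
        exact ⟨p, ⟨hp, hpr⟩, rfl⟩) (H w (List.mem_append_right _ (by simp)))
    simp only [Finset.mem_coe] at hgrow
    refine ⟨𝓖.image (Blob.fat h), ?_, ?_, ?_, ?_⟩
    · intro E hE
      obtain ⟨E, hEG, rfl⟩ := Finset.mem_image.1 hE
      obtain ⟨h1, h2, h3, h4⟩ := g1 E hEG
      refine ⟨⟨h1, fun p hp => ⟨(h2 p hp).1, (h2 p hp).2.1,
        Blob.box_subset_fat (h2 p hp).2.2⟩, h3, ?_⟩, ?_⟩
      · intro j hj
        have h5 := h4 j hj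
        -- The enlargement adds `2 * h` to each side. Every box has at least one point, so raising
        -- the allowance per point by `2 * h` pays for it.
        have h6 : (1 : ℤ) ≤ E.pts.card := by exact_mod_cast Finset.card_pos.2 h1
        have h7 : (2 * h : ℤ) ≤ E.pts.card * (2 * h) := by nlinarith
        simp only [Blob.fat]
        linarith
      · intro p hp
        obtain ⟨E', hE', hpE'⟩ := g4 E hEG p hp
        rcases Finset.mem_union.1 hE' with hE' | hE'
        · exact List.mem_append_left _ ((hok E' hE').2 p hpE')
        · obtain ⟨q, hq, -, rfl⟩ := h𝓢mem E' hE'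
          simp only [hsing, Finset.mem_singleton] at hpE'
          subst hpE'
          exact List.mem_append_right _ hq
    · intro E hE E' hE' hne
      obtain ⟨E, hEG, rfl⟩ := Finset.mem_image.1 hE
      obtain ⟨E', hEG', rfl⟩ := Finset.mem_image.1 hE'
      exact g2 E hEG E' hEG' fun hh => hne (by rw [hh])
    · intro E hE E' hE' hne
      obtain ⟨E, hEG, rfl⟩ := Finset.mem_image.1 hE
      obtain ⟨E', hEG', rfl⟩ := Finset.mem_image.1 hE'
      exact Blob.sep_of_fat _ (g3 E hEG E' hEG' fun hh => hne (by rw [hh]))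
    · rw [run_append]
      simp only [Finset.mem_image, Set.iUnion_exists, Set.biUnion_and', Set.iUnion_iUnion_eq_right]
      refine (run_mono w (hcov.trans ?_)).trans hgrow
      refine Set.Subset.trans ?_ g5
      exact Set.biUnion_subset_biUnion_left fun E hE => Finset.mem_union_left _ hE

/-- The covering by separated boxes, over successive windows. -/
lemma conf_of_windows {r k h : ℕ} {D : ℤ} (hmr : m ≤ r) (hk : 0 < k)
    (ws : List (List (Site d × ℕ))) (hnd : ws.flatten.Nodup)
    (hD : 2 * k * (2 * h + 2 + 2 * h * (ws.length : ℤ)) ≤ D)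
    (hL : SparseIn I req ws.flatten r k D)
    (H : ∀ w ∈ ws, ∀ j ∈ I, ∀ (b : Bool) (a : ℤ),
      run I m req (w.filter (fun p => r < req p)) {x | sg b * x j ≤ a} ⊆
        {x | sg b * x j ≤ a + h}) :
    Conf I m req ws.flatten k D := by
  obtain ⟨𝓕, hok, -, hsep, hcov⟩ := exists_cover hmr hk ws hnd (fun _ h => h) hD hL H
  have hside : ∀ E ∈ 𝓕, ∀ j ∈ I, E.hi j - E.lo j ≤ D := by
    intro E hE j hj
    obtain ⟨-, -, h3, h4⟩ := (hok E hE).1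
    have h5 := h4 j hj
    set A : ℤ := 2 * h + 2 + 2 * h * (ws.length : ℤ) with hA
    have hA0 : 0 ≤ A := by positivity
    have h6 : (E.pts.card : ℤ) * A ≤ (2 * k) * A := by
      refine mul_le_mul_of_nonneg_right ?_ hA0
      omega
    omega
  refine ⟨𝓕, fun E hE E' hE' hne => (hsep E hE E' hE' hne).mono (by norm_num), hcov,
    fun E hE => ⟨hside E hE, fun S hS => ?_⟩⟩
  exact hL ⟨E.lo, E.hi, S⟩ (hside E hE) fun p hp =>
    ⟨(hS p hp).1, (hS p hp).2.2.trans hmr, (hS p hp).2.1⟩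

/-- Without points of requirement at most `m + 1`, half-spaces do not grow. -/
lemma run_halfspace_subset_self (j : Fin d) (b : Bool) (a : ℤ)
    {w : List (Site d × ℕ)} (hnon : ∀ p ∈ w, m + 1 < req p) (hj : j ∈ I) :
    run I m req w {x | sg b * x j ≤ a} ⊆ {x | sg b * x j ≤ a} := by
  induction w using List.reverseRecOn with
  | nil => simp
  | append_singleton w p ih =>
    have ih := ih fun q hq => hnon q (List.mem_append_left _ hq)
    intro x hx
    rw [mem_run_concat] at hx
    rcases hx with hx | ⟨hN, hxc⟩
    · exact ih hx
    simp only [Set.mem_ofPred_eq]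
    rw [hxc j hj]
    by_contra hp
    -- A site outside an invariant half-space touches it only through the neighbour facing it, so at
    -- most `m + 1` neighbours are ever counted there.
    have h1 : nbCount I p.1 (run I m req w {x | sg b * x j ≤ a}) ≤ 1 := by
      have honly : ∀ q : Fin d × Bool, nbr p.1 q ∈ run I m req w {x | sg b * x j ≤ a} →
          q = (j, !b) := by
        intro q hq
        have h2 : sg b * nbr p.1 q j ≤ a := ih hq
        obtain ⟨i, b'⟩ := q
        by_cases hij : j = i
        · subst hij
          rcases Bool.eq_or_eq_not b' b with rfl | rfl
          · rw [sg_mul_nbr_same] at h2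
            omega
          · rfl
        · rw [nbr_apply_of_ne _ _ hij] at h2
          omega
      unfold nbCount
      rw [Finset.card_le_one]
      intro q hq q' hq'
      simp only [Finset.mem_filter] at hq hq'
      rw [honly q hq.2, honly q' hq'.2]
    have h3 := hnon p (by simp)
    omega

/-- A site of a covering box separated from the others is occupied only after a point of the box
has been occupied without occupied neighbours. -/
lemma exists_nucleation {𝓕 : Set (Blob d)} (hsep : ∀ E ∈ 𝓕, ∀ E' ∈ 𝓕, E ≠ E' → E.Sep I 1 E')
    {l : List (Site d × ℕ)} (hcov : run I m req l ∅ ⊆ (⋃ E ∈ 𝓕, E.box I)) {E : Blob d}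
    (hE : E ∈ 𝓕) {x : Site d} (hx : x ∈ run I m req l ∅) (hxE : x ∈ E.box I) :
    ∃ p ∈ l, p.1 ∈ E.box I ∧ req p ≤ m := by
  induction l using List.reverseRecOn generalizing x with
  | nil => simp at hx
  | append_singleton l p ih =>
    have hcov' : run I m req l ∅ ⊆ (⋃ E ∈ 𝓕, E.box I) := by
      refine Set.Subset.trans ?_ hcov
      rw [run_append]
      exact subset_run _ _
    have ih' : ∀ y ∈ run I m req l ∅, y ∈ E.box I →
        ∃ p' ∈ l ++ [p], p'.1 ∈ E.box I ∧ req p' ≤ m := fun y hy hyE => by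
      obtain ⟨p', h1, h2⟩ := ih hcov' hy hyE
      exact ⟨p', List.mem_append_left _ h1, h2⟩
    rw [mem_run_concat] at hx
    rcases hx with hx | ⟨hN, hxc⟩
    · exact ih' x hx hxE
    have hpE : p.1 ∈ E.box I := Blob.cyl_subset_box hxE fun j hj => (hxc j hj).symm
    by_cases hpos : 0 < nbCount I p.1 (run I m req l ∅)
    · obtain ⟨q, -, hq⟩ := exists_nbr_of_nbCount_pos hpos
      obtain ⟨E', hE', hqE'⟩ := Set.mem_iUnion₂.1 (hcov' hq)
      have hEE : E' = E := by
        by_contra hne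
        exact Blob.not_sep_of_near hqE' hpE (abs_nbr_sub_le p.1 q) (hsep E' hE' E hE hne)
      exact ih' _ hq (hEE ▸ hqE')
    · exact ⟨p, by simp, hpE, by omega⟩

/-! ### The induction on the number of free directions -/

/-- The windows `(s + iT, s + (i + 1)T]`, `i < M`, of a list. -/
def windows {α : Type*} (τ : α → ℝ) (l : List α) (s T : ℝ) (M : ℕ) : List (List α) :=
  (List.range M).map fun i : ℕ =>
    l.filter (fun p => s + (i : ℝ) * T < τ p ∧ τ p ≤ s + (i + 1 : ℕ) * T)

lemma windows_flatten {α : Type*} {τ : α → ℝ} {l : List α}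
    (hl : l.Pairwise (fun p q => τ p ≤ τ q)) {s T : ℝ} (hT : 0 ≤ T) {M : ℕ}
    (h0 : ∀ p ∈ l, s < τ p) (h1 : ∀ p ∈ l, τ p ≤ s + M * T) :
    (windows τ l s T M).flatten = l := by
  have key : ∀ N : ℕ, (windows τ l s T N).flatten = l.filter (fun p => τ p ≤ s + N * T) := by
    intro N
    induction N with
    | zero =>
      symm
      simp only [windows, List.range_zero, List.map_nil, List.flatten_nil, List.filter_eq_nil_iff]
      intro p hp
      simpa using h0 p hp
    | succ N ih =>
      have : windows τ l s T (N + 1) = windows τ l s T N ++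
          [l.filter (fun p => s + N * T < τ p ∧ τ p ≤ s + (N + 1 : ℕ) * T)] := by
        simp [windows, List.range_succ]
      rw [this, List.flatten_append, ih, List.flatten_singleton]
      symm
      apply filter_le_append_filter hl
      push_cast
      nlinarith
  rw [key]
  exact List.filter_eq_self.2 fun p hp => by simpa using h1 p hp

/-- The data of the hierarchy of scales: at the level `n`, processes in `n` directions over time
intervals of length `T n` are covered by separated boxes with sides at most `D n`, if there are few
points of requirement at most `d - n + θ n` in all boxes with sides at most `D n` in these
directions and less than `h` in the others. -/
theorem conf_of_sparse (τ : Site d × ℕ → ℝ) (V : Set (Site d × ℕ)) (T : ℕ → ℝ) (D : ℕ → ℤ)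
    (M θ : ℕ → ℕ) (k h : ℕ) (hk : 0 < k) (hkh : k < h) (hT : ∀ n, 0 < T n)
    (hθ : ∀ n ≤ d, (θ n = 1 ∧ 2 * k * (2 : ℤ) ≤ D n) ∨
      (θ n = 0 ∧ (n = 0 ∨ (T n ≤ M n * T (n - 1) ∧
        2 * k * (2 * h + 2 + 2 * h * (M n : ℤ)) ≤ D n))))
    (s₀ s₁ : ℝ)
    (hsparse : ∀ (I : Finset (Fin d)) (lo hi : Site d) (s : ℝ) (S : Finset (Site d × ℕ)),
      s₀ ≤ s → s ≤ s₁ → (∀ j ∈ I, hi j - lo j ≤ D I.card) → (∀ j ∉ I, hi j - lo j < h) →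
      (∀ p ∈ S, p ∈ V ∧ s < τ p ∧ τ p ≤ s + T I.card ∧ req p ≤ d - I.card + θ I.card ∧
        ∀ j, lo j ≤ p.1 j ∧ p.1 j ≤ hi j) → S.card ≤ k)
    (n : ℕ) : ∀ (I : Finset (Fin d)), I.card = n →
    ∀ (l : List (Site d × ℕ)) (s : ℝ) (base : Site d),
      l.Nodup → l.Pairwise (fun p q => τ p ≤ τ q) → s₀ ≤ s → (∀ p ∈ l, τ p ≤ s₁) → s ≤ s₁ →
      (∀ p ∈ l, p ∈ V ∧ s < τ p ∧ τ p ≤ s + T n ∧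
        ∀ j ∉ I, base j < p.1 j ∧ p.1 j ≤ base j + h) →
      Conf I (d - n) req l k (D n) := by
  induction n with
  | zero =>
    intro I hI l s base hnd hsort hs hs1 hss hl
    rw [Finset.card_eq_zero] at hI
    subst hI
    -- With no free direction a box carries no constraint, so one box is the whole lattice. The
    -- points themselves are confined to a cube of side `h`, where sparseness applies.
    refine ⟨{⟨0, 0, ∅⟩}, by simp, by intro x _; simp [Blob.box], ?_⟩
    intro E hE
    refine ⟨by simp, fun S hS => ?_⟩
    refine hsparse ∅ (fun j => base j + 1) (fun j => base j + h) s S hs hss (by simp)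
      (fun j _ => by omega) fun p hp => ?_
    obtain ⟨h1, h2, h3⟩ := hS p hp
    obtain ⟨h4, h5, h6, h7⟩ := hl p h1
    refine ⟨h4, h5, h6, ?_, fun j => ?_⟩
    · simp only [Finset.card_empty]
      omega
    · have := h7 j (by simp)
      omega
  | succ n ih =>
    intro I hI l s base hnd hsort hs hs1 hss hl
    have hnd' : n + 1 ≤ d := by
      rw [← hI]
      simpa using Finset.card_le_univ I
    -- A box in the directions of `I` is completed by the slab of thickness `h` that contains the
    -- points of `l` in the other directions.
    have hsp : ∀ r, r ≤ d - (n + 1) + θ (n + 1) → SparseIn I req l r k (D (n + 1)) := by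
      intro r hr E hE hpE
      refine hsparse I (fun j => if j ∈ I then E.lo j else base j + 1)
        (fun j => if j ∈ I then E.hi j else base j + h) s E.pts hs hss ?_ ?_ fun p hp => ?_
      · intro j hj
        simp only [hj, if_true, hI]
        exact hE j hj
      · intro j hj
        simp only [hj, if_false]
        omega
      · obtain ⟨h1, h2, h3⟩ := hpE p hp
        obtain ⟨h4, h5, h6, h7⟩ := hl p h1
        rw [hI]
        refine ⟨h4, h5, h6, h2.trans hr, fun j => ?_⟩
        by_cases hj : j ∈ I
        · simp only [hj, if_true]
          exact h3 j hj
        · simp only [hj, if_false]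
          have := h7 j hj
          omega
    rcases hθ (n + 1) hnd' with ⟨hθ1, hD⟩ | ⟨hθ0, hh⟩
    -- Case `θ = 1`: points of requirement up to one more than the free count are treated as nuclei.
    -- Without them half-spaces do not move, so a single window with `h = 0` suffices.
    · have hfl : [l].flatten = l := List.flatten_singleton
      rw [← hfl]
      refine conf_of_windows (r := d - (n + 1) + 1) (h := 0) (by omega) hk [l] (by rwa [hfl]) ?_
        (by rw [hfl]; exact hsp _ (by omega)) ?_
      · simpa [mul_assoc] using hD
      · intro w hw j hj b a
        simp only [Nat.cast_zero, add_zero]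
        refine run_halfspace_subset_self j b a (fun p hp => ?_) hj
        simpa using (List.mem_filter.1 hp).2
    -- Case `θ = 0`: the time is cut into `M (n + 1)` windows of length `T n`, in each of which the
    -- claim at level `n` bounds the growth of half-spaces.
    · obtain ⟨hTM, hD⟩ := hh.resolve_left (by omega)
      simp only [Nat.add_sub_cancel] at hTM
      have hfl : (windows τ l s (T n) (M (n + 1))).flatten = l :=
        windows_flatten hsort (hT n).le (fun p hp => (hl p hp).2.1)
          fun p hp => (hl p hp).2.2.1.trans (by linarith)
      have hlen : (windows τ l s (T n) (M (n + 1))).length = M (n + 1) := by simp [windows]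
      rw [← hfl]
      refine conf_of_windows (r := d - (n + 1)) (h := h) le_rfl hk _ (by rwa [hfl])
        (by rwa [hlen]) (by rw [hfl]; exact hsp _ (by omega)) ?_
      intro w hw j hj b a
      simp only [windows, List.mem_map, List.mem_range] at hw
      obtain ⟨i, hi, rfl⟩ := hw
      set v := (l.filter (fun p => s + i * T n < τ p ∧ τ p ≤ s + (i + 1 : ℕ) * T n)).filter
        (fun p => d - (n + 1) < req p) with hv
      have hvsub : v.Sublist l := List.filter_sublist.trans List.filter_sublist
      have hvmem : ∀ p ∈ v, p ∈ l ∧ s + i * T n < τ p ∧ τ p ≤ s + (i + 1 : ℕ) * T n ∧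
          d - (n + 1) < req p := by
        intro p hp
        simp only [hv, List.mem_filter, decide_eq_true_eq] at hp
        tauto
      have hIj : insert j (I.erase j) = I := Finset.insert_erase hj
      have hcardE : (I.erase j).card = n := by rw [Finset.card_erase_of_mem hj, hI]; rfl
      by_cases hemp : v = []
      · rw [hemp]
        intro x hx
        simp only [run_nil, Set.mem_ofPred_eq] at hx ⊢
        omega
      obtain ⟨p₀, hp₀⟩ := List.exists_mem_of_ne_nil v hemp
      have hiT : 0 ≤ i * T n := by have := hT n; positivity
      -- The direction `j` ceases to be free: the points considered are those in the layer of
      -- thickness `h` in front of the half-space. For the negative orientation, `a < -x j ≤ a + h`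
      -- means that `x j` lies in an interval of `h` integers above `-a - h - 1`.
      have hnext := ih (I.erase j) hcardE
        (v.filter (fun p => a < sg b * p.1 j ∧ sg b * p.1 j ≤ a + h)) (s + i * T n)
        (Function.update base j (if b then a else -a - h - 1))
        ((List.filter_sublist.trans hvsub).nodup hnd)
        (hsort.sublist (List.filter_sublist.trans hvsub)) (by linarith)
        (fun p hp => hs1 p (hvmem p (List.mem_of_mem_filter hp)).1)
        ((hvmem p₀ hp₀).2.1.le.trans (hs1 p₀ (hvmem p₀ hp₀).1)) (by
          intro p hp
          simp only [List.mem_filter, decide_eq_true_eq] at hp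
          obtain ⟨hpv, hp1, hp2⟩ := hp
          obtain ⟨h1, h2, h3, h4⟩ := hvmem p hpv
          refine ⟨(hl p h1).1, h2, ?_, ?_⟩
          · push_cast at h3
            linarith
          · intro j' hj'
            by_cases hjj : j' = j
            · subst hjj
              simp only [Function.update_self]
              cases b <;> simp [sg] at hp1 hp2 ⊢ <;> omega
            · rw [Function.update_of_ne hjj]
              exact (hl p h1).2.2.2 j' fun hjI => hj' (Finset.mem_erase.2 ⟨hjj, hjI⟩))
      -- One free direction fewer is one free neighbour more, matching the `m + 1` of the half-space
      -- comparison.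
      have hm : d - n = d - (n + 1) + 1 := by omega
      rw [hm] at hnext
      have := run_halfspace_subset (I := I.erase j) (m := d - (n + 1)) (req := req)
        (Finset.notMem_erase j I) b a (hvsub.nodup hnd) hkh (fun p hp => (hvmem p hp).2.2.2) hnext
      rwa [hIj] at this

end deterministic

/-! ### The process in terms of requirements -/

section deterministic

variable {d : ℕ} {I : Finset (Fin d)} {m : ℕ} {req : Site d × ℕ → ℕ}

/-- The number of occupied neighbours needed for the point `p` to be effective. -/
def reqOf (c : ℕ → ℝ) (U : Site d → ℕ → ℝ) (p : Site d × ℕ) : ℕ :=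
  ((Finset.range (2 * d + 1)).filter (fun n => c n < U p.1 p.2)).card

/-- Since the rates are non-decreasing, the `n` with `c n < U` form an initial segment, whose length
is the first `n` with `U ≤ c n`. A mark above all rates gets the requirement `2 * d + 1`, which is
never met. -/
lemma reqOf_le_iff {c : ℕ → ℝ} (hc : ∀ m n, m ≤ n → n ≤ 2 * d → c m ≤ c n)
    (U : Site d → ℕ → ℝ) (p : Site d × ℕ) {N : ℕ} (hN : N ≤ 2 * d) :
    reqOf c U p ≤ N ↔ U p.1 p.2 ≤ c N := by
  unfold reqOf
  constructor
  · intro h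
    by_contra! hlt
    have : Finset.range (N + 1) ⊆
        (Finset.range (2 * d + 1)).filter (fun n => c n < U p.1 p.2) := by
      intro n hn
      simp only [Finset.mem_range, Finset.mem_filter] at hn ⊢
      exact ⟨by omega, (hc n N (by omega) hN).trans_lt hlt⟩
    have := Finset.card_le_card this
    simp only [Finset.card_range] at this
    omega
  · intro h
    have : (Finset.range (2 * d + 1)).filter (fun n => c n < U p.1 p.2) ⊆ Finset.range N := by
      intro n hn
      simp only [Finset.mem_range, Finset.mem_filter] at hn ⊢
      by_contra! hle
      exact absurd (h.trans (hc N n hle (by omega))) (not_le.2 hn.2)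
    have := Finset.card_le_card this
    simpa using this

lemma nbr_injective (x : Site d) : Function.Injective (nbr x) := by
  rintro ⟨i, b⟩ ⟨j, b'⟩ h
  have h1 := congrFun h i
  by_cases hij : i = j
  · subst hij
    have h2 := nbr_apply_self x (i, b)
    have h3 := nbr_apply_self x (i, b')
    simp only at h2 h3
    rw [h2, h3] at h1
    cases b <;> cases b' <;> simp [sg] at h1 ⊢
  · have h2 := nbr_apply_self x (i, b)
    simp only at h2
    rw [h2, nbr_apply_of_ne x (j, b') hij] at h1
    cases b <;> simp [sg] at h1

lemma exists_nbr_iff (x y : Site d) : (∑ j, |x j - y j| = 1) ↔ ∃ q, nbr x q = y := by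
  constructor
  · intro h
    obtain ⟨i, -, hi⟩ : ∃ i ∈ Finset.univ, |x i - y i| ≠ 0 := by
      apply Finset.exists_ne_zero_of_sum_ne_zero
      rw [h]
      norm_num
    have hsum := Finset.add_sum_erase Finset.univ (fun j => |x j - y j|) (Finset.mem_univ i)
    have hnn : 0 ≤ ∑ j ∈ Finset.univ.erase i, |x j - y j| :=
      Finset.sum_nonneg fun _ _ => abs_nonneg _
    have hpos : 0 < |x i - y i| := lt_of_le_of_ne (abs_nonneg _) hi.symm
    simp only [h] at hsum
    have hz : ∑ j ∈ Finset.univ.erase i, |x j - y j| = 0 := by omega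
    have h1 : |x i - y i| = 1 := by omega
    rw [Finset.sum_eq_zero_iff_of_nonneg fun _ _ => abs_nonneg _] at hz
    have hoff : ∀ j, j ≠ i → x j = y j := fun j hj => by
      have := hz j (Finset.mem_erase.2 ⟨hj, Finset.mem_univ j⟩)
      rw [abs_eq_zero] at this
      omega
    rcases (abs_eq one_pos.le).1 h1 with h2 | h2
    · refine ⟨(i, false), funext fun j => ?_⟩
      by_cases hj : j = i
      · subst hj
        have := nbr_apply_self x (j, false)
        simp only [sg] at this
        rw [this]
        simp
        omega
      · rw [nbr_apply_of_ne x (i, false) hj, hoff j hj]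
    · refine ⟨(i, true), funext fun j => ?_⟩
      by_cases hj : j = i
      · subst hj
        have := nbr_apply_self x (j, true)
        simp only [sg] at this
        rw [this]
        simp
        omega
      · rw [nbr_apply_of_ne x (i, true) hj, hoff j hj]
  · rintro ⟨q, rfl⟩
    rw [Finset.sum_eq_single q.1]
    · rw [nbr_apply_self]
      cases q.2 <;> simp [sg]
    · intro j _ hj
      rw [nbr_apply_of_ne x q hj]
      simp
    · simp

lemma numNbrs_eq (x : Site d) (η : Finset (Site d)) :
    numNbrs x η = nbCount Finset.univ x (η : Set (Site d)) := by
  classical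
  unfold numNbrs nbCount
  rw [← Finset.card_image_of_injective _ (nbr_injective x)]
  congr 1
  ext y
  simp only [Finset.mem_filter, exists_nbr_iff, Finset.mem_image, Finset.mem_product,
    Finset.mem_univ, true_and, Finset.mem_coe]
  constructor
  · rintro ⟨hy, q, rfl⟩
    exact ⟨q, hy, rfl⟩
  · rintro ⟨q, hq, rfl⟩
    exact ⟨hq, q, rfl⟩

/-- When all directions are free and `m = 0`, cylinders are single sites and the abstract growth is
the actual process. -/
lemma coe_foldl_update {c : ℕ → ℝ} (hc : ∀ m n, m ≤ n → n ≤ 2 * d → c m ≤ c n)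
    (U : Site d → ℕ → ℝ) (l : List (Site d × ℕ)) :
    ((l.foldl (update c U) ∅ : Finset (Site d)) : Set (Site d)) =
      run Finset.univ 0 (reqOf c U) l ∅ := by
  classical
  induction l using List.reverseRecOn with
  | nil => simp
  | append_singleton l p ih =>
    rw [run_concat, ← ih, List.foldl_append, List.foldl_cons, List.foldl_nil]
    have hcyl : cyl Finset.univ p.1 = {p.1} := by
      ext y
      simp [cyl, funext_iff]
    ext x
    rw [mem_growStep, add_zero, reqOf_le_iff hc U p (nbCount_univ_le _ _), hcyl, ← numNbrs_eq,
      update]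
    split_ifs with h
    · simp [h, or_comm]
    · simp [h]

/-- The list of arrivals is sorted by time, and consists of the arrivals in `Λ` up to time `t`. -/
lemma orderedArrivals_sorted (gap : Site d → ℕ → ℝ) (Λ : Finset (Site d)) (t : ℝ) :
    (orderedArrivals gap Λ t).Nodup ∧
      (orderedArrivals gap Λ t).Pairwise (fun p q => arrival gap p ≤ arrival gap q) ∧
      (∀ p ∈ orderedArrivals gap Λ t, p.1 ∈ Λ ∧ arrival gap p ≤ t) ∧
      ((arrivalsUpTo gap Λ t).Finite →
        ∀ p : Site d × ℕ, p.1 ∈ Λ → arrival gap p ≤ t → p ∈ orderedArrivals gap Λ t) := by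
  classical
  unfold orderedArrivals
  split_ifs with h
  · have : Std.Total (fun p q : Site d × ℕ => arrival gap p ≤ arrival gap q) :=
      ⟨fun p q => le_total _ _⟩
    have : IsTrans (Site d × ℕ) (fun p q => arrival gap p ≤ arrival gap q) :=
      ⟨fun p q r => le_trans⟩
    refine ⟨?_, List.pairwise_insertionSort _ _, ?_, ?_⟩
    · rw [(List.perm_insertionSort _ _).nodup_iff]
      exact Finset.nodup_toList _
    · intro p hp
      rw [(List.perm_insertionSort _ _).mem_iff] at hp
      simpa [arrivalsUpTo] using hp
    · intro _ p h1 h2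
      rw [(List.perm_insertionSort _ _).mem_iff]
      simpa [arrivalsUpTo] using ⟨h1, h2⟩
  · exact ⟨List.nodup_nil, List.Pairwise.nil, by simp, fun h' => absurd h' h⟩

/-! ### Finite speed of propagation -/

/-- The lattice paths of `n` sites starting from `x`. -/
def paths {d : ℕ} : ℕ → Site d → Finset (List (Site d))
  | 0, _ => {[]}
  | n + 1, x => Finset.univ.biUnion fun q : Fin d × Bool => (paths n (nbr x q)).image (x :: ·)

lemma card_paths_le (n : ℕ) (x : Site d) : (paths n x).card ≤ (2 * d) ^ n := by
  induction n generalizing x with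
  | zero => simp [paths]
  | succ n ih =>
    rw [paths]
    refine Finset.card_biUnion_le.trans ?_
    refine (Finset.sum_le_sum fun q _ => Finset.card_image_le.trans (ih _)).trans ?_
    simp [pow_succ]
    apply le_of_eq
    ring

lemma length_of_mem_paths {n : ℕ} {x : Site d} {L : List (Site d)} (hL : L ∈ paths n x) :
    L.length = n := by
  induction n generalizing x L with
  | zero => simp [paths] at hL; simp [hL]
  | succ n ih =>
    simp only [paths, Finset.mem_biUnion, Finset.mem_image] at hL
    obtain ⟨q, -, L', hL', rfl⟩ := hL
    simp [ih hL']

/-- The complement of `B` is reached from the site in `n` steps, through sites of `A`. -/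
def Reach (A B : Set (Site d)) : ℕ → Site d → Prop
  | 0, x => x ∉ B
  | n + 1, x => x ∈ A ∧ ∃ q, Reach A B n (nbr x q)

/-- Minimality of `n` makes the path self-avoiding: a site visited again later would leave `B` in
fewer steps. Distinct sites are needed because they will be charged with distinct arrivals. -/
lemma exists_path_of_reach {A B : Set (Site d)} (m n : ℕ) (x : Site d) (hmn : m ≤ n)
    (hr : Reach A B n x) (hmin : ∀ n' < n, ¬ Reach A B n' x) :
    ∃ L ∈ paths m x, L.Nodup ∧ ∀ y ∈ L, y ∈ A ∧ ∃ r ≤ n, Reach A B r y := by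
  induction m generalizing n x with
  | zero => exact ⟨[], by simp [paths], by simp, by simp⟩
  | succ m ih =>
    obtain ⟨n, rfl⟩ : ∃ n', n = n' + 1 := ⟨n - 1, by omega⟩
    have hr' := hr
    obtain ⟨hxA, q, hq⟩ := hr
    obtain ⟨L, hL, hnd, hall⟩ := ih n (nbr x q) (by omega) hq fun n' hn' hR =>
      hmin (n' + 1) (by omega) ⟨hxA, q, hR⟩
    refine ⟨x :: L, ?_, ?_, ?_⟩
    · simp only [paths, Finset.mem_biUnion, Finset.mem_image]
      exact ⟨q, Finset.mem_univ _, L, hL, rfl⟩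
    · rw [List.nodup_cons]
      refine ⟨fun hx => ?_, hnd⟩
      obtain ⟨r, hr, hR⟩ := (hall x hx).2
      exact hmin r (by omega) hR
    · intro y hy
      rcases List.mem_cons.1 hy with rfl | hy
      · exact ⟨hxA, n + 1, le_rfl, hr'⟩
      · obtain ⟨h1, r, h2, h3⟩ := hall y hy
        exact ⟨h1, r, by omega, h3⟩

lemma lt_of_reach {A : Set (Site d)} {R : ℤ} {n : ℕ} {x : Site d}
    (hr : Reach A {y | ∀ j, |y j| ≤ R} n x) : ∃ j, R < |x j| + n := by
  induction n generalizing x with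
  | zero =>
    simp only [Reach, Set.mem_ofPred_eq, not_forall, not_le] at hr
    simpa using hr
  | succ n ih =>
    obtain ⟨-, q, hq⟩ := hr
    obtain ⟨j, hj⟩ := ih hq
    refine ⟨j, ?_⟩
    have h1 := abs_nbr_sub_le x q j
    have h2 : |nbr x q j| ≤ |nbr x q j - x j| + |x j| := by
      have := abs_add_le (nbr x q j - x j) (x j)
      simpa using this
    push_cast
    omega

/-- A discrepancy between the process and its restriction to the points in `Λ` comes from outside
`B ⊆ Λ` along the sites of effective points. -/
lemma exists_reach {B : Set (Site d)} (Λ : Site d × ℕ → Bool) (hB : ∀ p : Site d × ℕ, p.1 ∈ B → Λ p)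
    (w : List (Site d × ℕ)) {η η' : Set (Site d)} (hη : ∀ x ∈ B, x ∈ η → x ∈ η') :
    ∀ x, x ∈ run Finset.univ 0 req w η → x ∉ run Finset.univ 0 req (w.filter Λ) η' →
      ∃ n, Reach {y | ∃ p ∈ w, p.1 = y ∧ req p ≤ 2 * d} B n x := by
  have hmonoA : ∀ (A A' : Set (Site d)), A ⊆ A' → ∀ n x, Reach A B n x → Reach A' B n x := by
    intro A A' hAA n
    induction n with
    | zero => exact fun x h => h
    | succ n ih =>
      rintro x ⟨h1, q, h2⟩
      exact ⟨hAA h1, q, ih _ h2⟩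
  induction w using List.reverseRecOn with
  | nil =>
    intro x hx hx'
    simp only [run_nil, List.filter_nil] at hx hx'
    exact ⟨0, fun hxB => hx' (hη x hxB hx)⟩
  | append_singleton w p ih =>
    intro x hx hx'
    have ih' : ∀ x, x ∈ run Finset.univ 0 req w η → x ∉ run Finset.univ 0 req (w.filter Λ) η' →
      ∃ n, Reach {y | ∃ p' ∈ w ++ [p], p'.1 = y ∧ req p' ≤ 2 * d} B n x := by
      intro x hx hx'
      obtain ⟨n, hn⟩ := ih x hx hx'
      refine ⟨n, hmonoA _ _ ?_ n x hn⟩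
      rintro y ⟨p', h1, h2⟩
      exact ⟨p', List.mem_append_left _ h1, h2⟩
    have hx'' : x ∉ run Finset.univ 0 req (w.filter Λ) η' := by
      intro h
      apply hx'
      rw [List.filter_append, run_append]
      exact subset_run _ _ h
    rw [mem_run_concat] at hx
    rcases hx with hx | ⟨hN, hxc⟩
    · exact ih' x hx hx''
    have hxp : x = p.1 := funext fun j => hxc j (Finset.mem_univ j)
    subst hxp
    by_cases hxB : p.1 ∈ B
    · have hf : (w ++ [p]).filter Λ = w.filter Λ ++ [p] := by
        rw [List.filter_append]
        simp [hB p hxB]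
      rw [hf, mem_run_concat] at hx'
      push Not at hx'
      have h1 : ¬ req p ≤ nbCount Finset.univ p.1 (run Finset.univ 0 req (w.filter Λ) η') + 0 :=
        fun h => hx'.2 h (mem_cyl_self _)
      -- The same point is effective in the full process and not in the restricted one, so one of
      -- its neighbours is already a discrepancy.
      obtain ⟨q, -, hq, hq'⟩ := exists_nbr_of_nbCount_lt (I := Finset.univ) (x := p.1)
        (η := run Finset.univ 0 req w η) (η' := run Finset.univ 0 req (w.filter Λ) η') (by omega)
      obtain ⟨n, hn⟩ := ih' _ hq hq'
      refine ⟨n + 1, ⟨p, by simp, rfl, ?_⟩, q, hn⟩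
      exact hN.trans (nbCount_univ_le _ _)
    · exact ⟨0, hxB⟩

/-- Finite speed of propagation: if in none of the successive windows of length `δ` there is a path
of `n` sites with effective points, then the state of the origin is determined by the points
in a box. -/
lemma zero_mem_run_filter (τ : Site d × ℕ → ℝ) {l : List (Site d × ℕ)}
    (hl : l.Pairwise (fun p q => τ p ≤ τ q)) (Λ : Site d × ℕ → Bool) {X : ℤ}
    (hΛ : ∀ p : Site d × ℕ, (∀ j, |p.1 j| ≤ X) → Λ p) {δ : ℝ} (hδ : 0 ≤ δ) {M n : ℕ}
    (hX : (M : ℤ) * n ≤ X) (h0 : ∀ p ∈ l, 0 < τ p) (h1 : ∀ p ∈ l, τ p ≤ M * δ)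
    (hpath : ∀ i < M, ∀ x : Site d, (∀ j, |x j| ≤ X) → ∀ L ∈ paths n x, L.Nodup →
      ¬ ∀ y ∈ L, ∃ p ∈ l, p.1 = y ∧ i * δ < τ p ∧ τ p ≤ (i + 1 : ℕ) * δ ∧ req p ≤ 2 * d)
    (hz : 0 ∈ run Finset.univ 0 req l ∅) : 0 ∈ run Finset.univ 0 req (l.filter Λ) ∅ := by
  -- The box on which the two processes are known to agree shrinks by `n` in each window; `M * n ≤
  -- X` keeps the origin in it to the end.
  have key : ∀ i ≤ M, ∀ x : Site d, (∀ j, |x j| ≤ X - i * n) →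
      x ∈ run Finset.univ 0 req (l.filter (fun p => τ p ≤ i * δ)) ∅ →
      x ∈ run Finset.univ 0 req ((l.filter Λ).filter (fun p => τ p ≤ i * δ)) ∅ := by
    intro i
    induction i with
    | zero =>
      intro _ x _ hx
      have : l.filter (fun p => decide (τ p ≤ (0 : ℕ) * δ)) = [] := by
        rw [List.filter_eq_nil_iff]
        intro p hp
        simpa using h0 p hp
      rw [this] at hx
      simp at hx
    | succ i ih =>
      intro hi x hx hxr
      have ih := ih (by omega)
      have hle : (i : ℝ) * δ ≤ (i + 1 : ℕ) * δ := by
        push_cast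
        nlinarith
      rw [filter_le_append_filter hl hle, run_append] at hxr
      rw [filter_le_append_filter (hl.filter _) hle, run_append, List.filter_comm]
      by_contra hcon
      set w := l.filter (fun p => decide ((i : ℝ) * δ < τ p ∧ τ p ≤ (i + 1 : ℕ) * δ)) with hw
      have hexR := exists_reach (req := req) (B := {y | ∀ j, |y j| ≤ X - i * n}) Λ (by
        intro p hp
        refine hΛ p fun j => (hp j).trans ?_
        have : (0 : ℤ) ≤ i * n := by positivity
        omega) w (η := run Finset.univ 0 req (l.filter (fun p => τ p ≤ i * δ)) ∅)
        (η' := run Finset.univ 0 req ((l.filter Λ).filter (fun p => τ p ≤ i * δ)) ∅)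
        ih x hxr hcon
      classical
      have hspec := Nat.find_spec hexR
      obtain ⟨j, hj⟩ := lt_of_reach hspec
      have hxj := hx j
      push_cast at hxj
      -- The site is at depth at least `n` in the previous box of agreement, so even the shortest
      -- way out has `n` steps.
      have hni : n ≤ Nat.find hexR := by
        have : (n : ℤ) ≤ Nat.find hexR := by linarith
        exact_mod_cast this
      obtain ⟨L, hL, hnd, hall⟩ := exists_path_of_reach n _ x hni hspec
        fun n' hn' => Nat.find_min hexR hn'
      refine hpath i (by omega) x (fun j => (hx j).trans ?_) L hL hnd fun y hy => ?_
      · have : (0 : ℤ) ≤ (i + 1 : ℕ) * n := by positivity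
        omega
      · obtain ⟨p, hp, h2, h3⟩ := (hall y hy).1
        simp only [hw, List.mem_filter, decide_eq_true_eq] at hp
        exact ⟨p, hp.1, h2, hp.2.1, hp.2.2, h3⟩
  have hfull : l.filter (fun p => decide (τ p ≤ M * δ)) = l :=
    List.filter_eq_self.2 fun p hp => by simpa using h1 p hp
  have := key M le_rfl 0 (fun j => by simpa using hX) (by rwa [hfull])
  rwa [List.filter_comm, hfull] at this

end deterministic

/-! ### Filling cubes from a nucleus -/

/-- The cube of side `r` in the directions of `I` with lowest corner `lo`. -/
def flat {d : ℕ} (I : Finset (Fin d)) (r : ℕ) (lo : Site d) : Set (Site d) :=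
  {x | (∀ j ∈ I, lo j ≤ x j ∧ x j < lo j + r) ∧ ∀ j ∉ I, x j = lo j}

/-- In the region `Q` and the time interval `[0, t₁]`, a cube of side `r` in the directions of `I`
whose sites have an occupied neighbour in each other direction is occupied after a time `T`. -/
def Fill {d : ℕ} (σ : ℝ → Set (Site d)) (Q : Set (Site d)) (t₁ : ℝ) (I : Finset (Fin d)) (r : ℕ)
    (T : ℝ) : Prop :=
  ∀ lo, flat I r lo ⊆ Q → ∀ s, 0 ≤ s → s + T ≤ t₁ → ∀ e : Fin d → Bool,
    (∀ x ∈ flat I r lo, ∀ j ∉ I, nbr x (j, e j) ∈ σ s) → flat I r lo ⊆ σ (s + T)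

/-- In the region `Q` and the time interval `[0, t₁]`, in a cube of side `r` in the directions of
`I` there is after a time `T` a point which needs only the neighbours in the other directions. -/
def Nucleates {d : ℕ} (τ : Site d × ℕ → ℝ) (req : Site d × ℕ → ℕ) (Q : Set (Site d)) (t₁ : ℝ)
    (I : Finset (Fin d)) (r : ℕ) (T : ℝ) : Prop :=
  ∀ lo, flat I r lo ⊆ Q → ∀ s, 0 ≤ s → s + T ≤ t₁ →
    ∃ p : Site d × ℕ, p.1 ∈ flat I r lo ∧ s < τ p ∧ τ p ≤ s + T ∧ req p ≤ d - I.card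

section deterministic

variable {d : ℕ} {τ : Site d × ℕ → ℝ} {req : Site d × ℕ → ℕ} {σ : ℝ → Set (Site d)}
  {Q : Set (Site d)} {t₁ : ℝ}

/-- Every site of the large cube lies in a translate of the small one contained in it; the minimum
in the proof pushes the translate back inside near the upper faces. -/
lemma Fill.mono_side (hσ : Monotone σ) {I : Finset (Fin d)} {r r' : ℕ} {T T' : ℝ}
    (h : Fill σ Q t₁ I r T) (hr : r ≤ r') (hr0 : 0 < r) (hT : T ≤ T') : Fill σ Q t₁ I r' T' := by
  intro lo hlo s hs hsT e he x hx
  refine hσ (by linarith : s + T ≤ s + T') ?_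
  set lo' : Site d := fun j => if j ∈ I then min (x j) (lo j + r' - r) else lo j with hlo'
  have hsub : flat I r lo' ⊆ flat I r' lo := by
    intro y hy
    refine ⟨fun j hj => ?_, fun j hj => ?_⟩
    · have h1 := hy.1 j hj
      have h2 := hx.1 j hj
      simp only [hlo', hj, if_true] at h1
      omega
    · have h1 := hy.2 j hj
      simpa only [hlo', hj, if_false] using h1
  refine h lo' (hsub.trans hlo) s hs (by linarith) e (fun y hy => he y (hsub hy)) ?_
  refine ⟨fun j hj => ?_, fun j hj => ?_⟩
  · have h2 := hx.1 j hj
    simp only [hlo', hj, if_true]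
    omega
  · simpa only [hlo', hj, if_false] using hx.2 j hj

lemma card_compl_le_nbCount {I : Finset (Fin d)} {e : Fin d → Bool} {x : Site d}
    {η : Set (Site d)} (he : ∀ j ∉ I, nbr x (j, e j) ∈ η) :
    d - I.card ≤ nbCount Finset.univ x η := by
  classical
  have h1 : d - I.card = (Iᶜ.image fun j => (j, e j)).card := by
    rw [Finset.card_image_of_injective _ (fun i j h => (Prod.ext_iff.1 h).1), Finset.card_compl,
      Fintype.card_fin]
  rw [h1]
  unfold nbCount
  apply Finset.card_le_card
  intro q hq
  obtain ⟨j, hj, rfl⟩ := Finset.mem_image.1 hq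
  simp only [Finset.mem_filter, Finset.mem_product, Finset.mem_univ, true_and]
  exact he j (Finset.mem_compl.1 hj)

/-- The nucleus of a cube. -/
lemma exists_nucleus
    (hact : ∀ p : Site d × ℕ, p.1 ∈ Q → ∀ s t, 0 ≤ s → s < τ p → τ p ≤ t → t ≤ t₁ →
      req p ≤ nbCount Finset.univ p.1 (σ s) → p.1 ∈ σ t)
    {I : Finset (Fin d)} {r : ℕ} {T : ℝ} (hN : Nucleates τ req Q t₁ I r T) {lo : Site d}
    (hlo : flat I r lo ⊆ Q) {s : ℝ} (hs : 0 ≤ s) (hsT : s + T ≤ t₁) {e : Fin d → Bool}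
    (he : ∀ x ∈ flat I r lo, ∀ j ∉ I, nbr x (j, e j) ∈ σ s) :
    ∃ x ∈ flat I r lo, x ∈ σ (s + T) := by
  obtain ⟨p, hp, h1, h2, h3⟩ := hN lo hlo s hs hsT
  exact ⟨p.1, hp, hact p (hlo hp) s (s + T) hs h1 h2 hsT
    (h3.trans (card_compl_le_nbCount (he p.1 hp)))⟩

lemma fill_empty
    (hact : ∀ p : Site d × ℕ, p.1 ∈ Q → ∀ s t, 0 ≤ s → s < τ p → τ p ≤ t → t ≤ t₁ →
      req p ≤ nbCount Finset.univ p.1 (σ s) → p.1 ∈ σ t)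
    {r : ℕ} {T : ℝ} (hN : Nucleates τ req Q t₁ ∅ r T) : Fill σ Q t₁ ∅ r T := by
  intro lo hlo s hs hsT e he y hy
  obtain ⟨x, hx, hxσ⟩ := exists_nucleus hact hN hlo hs hsT he
  have : y = x := funext fun j => (hy.2 j (by simp)).trans (hx.2 j (by simp)).symm
  rwa [this]

/-- The part of the cube at distance at most `m` from `x`, and `m + 1` in the directions of `J`. -/
def grown {d : ℕ} (I J : Finset (Fin d)) (r : ℕ) (lo x : Site d) (m : ℕ) : Set (Site d) :=
  {y | y ∈ flat I r lo ∧ ∀ j ∈ I, |y j - x j| ≤ m + if j ∈ J then 1 else 0}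

/-- The growth by one in the direction `j`. -/
lemma grown_insert (hσ : Monotone σ) {I J : Finset (Fin d)} {r ρ m : ℕ} {lo x : Site d}
    (hlo : flat I r lo ⊆ Q) (hx : x ∈ flat I r lo) {s t T : ℝ} (hs : 0 ≤ s) (hst : s ≤ t)
    {e : Fin d → Bool} (he : ∀ x ∈ flat I r lo, ∀ j ∉ I, nbr x (j, e j) ∈ σ s) {j : Fin d}
    (hj : j ∈ I) (hjJ : j ∉ J) (hρ : ρ ≤ m + 1) (hρ0 : 0 < ρ) (hρr : ρ ≤ r) (hT : 0 ≤ T)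
    (htT : t + T ≤ t₁)
    (hF : Fill σ Q t₁ (I.erase j) ρ T) (hg : grown I J r lo x m ⊆ σ t) :
    grown I (insert j J) r lo x m ⊆ σ (t + T) := by
  rintro y ⟨hy, hyx⟩
  by_cases hyJ : |y j - x j| ≤ m
  · refine hσ (by linarith : t ≤ t + T) (hg ⟨hy, fun i hi => ?_⟩)
    by_cases hij : i = j
    · subst hij
      simpa [hjJ] using hyJ
    · have := hyx i hi
      simpa [hij] using this
  have hyj := hyx j hj
  simp only [Finset.mem_insert_self, if_true] at hyj
  -- The direction from `y` back towards `x`, in which the slice through `y` has occupied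
  -- neighbours.
  set b : Bool := decide (y j < x j) with hb
  set mm : Fin d → ℤ := fun i => m + if i ∈ J then 1 else 0 with hmm
  -- A face of side `ρ` in the slice through `y`, containing `y` and contained both in the cube and
  -- in the lateral extent of the grown part. There is room because `ρ ≤ m + 1`, `ρ ≤ r` and `x` is
  -- in the cube.
  set lo' : Site d := fun i => if i ∈ I.erase j then
    min (y i) (min (lo i + r - 1) (x i + mm i) - ρ + 1) else y i with hlo'
  have hmm0 : ∀ i, (m : ℤ) ≤ mm i := by
    intro i
    simp only [hmm]
    split_ifs <;> omega
  have hsub : flat (I.erase j) ρ lo' ⊆ flat I r lo ∩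
      {z | z j = y j ∧ ∀ i ∈ I.erase j, |z i - x i| ≤ mm i} := by
    intro z hz
    have hzj : z j = y j := by
      have := hz.2 j (by simp)
      simpa [hlo'] using this
    have hzi : ∀ i ∈ I.erase j, (lo i ≤ z i ∧ z i < lo i + r) ∧ |z i - x i| ≤ mm i := by
      intro i hi
      have hiI := Finset.mem_of_mem_erase hi
      have h1 := hz.1 i hi
      have h2 := hy.1 i hiI
      have h3 := hyx i hiI
      have h4 := hx.1 i hiI
      have h5 := hmm0 i
      have h6 : (if i ∈ insert j J then (1 : ℤ) else 0) = if i ∈ J then 1 else 0 := by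
        simp [Finset.ne_of_mem_erase hi]
      rw [h6] at h3
      change |y i - x i| ≤ mm i at h3
      simp only [hlo', hi, if_true] at h1
      rw [abs_le] at h3 ⊢
      omega
    refine ⟨⟨fun i hi => ?_, fun i hi => ?_⟩, hzj, fun i hi => (hzi i hi).2⟩
    · by_cases hij : i = j
      · subst hij
        rw [hzj]
        exact hy.1 i hi
      · exact (hzi i (Finset.mem_erase.2 ⟨hij, hi⟩)).1
    · have hi' : i ∉ I.erase j := fun h => hi (Finset.mem_of_mem_erase h)
      have := hz.2 i hi'
      simp only [hlo', hi', if_false] at this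
      rw [this]
      exact hy.2 i hi
  refine hF lo' (fun z hz => hlo (hsub hz).1) t (hs.trans hst) htT (Function.update e j b) ?_ ?_
  · intro z hz i hi
    obtain ⟨hzC, hzj, hzi⟩ := hsub hz
    by_cases hij : i = j
    · subst hij
      rw [Function.update_self]
      apply hg
      have hnb := nbr_apply_self z (i, b)
      simp only at hnb
      have hyi := hy.1 i hj
      have hxi := hx.1 i hj
      have hcloser : |y i + sg b - x i| ≤ m ∧ lo i ≤ y i + sg b ∧ y i + sg b < lo i + r := by
        by_cases hlt : y i < x i
        · simp only [hb, hlt, decide_true, sg, if_true]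
          rw [abs_of_nonpos (by omega)] at hyj hyJ
          rw [abs_le]
          omega
        · simp only [hb, hlt, decide_false, sg, Bool.false_eq_true, if_false]
          rw [abs_of_nonneg (by omega)] at hyj hyJ
          rw [abs_le]
          omega
      refine ⟨⟨fun l hl => ?_, fun l hl => ?_⟩, fun l hl => ?_⟩
      · by_cases hli : l = i
        · subst hli
          rw [hnb, hzj]
          exact hcloser.2
        · rw [nbr_apply_of_ne z (i, b) hli]
          exact hzC.1 l hl
      · rw [nbr_apply_of_ne z (i, b) (fun h => hl (by simp only at h; rwa [h]))]
        exact hzC.2 l hl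
      · by_cases hli : l = i
        · subst hli
          rw [hnb, hzj]
          simpa [hjJ] using hcloser.1
        · rw [nbr_apply_of_ne z (i, b) hli]
          exact hzi l (Finset.mem_erase.2 ⟨hli, hl⟩)
    · rw [Function.update_of_ne hij]
      exact hσ hst (he z hzC i fun hiI => hi (Finset.mem_erase.2 ⟨hij, hiI⟩))
  · refine ⟨fun i hi => ?_, fun i hi => ?_⟩
    · have hiI := Finset.mem_of_mem_erase hi
      have h2 := hy.1 i hiI
      have h3 := hyx i hiI
      have h6 : (if i ∈ insert j J then (1 : ℤ) else 0) = if i ∈ J then 1 else 0 := by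
        simp [Finset.ne_of_mem_erase hi]
      rw [h6] at h3
      change |y i - x i| ≤ mm i at h3
      simp only [hlo', hi, if_true]
      rw [abs_le] at h3
      omega
    · simp only [hlo', hi, if_false]

/-- The growth by one in all directions, `n` times. -/
lemma grown_rounds (hσ : Monotone σ) {I : Finset (Fin d)} {r ρ m : ℕ} {lo x : Site d}
    (hlo : flat I r lo ⊆ Q) (hx : x ∈ flat I r lo) {s t T : ℝ} (hs : 0 ≤ s) (hst : s ≤ t)
    {e : Fin d → Bool} (he : ∀ x ∈ flat I r lo, ∀ j ∉ I, nbr x (j, e j) ∈ σ s)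
    (hρ : ρ ≤ m + 1) (hρ0 : 0 < ρ) (hρr : ρ ≤ r) (hT : 0 ≤ T)
    (hF : ∀ j ∈ I, Fill σ Q t₁ (I.erase j) ρ T) (hg : grown I ∅ r lo x m ⊆ σ t) (n : ℕ)
    (htT : t + n * (I.card * T) ≤ t₁) :
    grown I ∅ r lo x (m + n) ⊆ σ (t + n * (I.card * T)) := by
  classical
  induction n with
  | zero => simpa using hg
  | succ n ih =>
    have hIT : 0 ≤ I.card * T := by positivity
    have hnIT : 0 ≤ n * (I.card * T) := by positivity
    push_cast at htT ⊢
    have ih := ih (by linarith)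
    -- Within one round the directions are treated one after the other, each at the cost of one
    -- filling time.
    have key : ∀ J ⊆ I, grown I J r lo x (m + n) ⊆ σ (t + n * (I.card * T) + J.card * T) := by
      intro J
      induction J using Finset.induction_on with
      | empty => intro _; simpa using ih
      | insert j J hjJ ihJ =>
        intro hJI
        rw [Finset.insert_subset_iff] at hJI
        have hcardJ : ((insert j J).card : ℝ) = J.card + 1 := by
          rw [Finset.card_insert_of_notMem hjJ]
          push_cast
          ring
        have hle : ((insert j J).card : ℝ) ≤ I.card := by
          exact_mod_cast Finset.card_le_card (Finset.insert_subset hJI.1 hJI.2)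
        have hle2 : ((insert j J).card : ℝ) * T ≤ I.card * T :=
          mul_le_mul_of_nonneg_right hle hT
        have hJT : 0 ≤ (J.card : ℝ) * T := by positivity
        rw [hcardJ] at hle2 ⊢
        have := grown_insert (Q := Q) (t₁ := t₁) hσ hlo hx hs
          (t := t + n * (I.card * T) + J.card * T) (by linarith) he hJI.1 hjJ
          (by omega : ρ ≤ m + n + 1) hρ0 hρr hT (by linarith) (hF j hJI.1) (ihJ hJI.2)
        convert this using 2
        ring
    have := key I le_rfl
    intro y hy
    have hy' : y ∈ grown I I r lo x (m + n) := by
      refine ⟨hy.1, fun j hj => ?_⟩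
      have := hy.2 j hj
      simp only [hj, if_true, Finset.notMem_empty, if_false] at this ⊢
      push_cast at this
      omega
    have h2 := this hy'
    convert h2 using 2
    ring

/-- A cube is filled once it has a nucleus which grows through the successive scales `r k`. -/
theorem fill_of_scales (hσ : Monotone σ)
    (hact : ∀ p : Site d × ℕ, p.1 ∈ Q → ∀ s t, 0 ≤ s → s < τ p → τ p ≤ t → t ≤ t₁ →
      req p ≤ nbCount Finset.univ p.1 (σ s) → p.1 ∈ σ t)
    {I : Finset (Fin d)} {K : ℕ} {r : ℕ → ℕ} {T : ℕ → ℝ} {T₀ : ℝ} (hr0 : r 0 = 1)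
    (hr : Monotone r) (hT : ∀ k, 0 ≤ T k) (hT₀ : 0 ≤ T₀)
    (hF : ∀ k < K, ∀ j ∈ I, Fill σ Q t₁ (I.erase j) (r k) (T k))
    (hN : Nucleates τ req Q t₁ I (r K) T₀) :
    Fill σ Q t₁ I (r K) (T₀ + ∑ k ∈ Finset.range K, r (k + 1) * (I.card * T k)) := by
  intro lo hlo s hs hsT e he
  have hsum0 : ∀ k, 0 ≤ ∑ k ∈ Finset.range k, r (k + 1) * (I.card * T k) := fun k =>
    Finset.sum_nonneg fun i _ => by have := hT i; positivity
  have hsumle : ∀ k ≤ K, ∑ k ∈ Finset.range k, r (k + 1) * (I.card * T k) ≤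
      ∑ k ∈ Finset.range K, r (k + 1) * (I.card * T k) := fun k hk =>
    Finset.sum_le_sum_of_subset_of_nonneg (Finset.range_mono hk)
      fun i _ _ => by have := hT i; positivity
  obtain ⟨x, hx, hxσ⟩ := exists_nucleus hact hN hlo hs (by linarith [hsum0 K]) he
  have hrpos : ∀ k, 1 ≤ r k := fun k => hr0 ▸ hr (Nat.zero_le k)
  -- A nucleus of radius `r k - 1` has faces on which cubes of side `r k` fit, and `r (k + 1) - r k`
  -- rounds bring it to the next scale. Radius `r K - 1` about any site of the cube covers the cube.
  have key : ∀ k ≤ K, grown I ∅ (r K) lo x (r k - 1) ⊆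
      σ (s + T₀ + ∑ k ∈ Finset.range k, r (k + 1) * (I.card * T k)) := by
    intro k
    induction k with
    | zero =>
      intro _ y hy
      have : y = x := by
        funext j
        by_cases hj : j ∈ I
        · have := hy.2 j hj
          rw [hr0] at this
          simp only [Finset.notMem_empty, if_false] at this
          rw [abs_le] at this
          push_cast at this
          omega
        · exact (hy.1.2 j hj).trans (hx.2 j hj).symm
      rw [this]
      simpa using hxσ
    | succ k ih =>
      intro hk
      have hkk := hr (Nat.le_succ k)
      have h1 := hrpos k
      have h3 : ((r (k + 1) - r k : ℕ) : ℝ) * (I.card * T k) ≤ r (k + 1) * (I.card * T k) := by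
        refine mul_le_mul_of_nonneg_right ?_ (by have := hT k; positivity)
        exact_mod_cast Nat.sub_le _ _
      have h4 := hsumle (k + 1) hk
      rw [Finset.sum_range_succ] at h4 ⊢
      have h2 := grown_rounds (Q := Q) (t₁ := t₁) (m := r k - 1) (ρ := r k) hσ hlo hx hs
        (t := s + T₀ + ∑ k ∈ Finset.range k, r (k + 1) * (I.card * T k)) (by linarith [hsum0 k]) he
        (by omega) (by omega) (hr (by omega)) (hT k) (hF k (by omega)) (ih (by omega))
        (r (k + 1) - r k) (by linarith)
      have h5 : r k - 1 + (r (k + 1) - r k) = r (k + 1) - 1 := by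
        change r k ≤ r (k + 1) at hkk
        omega
      rw [h5] at h2
      exact h2.trans (hσ (by linarith))
  have hK := key K le_rfl
  rw [← add_assoc]
  intro y hy
  refine hK ⟨hy, fun j hj => ?_⟩
  have h1 := hy.1 j hj
  have h2 := hx.1 j hj
  have h3 := hrpos K
  simp only [Finset.notMem_empty, if_false]
  rw [abs_le]
  omega

end deterministic

/-! ### Exponential moments of the number of effective arrivals at one site -/

open scoped ENNReal

/-- The laws of the waiting times and of the marks. -/
def inputLaw : Fin 2 → Measure ℝ := ![expMeasure 1, volume.restrict (Set.Icc (0 : ℝ) 1)]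

instance (b : Fin 2) : IsProbabilityMeasure (inputLaw b) := by
  fin_cases b
  · exact isProbabilityMeasure_expMeasure one_pos
  · exact ⟨by simp [inputLaw]⟩

/-- The weight `∏ z`, over the effective arrivals in `(s, t]` among the first `n` arrivals. -/
def weight (z : ℝ≥0∞) (c : ℝ) : (n : ℕ) → (Fin n → Fin 2 → ℝ) → ℝ → ℝ → ℝ≥0∞
  | 0, _, _, _ => 1
  | n + 1, y, s, t => (if s < y 0 0 ∧ y 0 0 ≤ t ∧ y 0 1 ≤ c then z else 1) *
      weight z c n (Fin.tail y) (s - y 0 0) (t - y 0 0)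

lemma measurableSet_effective {α : Type*} [MeasurableSpace α] {f g h k : α → ℝ} (c : ℝ)
    (hf : Measurable f) (hg : Measurable g) (hh : Measurable h) (hk : Measurable k) :
    MeasurableSet {x | f x < g x ∧ g x ≤ h x ∧ k x ≤ c} :=
  (measurableSet_lt hf hg).inter ((measurableSet_le hg hh).inter
    (measurableSet_le hk measurable_const))

lemma measurable_weight (z : ℝ≥0∞) (c : ℝ) (n : ℕ) :
    Measurable fun p : (Fin n → Fin 2 → ℝ) × ℝ × ℝ => weight z c n p.1 p.2.1 p.2.2 := by
  induction n with
  | zero => exact measurable_const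
  | succ n ih =>
    unfold weight
    refine Measurable.mul (Measurable.ite ?_ measurable_const measurable_const) ?_
    · exact measurableSet_effective c (by fun_prop) (by fun_prop) (by fun_prop) (by fun_prop)
    · refine ih.comp (Measurable.prodMk ?_ (Measurable.prodMk (by fun_prop) (by fun_prop)))
      exact measurable_pi_lambda _ fun k => (measurable_pi_apply k.succ).comp measurable_fst

/-- The recursion is a renewal at the first arrival, which becomes the new time origin; unrolling it
restores the arrival times as partial sums of the waiting times. -/
lemma weight_eq_prod (z : ℝ≥0∞) (c : ℝ) (n : ℕ) (y : ℕ → Fin 2 → ℝ) (s t : ℝ) :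
    weight z c n (fun k b => y k b) s t = ∏ i ∈ Finset.range n,
      if s < ∑ j ∈ Finset.range (i + 1), y j 0 ∧ ∑ j ∈ Finset.range (i + 1), y j 0 ≤ t ∧ y i 1 ≤ c
        then z else 1 := by
  induction n generalizing y s t with
  | zero => simp [weight]
  | succ n ih =>
    rw [weight, Finset.prod_range_succ', mul_comm]
    congr 1
    · have := ih (fun k => y (k + 1)) (s - y 0 0) (t - y 0 0)
      have htail : Fin.tail (fun (k : Fin (n + 1)) b => y k b) =
          fun (k : Fin n) b => y (k + 1) b := by
        ext k b
        simp [Fin.tail]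
      rw [htail]
      refine this.trans (Finset.prod_congr rfl fun i _ => ?_)
      rw [Finset.sum_range_succ' _ (i + 1)]
      simp only [sub_lt_iff_lt_add, le_sub_iff_add_le]
    · simp only [zero_add, Finset.sum_range_one]
      rfl

/-- The bound on the expected weight. -/
def weightBound (q a : ℝ) (n : ℕ) (s t : ℝ) : ℝ :=
  if t < 0 then 1 else Real.exp ((q - 1) * (t - max s 0)) + a * Real.exp t * (1 / 2) ^ n

lemma setLIntegral_ofReal_eq_sub {f F : ℝ → ℝ} {a b : ℝ} (hab : a ≤ b) (hf : Continuous f)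
    (hf0 : ∀ x, 0 ≤ f x) (hF : ∀ x, HasDerivAt F (f x) x) :
    ∫⁻ x in Set.Ioc a b, ENNReal.ofReal (f x) = ENNReal.ofReal (F b - F a) := by
  rw [← ofReal_integral_eq_lintegral_ofReal (hf.integrableOn_Ioc) (ae_of_all _ hf0),
    ← intervalIntegral.integral_of_le hab,
    intervalIntegral.integral_eq_sub_of_hasDerivAt (fun x _ => hF x) (hf.intervalIntegrable _ _)]

lemma lintegral_expMeasure (f : ℝ → ℝ≥0∞) (hf : Measurable f) :
    ∫⁻ g, f g ∂(expMeasure 1) = ∫⁻ g in Set.Ioi 0, ENNReal.ofReal (Real.exp (-g)) * f g := by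
  have h1 : expMeasure 1 = volume.withDensity (exponentialPDF 1) := rfl
  have h2 : Measurable (exponentialPDF 1) := (measurable_exponentialPDFReal 1).ennreal_ofReal
  rw [h1, lintegral_withDensity_eq_lintegral_mul _ h2 hf, ← lintegral_indicator measurableSet_Ioi]
  apply lintegral_congr_ae
  have h0 : ∀ᵐ g : ℝ, g ≠ 0 := by
    rw [ae_iff]
    simp
  filter_upwards [h0] with g hg
  rcases lt_or_gt_of_ne hg with hlt | hgt
  · rw [Set.indicator_of_notMem (by simp; exact hlt.le), Pi.mul_apply,
      exponentialPDF_of_neg hlt, zero_mul]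
  · rw [Set.indicator_of_mem (by simpa using hgt), Pi.mul_apply, exponentialPDF_of_nonneg hgt.le]
    simp

lemma setLIntegral_exp_neg_Ioi (t : ℝ) :
    ∫⁻ g in Set.Ioi t, ENNReal.ofReal (Real.exp (-g)) = ENNReal.ofReal (Real.exp (-t)) := by
  rw [← integral_exp_neg_Ioi t, ofReal_integral_eq_lintegral_ofReal (integrableOn_exp_neg_Ioi t)
    (ae_of_all _ fun x => (Real.exp_pos _).le)]

/-- One renewal step. The first waiting time `g` falls before the interval, inside it or after it;
the three contributions of the main term add up exactly to the main term again. The error term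
acquires a factor `exp (-2 * g)`, whose integral is at most one half. -/
lemma lintegral_weightBound_le {q a : ℝ} (hq : 0 ≤ q) (ha : 0 ≤ a) (hqa : q ≤ 1 ∨ a = 0) (n : ℕ)
    {s t : ℝ} (hst : s ≤ t) :
    ∫⁻ g, (if s < g ∧ g ≤ t then ENNReal.ofReal q else 1) *
      ENNReal.ofReal (weightBound q a n (s - g) (t - g)) ∂(expMeasure 1) ≤
      ENNReal.ofReal (weightBound q a (n + 1) s t) := by
  have hmeas : Measurable fun g => (if s < g ∧ g ≤ t then ENNReal.ofReal q else 1) *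
      ENNReal.ofReal (weightBound q a n (s - g) (t - g)) := by
    refine Measurable.mul (Measurable.ite ?_ measurable_const measurable_const) ?_
    · exact (measurableSet_lt measurable_const measurable_id).inter
        (measurableSet_le measurable_id measurable_const)
    · unfold weightBound
      refine Measurable.ennreal_ofReal (Measurable.ite ?_ measurable_const ?_)
      · exact measurableSet_lt (by fun_prop) measurable_const
      · fun_prop
  rw [lintegral_expMeasure _ hmeas]
  by_cases ht : t < 0
  · rw [weightBound, if_pos ht]
    refine (setLIntegral_mono (g := fun g => ENNReal.ofReal (Real.exp (-g)))
      (by fun_prop) fun g hg => ?_).trans ?_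
    · have hg : 0 < g := hg
      rw [if_neg (fun h => by linarith [h.2]), weightBound, if_pos (by linarith)]
      simp
    · rw [setLIntegral_exp_neg_Ioi]
      simp
  push Not at ht
  set s' := max s 0 with hs'
  have hs't : s' ≤ t := max_le hst ht
  have hs'0 : 0 ≤ s' := le_max_right _ _
  set A := a * Real.exp t * (1 / 2) ^ n with hA
  have hA0 : 0 ≤ A := by positivity
  set B := Real.exp ((q - 1) * (t - s')) with hB
  have hB0 : 0 ≤ B := (Real.exp_pos _).le
  have hIoi : Set.Ioi (0 : ℝ) = Set.Ioc 0 s' ∪ (Set.Ioc s' t ∪ Set.Ioi t) := by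
    rw [Set.Ioc_union_Ioi_eq_Ioi hs't, Set.Ioc_union_Ioi_eq_Ioi hs'0]
  have hp1 : ∫⁻ g in Set.Ioc 0 s', ENNReal.ofReal (Real.exp (-g)) *
      ((if s < g ∧ g ≤ t then ENNReal.ofReal q else 1) *
        ENNReal.ofReal (weightBound q a n (s - g) (t - g))) ≤
      ENNReal.ofReal ((-(B * Real.exp (-s')) - A / 2 * Real.exp (-2 * s')) -
        (-(B * Real.exp (-0)) - A / 2 * Real.exp (-2 * 0))) := by
    rw [← setLIntegral_ofReal_eq_sub (f := fun g => B * Real.exp (-g) + A * Real.exp (-2 * g))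
      (F := fun g => -(B * Real.exp (-g)) - A / 2 * Real.exp (-2 * g)) hs'0 (by fun_prop)
      (fun x => by positivity)]
    · refine setLIntegral_mono (by fun_prop) fun g hg => ?_
      have hsg : g ≤ s := by
        by_contra! h
        exact absurd hg.2 (not_le.2 (max_lt h hg.1))
      have hss : s' = s := max_eq_left (hg.1.le.trans hsg)
      have htg : ¬ t - g < 0 := by linarith [hg.2]
      rw [if_neg (fun h => by linarith [h.1]), one_mul, weightBound, if_neg htg,
        ← ENNReal.ofReal_mul (Real.exp_pos _).le, max_eq_left (by linarith)]
      apply ENNReal.ofReal_le_ofReal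
      apply le_of_eq
      have e1 : t - g - (s - g) = t - s' := by rw [hss]; ring
      have e2 : Real.exp (-g) * Real.exp (t - g) = Real.exp t * Real.exp (-2 * g) := by
        rw [← Real.exp_add, ← Real.exp_add]
        ring_nf
      rw [e1, hA, hB]
      linear_combination (a * (1 / 2) ^ n) * e2
    · intro x
      have h1 : HasDerivAt (fun g : ℝ => Real.exp (-g)) (Real.exp (-x) * -1) x :=
        (hasDerivAt_neg x).exp
      have h2 : HasDerivAt (fun g : ℝ => Real.exp (-2 * g)) (Real.exp (-2 * x) * (-2 * 1)) x :=
        ((hasDerivAt_id x).const_mul (-2)).exp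
      exact (((h1.const_mul B).neg).sub (h2.const_mul (A / 2))).congr_deriv (by ring)
  have hp2 : ∫⁻ g in Set.Ioc s' t, ENNReal.ofReal (Real.exp (-g)) *
      ((if s < g ∧ g ≤ t then ENNReal.ofReal q else 1) *
        ENNReal.ofReal (weightBound q a n (s - g) (t - g))) ≤
      ENNReal.ofReal ((-(Real.exp ((q - 1) * t) * Real.exp (-q * t)) -
        A / 2 * Real.exp (-2 * t)) -
        (-(Real.exp ((q - 1) * t) * Real.exp (-q * s')) - A / 2 * Real.exp (-2 * s'))) := by
    rw [← setLIntegral_ofReal_eq_sub (f := fun g => q * Real.exp ((q - 1) * t) * Real.exp (-q * g) +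
        A * Real.exp (-2 * g))
      (F := fun g => -(Real.exp ((q - 1) * t) * Real.exp (-q * g)) - A / 2 * Real.exp (-2 * g))
      hs't (by fun_prop) (fun x => by positivity)]
    · refine setLIntegral_mono (by fun_prop) fun g hg => ?_
      have hsg : s < g := (le_max_left s 0).trans_lt hg.1
      have htg : ¬ t - g < 0 := by linarith [hg.2]
      rw [if_pos ⟨hsg, hg.2⟩, weightBound, if_neg htg, ← ENNReal.ofReal_mul hq,
        ← ENNReal.ofReal_mul (Real.exp_pos _).le, max_eq_right (by linarith)]
      apply ENNReal.ofReal_le_ofReal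
      have e1 : Real.exp (-g) * Real.exp ((q - 1) * (t - g - 0)) =
          Real.exp ((q - 1) * t) * Real.exp (-q * g) := by
        rw [← Real.exp_add, ← Real.exp_add]
        ring_nf
      have e2 : Real.exp (-g) * Real.exp (t - g) = Real.exp t * Real.exp (-2 * g) := by
        rw [← Real.exp_add, ← Real.exp_add]
        ring_nf
      -- The error term is not to be amplified by `q`: either `q ≤ 1` or there is no error term.
      have e3 : q * a ≤ a := by
        rcases hqa with h | h
        · nlinarith
        · simp [h]
      have e4 : Real.exp (-g) * (q * (Real.exp ((q - 1) * (t - g - 0)) +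
          a * Real.exp (t - g) * (1 / 2) ^ n)) =
          q * (Real.exp ((q - 1) * t) * Real.exp (-q * g)) +
            q * a * (Real.exp t * (1 / 2) ^ n * Real.exp (-2 * g)) := by
        linear_combination q * e1 + (q * a * (1 / 2) ^ n) * e2
      rw [e4, hA]
      have e5 := mul_le_mul_of_nonneg_right e3
        (by positivity : 0 ≤ Real.exp t * (1 / 2) ^ n * Real.exp (-2 * g))
      nlinarith
    · intro x
      have h1 : HasDerivAt (fun g : ℝ => Real.exp (-q * g)) (Real.exp (-q * x) * (-q * 1)) x :=
        ((hasDerivAt_id x).const_mul (-q)).exp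
      have h2 : HasDerivAt (fun g : ℝ => Real.exp (-2 * g)) (Real.exp (-2 * x) * (-2 * 1)) x :=
        ((hasDerivAt_id x).const_mul (-2)).exp
      exact (((h1.const_mul _).neg).sub (h2.const_mul (A / 2))).congr_deriv (by ring)
  have hp3 : ∫⁻ g in Set.Ioi t, ENNReal.ofReal (Real.exp (-g)) *
      ((if s < g ∧ g ≤ t then ENNReal.ofReal q else 1) *
        ENNReal.ofReal (weightBound q a n (s - g) (t - g))) ≤ ENNReal.ofReal (Real.exp (-t)) := by
    rw [← setLIntegral_exp_neg_Ioi]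
    refine setLIntegral_mono (by fun_prop) fun g hg => ?_
    have hg : t < g := hg
    rw [if_neg (fun h => by linarith [h.2]), weightBound, if_pos (by linarith)]
    simp
  rw [hIoi]
  refine (lintegral_union_le _ _ _).trans ((add_le_add hp1 ((lintegral_union_le _ _ _).trans
    (add_le_add hp2 hp3))).trans ?_)
  have m1 : Real.exp (-s') ≤ 1 := Real.exp_le_one_iff.2 (by linarith)
  have m2 : Real.exp (-2 * s') ≤ 1 := Real.exp_le_one_iff.2 (by linarith)
  have m3 : Real.exp (-2 * t) ≤ Real.exp (-2 * s') := Real.exp_le_exp.2 (by linarith)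
  have m4 : Real.exp (-q * t) ≤ Real.exp (-q * s') := Real.exp_le_exp.2 (by nlinarith)
  have m5 : Real.exp ((q - 1) * t) * Real.exp (-q * t) = Real.exp (-t) := by
    rw [← Real.exp_add]
    ring_nf
  have m6 : Real.exp ((q - 1) * t) * Real.exp (-q * s') = B * Real.exp (-s') := by
    rw [hB, ← Real.exp_add, ← Real.exp_add]
    ring_nf
  have n1 : 0 ≤ (-(B * Real.exp (-s')) - A / 2 * Real.exp (-2 * s')) -
        (-(B * Real.exp (-0)) - A / 2 * Real.exp (-2 * 0)) := by
    simp only [neg_zero, mul_zero, Real.exp_zero]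
    nlinarith
  have n2 : 0 ≤ (-(Real.exp ((q - 1) * t) * Real.exp (-q * t)) -
        A / 2 * Real.exp (-2 * t)) -
        (-(Real.exp ((q - 1) * t) * Real.exp (-q * s')) - A / 2 * Real.exp (-2 * s')) := by
    have := mul_le_mul_of_nonneg_left m4 (Real.exp_pos ((q - 1) * t)).le
    have := mul_le_mul_of_nonneg_left m3 (by positivity : 0 ≤ A / 2)
    linarith
  rw [← ENNReal.ofReal_add n2 (Real.exp_pos _).le, ← ENNReal.ofReal_add n1 (by positivity),
    weightBound, if_neg (not_lt.2 ht)]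
  apply ENNReal.ofReal_le_ofReal
  rw [m5, m6, pow_succ]
  simp only [neg_zero, mul_zero, Real.exp_zero]
  have hAt : 0 ≤ A / 2 * Real.exp (-2 * t) := by positivity
  have : a * Real.exp t * ((1 / 2) ^ n * (1 / 2)) = A / 2 := by
    rw [hA]
    ring
  rw [this]
  linarith

/-- The probability that a mark is at most `c`. -/
lemma lintegral_mark {z c : ℝ} (hz : 0 ≤ z) (hc : 0 ≤ c) :
    ∫⁻ u, (if u ≤ c then ENNReal.ofReal z else 1) ∂(volume.restrict (Set.Icc (0 : ℝ) 1)) =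
      ENNReal.ofReal (1 + (z - 1) * min c 1) := by
  have hfun : (fun u : ℝ => if u ≤ c then ENNReal.ofReal z else 1) =
      fun u => (Set.Iic c).indicator (fun _ => ENNReal.ofReal z) u +
        (Set.Ioi c).indicator (fun _ => 1) u := by
    ext u
    by_cases hu : u ≤ c
    · simp [hu]
    · simp [hu, not_le.1 hu]
  rw [hfun, lintegral_add_left (by fun_prop (disch := measurability)),
    lintegral_indicator measurableSet_Iic, lintegral_indicator measurableSet_Ioi]
  simp only [lintegral_const, one_mul]
  rw [Measure.restrict_apply MeasurableSet.univ, Measure.restrict_apply MeasurableSet.univ,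
    Set.univ_inter, Set.univ_inter, Measure.restrict_apply measurableSet_Iic,
    Measure.restrict_apply measurableSet_Ioi]
  have h1 : volume (Set.Iic c ∩ Set.Icc (0 : ℝ) 1) = ENNReal.ofReal (min c 1) := by
    have : Set.Iic c ∩ Set.Icc (0 : ℝ) 1 = Set.Icc 0 (min c 1) := by
      ext u
      simp
      tauto
    rw [this, Real.volume_Icc, sub_zero]
  have h2 : volume (Set.Ioi c ∩ Set.Icc (0 : ℝ) 1) = ENNReal.ofReal (1 - min c 1) := by
    by_cases hc1 : c ≤ 1
    · have : Set.Ioi c ∩ Set.Icc (0 : ℝ) 1 = Set.Ioc c 1 := by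
        ext u
        simp only [Set.mem_inter_iff, Set.mem_Ioi, Set.mem_Icc, Set.mem_Ioc]
        constructor
        · tauto
        · intro h
          exact ⟨h.1, by linarith, h.2⟩
      rw [this, Real.volume_Ioc, min_eq_left hc1]
    · have : Set.Ioi c ∩ Set.Icc (0 : ℝ) 1 = ∅ := by
        ext u
        simp only [Set.mem_inter_iff, Set.mem_Ioi, Set.mem_Icc, Set.mem_empty_iff_false, iff_false]
        intro h
        linarith [h.1, h.2.2]
      rw [this, min_eq_right (by linarith)]
      simp
  rw [h1, h2, ← ENNReal.ofReal_mul hz, ← ENNReal.ofReal_add]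
  · congr 1
    ring
  · positivity
  · simp

/-- Averaging `z` over the mark replaces it by `q = 1 + (z - 1) * min c 1`, and the full Poisson
process would give the exponential exactly. Keeping only `n` arrivals decreases the weight when `z ≥
1`, so no error is needed; when `z ≤ 1` the error is at most the probability that the `n` arrivals
all precede `t`, at most `exp t * (1 / 2) ^ n`. -/
lemma lintegral_weight_le {z c a : ℝ} (hz : 0 ≤ z) (hc : 0 ≤ c) (ha : 0 ≤ a)
    (hza : (1 ≤ z ∧ a = 0) ∨ (z ≤ 1 ∧ a = 1)) (n : ℕ) {s t : ℝ} (hst : s ≤ t) :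
    ∫⁻ y, weight (ENNReal.ofReal z) c n y s t ∂(Measure.pi fun _ : Fin n => Measure.pi inputLaw) ≤
      ENNReal.ofReal (weightBound (1 + (z - 1) * min c 1) a n s t) := by
  have hm0 : 0 ≤ min c 1 := le_min hc zero_le_one
  have hm1 : min c 1 ≤ 1 := min_le_right _ _
  set q := 1 + (z - 1) * min c 1 with hq
  have hq0 : 0 ≤ q := by
    have : z * min c 1 ≥ 0 := by positivity
    nlinarith
  have hqa : q ≤ 1 ∨ a = 0 := by
    rcases hza with h | h
    · exact Or.inr h.2
    · left
      nlinarith [h.1]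
  induction n generalizing s t with
  | zero =>
    simp only [weight, lintegral_const, measure_univ, mul_one]
    rw [← ENNReal.ofReal_one]
    apply ENNReal.ofReal_le_ofReal
    unfold weightBound
    split_ifs with ht
    · exact le_rfl
    · push Not at ht
      have hts : 0 ≤ t - max s 0 := sub_nonneg.2 (max_le hst ht)
      rcases hza with h | h
      · have : 1 ≤ Real.exp ((q - 1) * (t - max s 0)) := by
          apply Real.one_le_exp
          have : 0 ≤ q - 1 := by nlinarith [h.1]
          positivity
        rw [h.2]
        linarith
      · rw [h.2]
        have h1 := Real.one_le_exp ht
        have h2 := Real.exp_pos ((q - 1) * (t - max s 0))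
        linarith
  | succ n ih =>
    -- The first arrival is split off; the later ones are handled by induction with shifted `s` and
    -- `t`, which may become negative.
    rw [← (measurePreserving_piFinSuccAbove (fun _ : Fin (n + 1) => Measure.pi inputLaw) 0).symm
      (MeasurableEquiv.piFinSuccAbove (fun _ => Fin 2 → ℝ) 0) |>.lintegral_comp_emb
        (MeasurableEquiv.measurableEmbedding _)]
    have hrew : ∀ p : (Fin 2 → ℝ) × (Fin n → Fin 2 → ℝ),
        weight (ENNReal.ofReal z) c (n + 1)
          ((MeasurableEquiv.piFinSuccAbove (fun _ => Fin 2 → ℝ) 0).symm p) s t =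
        (if s < p.1 0 ∧ p.1 0 ≤ t ∧ p.1 1 ≤ c then ENNReal.ofReal z else 1) *
          weight (ENNReal.ofReal z) c n p.2 (s - p.1 0) (t - p.1 0) := by
      intro p
      rfl
    simp only [hrew]
    have hmeas : Measurable fun p : (Fin 2 → ℝ) × (Fin n → Fin 2 → ℝ) =>
        (if s < p.1 0 ∧ p.1 0 ≤ t ∧ p.1 1 ≤ c then ENNReal.ofReal z else 1) *
          weight (ENNReal.ofReal z) c n p.2 (s - p.1 0) (t - p.1 0) := by
      refine Measurable.mul (Measurable.ite ?_ measurable_const measurable_const) ?_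
      · exact measurableSet_effective c (by fun_prop) (by fun_prop) (by fun_prop) (by fun_prop)
      · exact (measurable_weight _ c n).comp
          (Measurable.prodMk measurable_snd (Measurable.prodMk (by fun_prop) (by fun_prop)))
    rw [lintegral_prod _ hmeas.aemeasurable]
    have hstep : ∀ x : Fin 2 → ℝ,
        ∫⁻ y, (if s < x 0 ∧ x 0 ≤ t ∧ x 1 ≤ c then ENNReal.ofReal z else 1) *
          weight (ENNReal.ofReal z) c n y (s - x 0) (t - x 0)
            ∂(Measure.pi fun _ : Fin n => Measure.pi inputLaw) ≤
        (if s < x 0 ∧ x 0 ≤ t ∧ x 1 ≤ c then ENNReal.ofReal z else 1) *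
          ENNReal.ofReal (weightBound q a n (s - x 0) (t - x 0)) := by
      intro x
      have hm : Measurable fun y => weight (ENNReal.ofReal z) c n y (s - x 0) (t - x 0) :=
        (measurable_weight _ c n).comp
          (Measurable.prodMk measurable_id (Measurable.prodMk measurable_const measurable_const))
      rw [lintegral_const_mul _ hm]
      gcongr
      exact ih (by linarith)
    refine (lintegral_mono hstep).trans ?_
    refine le_trans (le_of_eq ?_) (lintegral_weightBound_le hq0 ha hqa n hst)
    rw [← (measurePreserving_piFinTwo inputLaw).symm
      (MeasurableEquiv.piFinTwo fun _ => ℝ) |>.lintegral_comp_emb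
        (MeasurableEquiv.measurableEmbedding _)]
    have hrew2 : ∀ p : ℝ × ℝ, (MeasurableEquiv.piFinTwo fun _ : Fin 2 => ℝ).symm p 0 = p.1 ∧
        (MeasurableEquiv.piFinTwo fun _ : Fin 2 => ℝ).symm p 1 = p.2 := fun p => ⟨rfl, rfl⟩
    simp only [fun p => (hrew2 p).1, fun p => (hrew2 p).2]
    have hwb : Measurable fun g => weightBound q a n (s - g) (t - g) := by
      unfold weightBound
      refine Measurable.ite ?_ measurable_const (by fun_prop)
      exact measurableSet_lt (by fun_prop) measurable_const
    rw [lintegral_prod]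
    · refine lintegral_congr fun g => ?_
      dsimp only
      rw [lintegral_mul_const]
      · congr 1
        by_cases hg : s < g ∧ g ≤ t
        · simp only [hg, true_and, if_true]
          exact lintegral_mark hz hc
        · have : ∀ u : ℝ, ¬ (s < g ∧ g ≤ t ∧ u ≤ c) := fun u h => hg ⟨h.1, h.2.1⟩
          simp only [this, hg, if_false, lintegral_const, measure_univ, mul_one]
      · refine Measurable.ite ?_ measurable_const measurable_const
        exact (MeasurableSet.const _).inter ((MeasurableSet.const _).inter
            (measurableSet_le measurable_id measurable_const))
    · refine Measurable.aemeasurable (Measurable.mul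
        (Measurable.ite ?_ measurable_const measurable_const) ?_)
      · exact measurableSet_effective c (by fun_prop) (by fun_prop) (by fun_prop) (by fun_prop)
      · exact (hwb.comp measurable_fst).ennreal_ofReal

open scoped ENNReal

/-! ### Poisson estimates over finite sets of sites -/

section probability

variable {d : ℕ} {Ω : Type*} [MeasurableSpace Ω] {P : Measure Ω}
  {gap U : Site d → ℕ → Ω → ℝ}

/-- The law of the input, site by site. -/
lemma IsGraphicalInput.hasLaw (h : IsGraphicalInput P gap U) :
    HasLaw (fun ω (x : Site d) (k : ℕ × Fin 2) => if k.2 = 0 then gap x k.1 ω else U x k.1 ω)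
      (Measure.infinitePi fun _ : Site d => Measure.infinitePi fun k : ℕ × Fin 2 => inputLaw k.2)
      P := by
  set e : Site d × (ℕ × Fin 2) → (Site d × ℕ) ⊕ (Site d × ℕ) := fun p =>
    if p.2.2 = 0 then Sum.inl (p.1, p.2.1) else Sum.inr (p.1, p.2.1) with he
  have hinj : Function.Injective e := by
    rintro ⟨x, i, b⟩ ⟨x', i', b'⟩ hh
    fin_cases b <;> fin_cases b' <;> simp [he] at hh ⊢ <;> exact hh
  have hind := h.indep.precomp hinj
  have hX : ∀ p : Site d × (ℕ × Fin 2), HasLaw ((Sum.elim (fun p : Site d × ℕ => gap p.1 p.2)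
      (fun p : Site d × ℕ => U p.1 p.2)) (e p)) (inputLaw p.2.2) P := by
    rintro ⟨x, i, b⟩
    fin_cases b
    · exact h.gap_law x i
    · exact h.mark_law x i
  have hlaw := iIndepFun.hasLaw_infinitePi hX hind
    (aemeasurable_pi_lambda _ fun p => (hX p).aemeasurable)
  have hcurry : HasLaw (MeasurableEquiv.curry (Site d) (ℕ × Fin 2) ℝ)
      (Measure.infinitePi fun _ : Site d => Measure.infinitePi fun k : ℕ × Fin 2 => inputLaw k.2)
      (Measure.infinitePi fun p : Site d × (ℕ × Fin 2) => inputLaw p.2.2) :=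
    ⟨(MeasurableEquiv.measurable _).aemeasurable,
      Measure.infinitePi_map_curry (fun (_ : Site d) (k : ℕ × Fin 2) => inputLaw k.2)⟩
  convert hcurry.comp hlaw using 1
  ext ω x k
  simp only [Function.comp_apply, MeasurableEquiv.coe_curry, Function.curry, he]
  split_ifs <;> rfl

/-- The weight of the first `n` arrivals at a site, as a function of the input at the site. -/
def siteWeight (z : ℝ≥0∞) (c : ℝ) (n : ℕ) (s t : ℝ) (y : ℕ × Fin 2 → ℝ) : ℝ≥0∞ :=
  weight z c n (fun k b => y (k, b)) s t

lemma measurable_siteWeight (z : ℝ≥0∞) (c : ℝ) (n : ℕ) (s t : ℝ) :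
    Measurable (siteWeight z c n s t) := by
  unfold siteWeight
  refine (measurable_weight z c n).comp (Measurable.prodMk ?_
    (Measurable.prodMk measurable_const measurable_const))
  exact measurable_pi_lambda _ fun k => measurable_pi_lambda _ fun b => measurable_pi_apply _

lemma lintegral_siteWeight (z : ℝ≥0∞) (c : ℝ) (n : ℕ) (s t : ℝ) :
    ∫⁻ y, siteWeight z c n s t y ∂(Measure.infinitePi fun k : ℕ × Fin 2 => inputLaw k.2) =
      ∫⁻ y, weight z c n y s t ∂(Measure.pi fun _ : Fin n => Measure.pi inputLaw) := by
  set Q := Measure.infinitePi fun k : ℕ × Fin 2 => inputLaw k.2 with hQ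
  have hind : iIndepFun (fun (k : ℕ × Fin 2) (y : ℕ × Fin 2 → ℝ) => y k) Q :=
    iIndepFun_infinitePi (X := fun _ => id) fun _ => measurable_id
  set e : Fin n × Fin 2 → ℕ × Fin 2 := fun p => (p.1, p.2) with he
  have hinj : Function.Injective e := by
    rintro ⟨i, b⟩ ⟨i', b'⟩ hh
    simp only [he, Prod.mk.injEq] at hh
    exact Prod.ext (Fin.ext hh.1) hh.2
  have hX : ∀ p : Fin n × Fin 2, HasLaw (fun y : ℕ × Fin 2 → ℝ => y (e p)) (inputLaw p.2) Q :=
    fun p => ⟨(measurable_pi_apply _).aemeasurable, Measure.infinitePi_map_eval _ (e p)⟩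
  have hlaw := iIndepFun.hasLaw_infinitePi hX (hind.precomp hinj)
    (aemeasurable_pi_lambda _ fun p => (hX p).aemeasurable)
  have hcurry : HasLaw (MeasurableEquiv.curry (Fin n) (Fin 2) ℝ)
      (Measure.infinitePi fun _ : Fin n => Measure.infinitePi fun b : Fin 2 => inputLaw b)
      (Measure.infinitePi fun p : Fin n × Fin 2 => inputLaw p.2) :=
    ⟨(MeasurableEquiv.measurable _).aemeasurable,
      Measure.infinitePi_map_curry (fun (_ : Fin n) (b : Fin 2) => inputLaw b)⟩
  have h2 := hcurry.comp hlaw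
  rw [Measure.infinitePi_eq_pi, Measure.infinitePi_eq_pi] at h2
  have hm : Measurable fun y => weight z c n y s t := (measurable_weight z c n).comp
    (Measurable.prodMk measurable_id (Measurable.prodMk measurable_const measurable_const))
  rw [← h2.lintegral_comp hm.aemeasurable]
  rfl

/-- The weight of the first `n` arrivals at each site of `S`. -/
def totalWeight (gap U : Site d → ℕ → Ω → ℝ) (z : ℝ≥0∞) (c : ℝ) (S : Finset (Site d)) (n : ℕ)
    (s t : ℝ) (ω : Ω) : ℝ≥0∞ :=
  ∏ x ∈ S, ∏ i ∈ Finset.range n,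
    if s < arrival (fun x i => gap x i ω) (x, i) ∧ arrival (fun x i => gap x i ω) (x, i) ≤ t ∧
      U x i ω ≤ c then z else 1

omit [MeasurableSpace Ω] in
lemma totalWeight_eq (z : ℝ≥0∞) (c : ℝ) (S : Finset (Site d)) (n : ℕ) (s t : ℝ) (ω : Ω) :
    totalWeight gap U z c S n s t ω = ∏ x ∈ S, siteWeight z c n s t
      (fun k => if k.2 = 0 then gap x k.1 ω else U x k.1 ω) := by
  unfold totalWeight siteWeight
  refine Finset.prod_congr rfl fun x _ => ?_
  exact (weight_eq_prod z c n (fun i b => if b = 0 then gap x i ω else U x i ω) s t).symm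

lemma aemeasurable_totalWeight (h : IsGraphicalInput P gap U) (z : ℝ≥0∞) (c : ℝ)
    (S : Finset (Site d)) (n : ℕ) (s t : ℝ) :
    AEMeasurable (totalWeight gap U z c S n s t) P := by
  have : totalWeight gap U z c S n s t = fun ω => ∏ x ∈ S, siteWeight z c n s t
      (fun k => if k.2 = 0 then gap x k.1 ω else U x k.1 ω) := funext fun ω => totalWeight_eq ..
  rw [this]
  have hm : Measurable fun y : Site d → ℕ × Fin 2 → ℝ => ∏ x ∈ S, siteWeight z c n s t (y x) :=
    Finset.measurable_prod _ fun x _ =>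
      (measurable_siteWeight z c n s t).comp (measurable_pi_apply x)
  exact hm.comp_aemeasurable h.hasLaw.aemeasurable

lemma lintegral_totalWeight (h : IsGraphicalInput P gap U) (z : ℝ≥0∞) (c : ℝ)
    (S : Finset (Site d)) (n : ℕ) (s t : ℝ) :
    ∫⁻ ω, totalWeight gap U z c S n s t ω ∂P =
      (∫⁻ y, weight z c n y s t ∂(Measure.pi fun _ : Fin n => Measure.pi inputLaw)) ^ S.card := by
  simp only [totalWeight_eq]
  have hm : Measurable fun y : Site d → ℕ × Fin 2 → ℝ => ∏ x ∈ S, siteWeight z c n s t (y x) :=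
    Finset.measurable_prod _ fun x _ =>
      (measurable_siteWeight z c n s t).comp (measurable_pi_apply x)
  have := h.hasLaw.lintegral_comp hm.aemeasurable
  refine this.trans ?_
  set ρ := Measure.infinitePi fun k : ℕ × Fin 2 => inputLaw k.2 with hρ
  have hms : ∀ x : Site d, Measurable fun y : Site d → ℕ × Fin 2 → ℝ =>
      siteWeight z c n s t (y x) :=
    fun x => (measurable_siteWeight z c n s t).comp (measurable_pi_apply x)
  rw [lintegral_prod_eq_prod_lintegral_of_indepFun S
    (fun x (y : Site d → ℕ × Fin 2 → ℝ) => siteWeight z c n s t (y x))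
    (iIndepFun_infinitePi (P := fun _ : Site d => ρ) (X := fun _ => siteWeight z c n s t)
      fun _ => measurable_siteWeight z c n s t) hms]
  rw [← lintegral_siteWeight, ← Finset.prod_const]
  refine Finset.prod_congr rfl fun x _ => ?_
  rw [← lintegral_map (measurable_siteWeight z c n s t) (measurable_pi_apply x),
    Measure.infinitePi_map_eval]

/-- The set of effective points of the sites of `S` in the time interval `(s, t]`. -/
def effective (gap U : Site d → ℕ → Ω → ℝ) (c : ℝ) (S : Finset (Site d)) (s t : ℝ) (ω : Ω) :
    Set (Site d × ℕ) :=
  {p | p.1 ∈ S ∧ s < arrival (fun x i => gap x i ω) p ∧ arrival (fun x i => gap x i ω) p ≤ t ∧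
    U p.1 p.2 ω ≤ c}

omit [MeasurableSpace Ω] in
lemma totalWeight_eq_pow (z : ℝ≥0∞) (c : ℝ) (S : Finset (Site d)) (n : ℕ) (s t : ℝ) (ω : Ω)
    (A : Finset (Site d × ℕ)) (hA : ∀ p, p ∈ A ↔ p ∈ effective gap U c S s t ω ∧ p.2 < n) :
    totalWeight gap U z c S n s t ω = z ^ A.card := by
  classical
  unfold totalWeight
  rw [← Finset.prod_product', ← Finset.prod_filter, Finset.prod_const]
  congr 2
  ext p
  rw [hA, Finset.mem_filter, Finset.mem_product, Finset.mem_range]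
  simp only [effective, Set.mem_ofPred_eq]
  tauto

/-- There are rarely many effective points. -/
theorem measure_many_le [IsProbabilityMeasure P] (h : IsGraphicalInput P gap U)
    {z c : ℝ} (hz : 1 ≤ z) (hc : 0 ≤ c)
    (S : Finset (Site d)) {s t : ℝ} (hs : 0 ≤ s) (hst : s ≤ t) (K : ℕ) :
    P {ω | ∃ A : Finset (Site d × ℕ), K ≤ A.card ∧ ∀ p ∈ A, p ∈ effective gap U c S s t ω} ≤
      ENNReal.ofReal (Real.exp ((z - 1) * (c * (t - s) * S.card)) / z ^ K) := by
  classical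
  have hz0 : 0 < z := by linarith
  -- Markov's inequality for `z` to the number of effective points, seen among the first `n`
  -- arrivals of each site. These events increase with `n`, and the bound does not depend on `n`.
  set E : ℕ → Set Ω := fun n => {ω | ENNReal.ofReal z ^ K ≤
    totalWeight gap U (ENNReal.ofReal z) c S n s t ω} with hE
  have hz1 : (1 : ℝ≥0∞) ≤ ENNReal.ofReal z := by simpa using hz
  have hmono : Monotone E := by
    intro n n' hn ω hω
    refine le_trans (show ENNReal.ofReal z ^ K ≤
      totalWeight gap U (ENNReal.ofReal z) c S n s t ω from hω) ?_
    unfold totalWeight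
    refine Finset.prod_le_prod' fun x _ => ?_
    refine Finset.prod_le_prod_of_subset_of_one_le' (Finset.range_mono hn) fun i _ _ => ?_
    split_ifs
    · exact hz1
    · exact le_rfl
  have hsub : {ω | ∃ A : Finset (Site d × ℕ), K ≤ A.card ∧
      ∀ p ∈ A, p ∈ effective gap U c S s t ω} ⊆ ⋃ n, E n := by
    rintro ω ⟨A, hAK, hA⟩
    obtain ⟨n, hn⟩ : ∃ n, ∀ p ∈ A, p.2 < n :=
      ⟨A.sup (fun p => p.2) + 1, fun p hp =>
        Nat.lt_succ_of_le (Finset.le_sup (f := fun p => p.2) hp)⟩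
    set B : Finset (Site d × ℕ) := (S ×ˢ Finset.range n).filter
      (fun p => p ∈ effective gap U c S s t ω) with hB
    have hBmem : ∀ p, p ∈ B ↔ p ∈ effective gap U c S s t ω ∧ p.2 < n := by
      intro p
      rw [hB, Finset.mem_filter, Finset.mem_product, Finset.mem_range]
      constructor
      · tauto
      · exact fun hp => ⟨⟨hp.1.1, hp.2⟩, hp.1⟩
    refine Set.mem_iUnion.2 ⟨n, ?_⟩
    change ENNReal.ofReal z ^ K ≤ totalWeight gap U (ENNReal.ofReal z) c S n s t ω
    rw [totalWeight_eq_pow _ c S n s t ω B hBmem]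
    refine pow_le_pow_right₀ hz1 (hAK.trans (Finset.card_le_card fun p hp => ?_))
    exact (hBmem p).2 ⟨hA p hp, hn p hp⟩
  refine (measure_mono hsub).trans ?_
  rw [hmono.measure_iUnion]
  refine iSup_le fun n => ?_
  refine (meas_ge_le_lintegral_div (aemeasurable_totalWeight h _ c S n s t)
    (pow_ne_zero _ (by simpa using hz0)) (ENNReal.pow_ne_top ENNReal.ofReal_ne_top)).trans ?_
  rw [ENNReal.ofReal_div_of_pos (by positivity), ENNReal.ofReal_pow hz0.le]
  gcongr
  rw [lintegral_totalWeight h]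
  have hw := lintegral_weight_le hz0.le hc le_rfl (Or.inl ⟨hz, rfl⟩) n hst
  refine (pow_le_pow_left' hw S.card).trans ?_
  have ht : ¬ t < 0 := by linarith
  rw [weightBound, if_neg ht, max_eq_left hs, zero_mul, zero_mul, add_zero,
    ← ENNReal.ofReal_pow (Real.exp_pos _).le, ← Real.exp_nat_mul]
  apply ENNReal.ofReal_le_ofReal
  apply Real.exp_le_exp.2
  have h1 : min c 1 ≤ c := min_le_left _ _
  have h2 : 0 ≤ (z - 1) * (t - s) * S.card := by
    have : 0 ≤ z - 1 := by linarith
    have : 0 ≤ t - s := by linarith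
    positivity
  nlinarith [mul_le_mul_of_nonneg_left h1 h2]

/-- The probability that there is no effective point. -/
theorem measure_none_le [IsProbabilityMeasure P] (h : IsGraphicalInput P gap U) {c : ℝ} (hc : 0 ≤ c)
    (S : Finset (Site d)) {s t : ℝ} (hs : 0 ≤ s) (hst : s ≤ t) :
    P {ω | ∀ p, p ∉ effective gap U c S s t ω} ≤
      ENNReal.ofReal (Real.exp (-(min c 1 * (t - s) * S.card))) := by
  classical
  -- With `z = 0` the weight is the indicator that none of the first `n` arrivals at each site is
  -- effective; the truncation error vanishes as `n → ∞`.
  have hn : ∀ n : ℕ, P {ω | ∀ p, p ∉ effective gap U c S s t ω} ≤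
      ENNReal.ofReal ((Real.exp (-(min c 1 * (t - s))) + Real.exp t * (1 / 2) ^ n) ^ S.card) := by
    intro n
    have hsub : {ω | ∀ p, p ∉ effective gap U c S s t ω} ⊆
        {ω | 1 ≤ totalWeight gap U (ENNReal.ofReal 0) c S n s t ω} := by
      intro ω hω
      change 1 ≤ totalWeight gap U (ENNReal.ofReal 0) c S n s t ω
      rw [totalWeight_eq_pow _ c S n s t ω ∅ (fun p => by simpa using fun hp => absurd hp (hω p))]
      simp
    refine (measure_mono hsub).trans ((meas_ge_le_lintegral_div
      (aemeasurable_totalWeight h _ c S n s t) one_ne_zero ENNReal.one_ne_top).trans ?_)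
    rw [div_one, lintegral_totalWeight h, ENNReal.ofReal_pow (by positivity)]
    refine pow_le_pow_left' ((lintegral_weight_le le_rfl hc zero_le_one
      (Or.inr ⟨zero_le_one, rfl⟩) n hst).trans (ENNReal.ofReal_le_ofReal ?_)) _
    rw [weightBound, if_neg (by linarith), max_eq_left hs, one_mul]
    gcongr
    apply le_of_eq
    ring
  have hlim : Tendsto (fun n : ℕ => ENNReal.ofReal
      ((Real.exp (-(min c 1 * (t - s))) + Real.exp t * (1 / 2) ^ n) ^ S.card)) atTop
      (𝓝 (ENNReal.ofReal ((Real.exp (-(min c 1 * (t - s))) + Real.exp t * 0) ^ S.card))) := by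
    refine (ENNReal.continuous_ofReal.tendsto _).comp (Tendsto.pow (Tendsto.const_add _
      (Tendsto.const_mul _ (tendsto_pow_atTop_nhds_zero_of_lt_one ?_ ?_))) _)
    · norm_num
    · norm_num
  refine (ge_of_tendsto' hlim hn).trans (le_of_eq ?_)
  rw [mul_zero, add_zero, ← Real.exp_nat_mul]
  congr 2
  ring

lemma ae_gap_pos (h : IsGraphicalInput P gap U) : ∀ᵐ ω ∂P, ∀ x i, 0 < gap x i ω := by
  rw [ae_all_iff]
  intro x
  rw [ae_all_iff]
  intro i
  have hp : Measurable fun g : ℝ => 0 < g := measurableSet_setOfPred.1 measurableSet_Ioi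
  rw [(h.gap_law x i).ae_iff hp, ae_iff]
  have : {g : ℝ | ¬ 0 < g} = Set.Iic 0 := by
    ext
    simp
  rw [this, expMeasure, gammaMeasure, withDensity_apply _ measurableSet_Iic]
  rw [setLIntegral_congr Iio_ae_eq_Iic.symm]
  exact lintegral_exponentialPDF_of_nonpos le_rfl

lemma arrival_pos {g : Site d → ℕ → ℝ} (hg : ∀ x i, 0 < g x i) (p : Site d × ℕ) :
    0 < arrival g p :=
  Finset.sum_pos (fun j _ => hg p.1 j) (by simp)

lemma ae_mark_le_one (h : IsGraphicalInput P gap U) : ∀ᵐ ω ∂P, ∀ x i, U x i ω ≤ 1 := by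
  rw [ae_all_iff]
  intro x
  rw [ae_all_iff]
  intro i
  have hp : Measurable fun u : ℝ => u ≤ 1 := measurableSet_setOfPred.1 measurableSet_Iic
  rw [(h.mark_law x i).ae_iff hp]
  filter_upwards [ae_restrict_mem measurableSet_Icc] with u hu
  exact hu.2

/-- Almost surely, there are finitely many arrivals in bounded regions. -/
lemma ae_finite_arrivals [IsProbabilityMeasure P] (h : IsGraphicalInput P gap U)
    {t : ℝ} (ht : 0 ≤ t) :
    ∀ᵐ ω ∂P, ∀ Λ : Finset (Site d), (arrivalsUpTo (fun x i => gap x i ω) Λ t).Finite := by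
  -- Marks are at most one, so at level `c = 1` every arrival is effective; having `K` of them has
  -- probability at most a constant times `2⁻ᴷ`.
  have hnull : ∀ x : Site d, ∀ᵐ ω ∂P, ¬ ∀ K : ℕ, ∃ A : Finset (Site d × ℕ), K ≤ A.card ∧
      ∀ p ∈ A, p ∈ effective gap U 1 {x} 0 t ω := by
    intro x
    rw [ae_iff]
    simp only [not_not]
    refine le_antisymm (ge_of_tendsto' (x := atTop) (f := fun K : ℕ =>
      ENNReal.ofReal (Real.exp ((2 - 1) * (1 * (t - 0) * ({x} : Finset (Site d)).card)) / 2 ^ K))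
      ?_ fun K => ?_) zero_le
    · rw [← ENNReal.ofReal_zero]
      refine (ENNReal.continuous_ofReal.tendsto _).comp ?_
      refine Tendsto.div_atTop tendsto_const_nhds ?_
      exact tendsto_pow_atTop_atTop_of_one_lt one_lt_two
    · refine (measure_mono ?_).trans (measure_many_le h one_le_two zero_le_one {x} le_rfl ht K)
      exact fun ω hω => hω K
  have hnull' := ae_all_iff.2 hnull
  filter_upwards [ae_mark_le_one h, hnull', ae_gap_pos h] with ω hU hω hgap
  have hfin : ∀ x : Site d, {p : Site d × ℕ | p.1 = x ∧
      arrival (fun x i => gap x i ω) p ≤ t}.Finite := by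
    intro x
    by_contra hinf
    apply hω x
    intro K
    obtain ⟨A, hA, hAK⟩ := Set.Infinite.exists_subset_card_eq hinf K
    refine ⟨A, hAK.ge, fun p hp => ?_⟩
    obtain ⟨h1, h2⟩ := hA hp
    exact ⟨by simpa using h1, arrival_pos hgap p, h2, hU _ _⟩
  intro Λ
  refine (Set.Finite.biUnion Λ.finite_toSet fun x _ => hfin x).subset ?_
  rintro p ⟨h1, h2⟩
  exact Set.mem_iUnion₂.2 ⟨p.1, h1, rfl, h2⟩

end probability

/-! ### Events of probability tending to one, and union bounds -/

section asymptotics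

/-- The event `A β` has a probability which tends to one as `β → ∞`. -/
def Whp {Ω : Type*} [MeasurableSpace Ω] (P : Measure Ω) (A : ℝ → Ω → Prop) : Prop :=
  Tendsto (fun β => P {ω | ¬ A β ω}) atTop (𝓝 0)

variable {Ω : Type*} [MeasurableSpace Ω] {P : Measure Ω} {A B : ℝ → Ω → Prop}

lemma Whp.mono (h : Whp P A) (hAB : ∀ᶠ β in atTop, ∀ ω, A β ω → B β ω) : Whp P B := by
  refine tendsto_of_tendsto_of_tendsto_of_le_of_le' tendsto_const_nhds h
    (Eventually.of_forall fun _ => zero_le) ?_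
  filter_upwards [hAB] with β hβ
  exact measure_mono fun ω hω hA => hω (hβ ω hA)

lemma Whp.and (hA : Whp P A) (hB : Whp P B) : Whp P fun β ω => A β ω ∧ B β ω := by
  have h := Tendsto.add hA hB
  rw [add_zero] at h
  refine tendsto_of_tendsto_of_tendsto_of_le_of_le tendsto_const_nhds h
    (fun _ => zero_le) fun β => ?_
  refine (measure_mono fun ω hω => ?_).trans (measure_union_le _ _)
  by_cases h : A β ω
  · exact Or.inr fun hB => hω ⟨h, hB⟩
  · exact Or.inl h

lemma whp_of_ae (h : ∀ᶠ β in atTop, ∀ᵐ ω ∂P, A β ω) : Whp P A := by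
  refine tendsto_const_nhds.congr' ?_
  filter_upwards [h] with β hβ
  exact (ae_iff.1 hβ).symm

lemma whp_of_le {f : ℝ → ℝ} (h : ∀ᶠ β in atTop, P {ω | ¬ A β ω} ≤ ENNReal.ofReal (f β))
    (hf : Tendsto f atTop (𝓝 0)) : Whp P A := by
  have h0 : Tendsto (fun β => ENNReal.ofReal (f β)) atTop (𝓝 0) := by
    rw [← ENNReal.ofReal_zero]
    exact (ENNReal.continuous_ofReal.tendsto 0).comp hf
  exact tendsto_of_tendsto_of_tendsto_of_le_of_le' tendsto_const_nhds h0
    (Eventually.of_forall fun _ => zero_le) h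

/-- The union bound. -/
lemma whp_ball_of_le {ι : Type*} {S : ℝ → Finset ι} {A : ι → ℝ → Ω → Prop} {N f : ℝ → ℝ}
    (hS : ∀ᶠ β in atTop, ((S β).card : ℝ) ≤ N β)
    (hA : ∀ᶠ β in atTop, ∀ i ∈ S β, P {ω | ¬ A i β ω} ≤ ENNReal.ofReal (f β))
    (hf : ∀ᶠ β in atTop, 0 ≤ f β) (hNf : Tendsto (fun β => N β * f β) atTop (𝓝 0)) :
    Whp P fun β ω => ∀ i ∈ S β, A i β ω := by
  refine whp_of_le (f := fun β => N β * f β) ?_ hNf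
  filter_upwards [hS, hA, hf] with β hS hA hf
  have hsub : {ω | ¬ ∀ i ∈ S β, A i β ω} ⊆ ⋃ i ∈ S β, {ω | ¬ A i β ω} := by
    intro ω hω
    rw [Set.mem_ofPred_eq] at hω
    push Not at hω
    obtain ⟨i, hi, h⟩ := hω
    exact Set.mem_iUnion₂.2 ⟨i, hi, h⟩
  refine (measure_mono hsub).trans ((measure_biUnion_finset_le _ _).trans
    ((Finset.sum_le_card_nsmul _ _ _ hA).trans ?_))
  rw [nsmul_eq_mul, ← ENNReal.ofReal_natCast, ← ENNReal.ofReal_mul (Nat.cast_nonneg _)]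
  exact ENNReal.ofReal_le_ofReal (mul_le_mul_of_nonneg_right hS hf)

lemma whp_ball {ι : Type*} (s : Finset ι) {A : ι → ℝ → Ω → Prop} (h : ∀ i ∈ s, Whp P (A i)) :
    Whp P fun β ω => ∀ i ∈ s, A i β ω := by
  classical
  induction s using Finset.induction_on with
  | empty => exact whp_of_ae (Eventually.of_forall fun β => Eventually.of_forall fun ω => by simp)
  | insert i s _ ih =>
    refine ((h i (by simp)).and (ih fun j hj => h j (by simp [hj]))).mono
      (Eventually.of_forall fun β ω hω j hj => ?_)
    rcases Finset.mem_insert.1 hj with rfl | hj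
    · exact hω.1
    · exact hω.2 j hj

lemma eventually_mul_exp_le (C : ℝ) {a b : ℝ} (h : a < b) :
    ∀ᶠ β : ℝ in atTop, C * Real.exp (β * a) ≤ Real.exp (β * b) := by
  have h1 : Tendsto (fun β : ℝ => Real.exp (β * (b - a))) atTop atTop :=
    Real.tendsto_exp_atTop.comp (tendsto_id.atTop_mul_const (sub_pos.2 h))
  filter_upwards [h1.eventually_ge_atTop C] with β hβ
  calc C * Real.exp (β * a) ≤ Real.exp (β * (b - a)) * Real.exp (β * a) := by gcongr
    _ = Real.exp (β * b) := by rw [← Real.exp_add]; congr 1; ring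

/-- In terms of y = exp(βb) the prefactor is at most a power of y, and exp(-cy) beats every power.
This is what pays for the union bounds over exponentially many boxes. -/
lemma tendsto_exp_mul_exp_neg_exp (C a : ℝ) {b c : ℝ} (hb : 0 < b) (hc : 0 < c) :
    Tendsto (fun β : ℝ => C * Real.exp (β * a) * Real.exp (-(c * Real.exp (β * b)))) atTop
      (𝓝 0) := by
  obtain ⟨n, hn⟩ := exists_nat_ge (a / b)
  have h1 : Tendsto (fun β : ℝ => c * Real.exp (β * b)) atTop atTop :=
    (Real.tendsto_exp_atTop.comp (tendsto_id.atTop_mul_const hb)).const_mul_atTop hc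
  have h2 := ((Real.tendsto_pow_mul_exp_neg_atTop_nhds_zero n).comp h1).const_mul (|C| / c ^ n)
  rw [mul_zero] at h2
  refine squeeze_zero_norm' ?_ h2
  filter_upwards [eventually_ge_atTop 0] with β hβ
  have h3 : Real.exp (β * a) ≤ Real.exp (β * b) ^ n := by
    rw [← Real.exp_nat_mul]
    apply Real.exp_le_exp.2
    rw [div_le_iff₀ hb] at hn
    nlinarith
  simp only [Function.comp_apply, norm_mul, Real.norm_eq_abs, Real.abs_exp, mul_pow]
  calc |C| * Real.exp (β * a) * Real.exp (-(c * Real.exp (β * b)))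
      ≤ |C| * Real.exp (β * b) ^ n * Real.exp (-(c * Real.exp (β * b))) := by gcongr
    _ = |C| / c ^ n * (c ^ n * Real.exp (β * b) ^ n * Real.exp (-(c * Real.exp (β * b)))) := by
      field_simp

end asymptotics

/-! ### Rates and critical exponents -/

section rates

variable {d : ℕ} {c : ℝ → ℕ → ℝ} {Γ : ℕ → ℝ}

/-- The two limits assumed for the rates overlap at `n = d`. -/
lemma RateHypothesis.energy_zero (hc : RateHypothesis d c Γ) : Γ 0 = 0 := by
  have h1 := hc.lim_low d le_rfl
  have h2 := hc.lim_high d le_rfl (by omega)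
  have := tendsto_nhds_unique h1 h2
  rw [Nat.sub_self] at this
  linarith

lemma RateHypothesis.energy_nonneg (hc : RateHypothesis d c Γ) {i : ℕ} (hi : i ≤ d) : 0 ≤ Γ i :=
  hc.energy_zero ▸ hc.energy_mono 0 i (Nat.zero_le _) hi

lemma RateHypothesis.exp_neg_le (hc : RateHypothesis d c Γ) {i : ℕ} (hi : i ≤ d) {b : ℝ}
    (hb : Γ i < b) : ∀ᶠ β in atTop, Real.exp (-(β * b)) ≤ c β (d - i) := by
  have h := hc.lim_low (d - i) (by omega)
  rw [Nat.sub_sub_self hi] at h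
  filter_upwards [h.eventually (lt_mem_nhds (neg_lt_neg hb)), eventually_gt_atTop 0] with β h1 h2
  have hpos := hc.pos β h2 (d - i) (by omega)
  rw [← Real.exp_log hpos]
  apply Real.exp_le_exp.2
  rw [one_div, ← div_eq_inv_mul, lt_div_iff₀ h2] at h1
  linarith

lemma RateHypothesis.le_exp_neg (hc : RateHypothesis d c Γ) {i : ℕ} (hi : i ≤ d) {b : ℝ}
    (hb : b < Γ i) : ∀ᶠ β in atTop, c β (d - i) ≤ Real.exp (-(β * b)) := by
  have h := hc.lim_low (d - i) (by omega)
  rw [Nat.sub_sub_self hi] at h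
  filter_upwards [h.eventually (gt_mem_nhds (neg_lt_neg hb)), eventually_gt_atTop 0] with β h1 h2
  have hpos := hc.pos β h2 (d - i) (by omega)
  rw [← Real.exp_log hpos]
  apply Real.exp_le_exp.2
  rw [one_div, ← div_eq_inv_mul, div_lt_iff₀ h2] at h1
  linarith

lemma energy_le_kappaCrit_succ (i : ℕ) : Γ i ≤ kappaCrit Γ (i + 1) := le_max_left _ _

lemma div_le_kappaCrit_succ (i : ℕ) :
    (Γ (i + 1) + (i + 1 : ℝ) * kappaCrit Γ i) / (i + 2 : ℝ) ≤ kappaCrit Γ (i + 1) := by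
  refine le_trans (le_of_eq ?_) (le_max_right _ _)
  push_cast
  ring

/-- κ_i is the larger of Γ_{i-1} and a weighted mean of Γ_i and κ_{i-1}, all of them at most Γ_i. -/
lemma kappaCrit_le_energy (hΓ : ∀ i j, i ≤ j → j ≤ d → Γ i ≤ Γ j) {i : ℕ} (hi : i ≤ d) :
    kappaCrit Γ i ≤ Γ i := by
  induction i with
  | zero => exact le_rfl
  | succ i ih =>
    have h1 := hΓ i (i + 1) (by omega) hi
    have h2 := ih (by omega)
    refine max_le h1 ?_
    rw [div_le_iff₀ (by positivity)]
    push_cast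
    have : (i + 1 : ℝ) * kappaCrit Γ i ≤ (i + 1 : ℝ) * Γ (i + 1) := by
      gcongr
      exact h2.trans h1
    linarith

end rates

/-! ### Above the critical exponent: the origin is occupied -/

section upper

variable {d : ℕ} {c : ℝ → ℕ → ℝ} {Γ : ℕ → ℝ} {Ω : Type*} [MeasurableSpace Ω] {P : Measure Ω}
  [IsProbabilityMeasure P] {gap U : Site d → ℕ → Ω → ℝ}

/-- The sites at `ℓ^∞` distance at most `R` from the origin. -/
def centered (d : ℕ) (R : ℕ) : Finset (Site d) :=
  Finset.Icc (fun _ => -(R : ℤ)) fun _ => (R : ℤ)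

lemma mem_centered {R : ℕ} {x : Site d} : x ∈ centered d R ↔ ∀ j, |x j| ≤ R := by
  simp only [centered, Finset.mem_Icc, Pi.le_def, abs_le, forall_and]

lemma card_centered (R : ℕ) : (centered d R).card = (2 * R + 1) ^ d := by
  have : ((R : ℤ) + 1 + R).toNat = 2 * R + 1 := by omega
  simp [centered, Pi.card_Icc, this]

lemma exists_finset_flat (I : Finset (Fin d)) (r : ℕ) (lo : Site d) :
    ∃ S : Finset (Site d), (S : Set (Site d)) = flat I r lo ∧ S.card = r ^ I.card := by
  classical
  refine ⟨Fintype.piFinset fun j => if j ∈ I then Finset.Ico (lo j) (lo j + r) else {lo j}, ?_, ?_⟩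
  · ext x
    simp only [Finset.mem_coe, Fintype.mem_piFinset, flat, Set.mem_ofPred_eq]
    constructor
    · refine fun h => ⟨fun j hj => ?_, fun j hj => ?_⟩
      · simpa [hj] using h j
      · simpa [hj] using h j
    · intro h j
      by_cases hj : j ∈ I
      · simpa [hj] using h.1 j hj
      · simpa [hj] using h.2 j hj
  · rw [Fintype.card_piFinset]
    have : ∀ j, (if j ∈ I then Finset.Ico (lo j) (lo j + r) else {lo j}).card =
        if j ∈ I then r else 1 := by
      intro j
      split_ifs <;> simp
    simp [this]

/-- Nucleation takes place everywhere as soon as the space-time volumes are large enough. -/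
lemma whp_nucleates (hc : RateHypothesis d c Γ) (hinput : IsGraphicalInput P gap U)
    (I : Finset (Fin d)) {C L κ κ' : ℝ} (hC : 0 ≤ C) (hL : Γ I.card < I.card * L + κ') :
    Whp P fun β ω => Nucleates (arrival fun x i => gap x i ω) (reqOf (c β) fun x i => U x i ω)
      (centered d ⌈Real.exp (β * C)⌉₊) (Real.exp (β * κ)) I ⌈Real.exp (β * L)⌉₊
      (Real.exp (β * κ')) := by
  have hI : I.card ≤ d := by simpa using Finset.card_le_univ I
  choose S hS hScard using exists_finset_flat (d := d) I
  -- Time is discretised into windows of half the length exp(βκ'). The exponent `b` lies strictly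
  -- between the energy and `I.card * L + κ'`, so the expected number of nuclei per window grows
  -- exponentially.
  set N : ℝ → ℕ := fun β => ⌈2 * Real.exp (β * (κ - κ'))⌉₊ + 1 with hN
  set b := (Γ I.card + (I.card * L + κ')) / 2 with hb
  have hb1 : Γ I.card < b := by linarith
  have hb2 : b < I.card * L + κ' := by linarith
  have hb0 : 0 ≤ b := (hc.energy_nonneg hI).trans hb1.le
  have hunion : Whp P fun β ω => ∀ q ∈ centered d ⌈Real.exp (β * C)⌉₊ ×ˢ Finset.range (N β),
      ∃ p, p ∈ effective gap U (c β (d - I.card)) (S ⌈Real.exp (β * L)⌉₊ q.1)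
        (q.2 * (Real.exp (β * κ') / 2)) ((q.2 + 1) * (Real.exp (β * κ') / 2)) ω := by
    refine whp_ball_of_le
      (N := fun β => (5 ^ d * 4) * Real.exp (β * (C * d + max (κ - κ') 0)))
      (f := fun β => Real.exp (-((1 / 2) * Real.exp (β * (I.card * L + κ' - b))))) ?_ ?_
      (Eventually.of_forall fun β => (Real.exp_pos _).le)
      (tendsto_exp_mul_exp_neg_exp _ _ (by linarith) one_half_pos)
    · filter_upwards [eventually_ge_atTop 0] with β hβ
      rw [Finset.card_product, card_centered, Finset.card_range]
      push_cast
      have h1 : (1 : ℝ) ≤ Real.exp (β * C) := Real.one_le_exp (by positivity)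
      have h2 := (Nat.ceil_lt_add_one (Real.exp_pos (β * C)).le).le
      have h3 := (Nat.ceil_lt_add_one (a := 2 * Real.exp (β * (κ - κ'))) (by positivity)).le
      have h4 : Real.exp (β * (κ - κ')) ≤ Real.exp (β * max (κ - κ') 0) := by
        gcongr
        exact le_max_left _ _
      have h5 : 1 ≤ Real.exp (β * max (κ - κ') 0) := Real.one_le_exp (by positivity)
      calc (2 * (⌈Real.exp (β * C)⌉₊ : ℝ) + 1) ^ d * (N β : ℝ)
          ≤ (5 * Real.exp (β * C)) ^ d * (4 * Real.exp (β * max (κ - κ') 0)) := by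
            gcongr
            · linarith
            · simp only [hN]
              push_cast
              linarith
        _ = (5 ^ d * 4) * Real.exp (β * (C * d + max (κ - κ') 0)) := by
            rw [mul_pow, ← Real.exp_nat_mul, mul_add, Real.exp_add]
            ring_nf
    · filter_upwards [hc.exp_neg_le hI hb1, eventually_ge_atTop 0] with β hβ hβ0 q hq
      have hcn : Real.exp (-(β * b)) ≤ min (c β (d - I.card)) 1 :=
        le_min hβ (Real.exp_le_one_iff.2 (by nlinarith))
      have h0 : 0 ≤ c β (d - I.card) := (Real.exp_pos _).le.trans hβ
      have hT : 0 < Real.exp (β * κ') / 2 := by positivity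
      have hset : {ω | ¬ ∃ p, p ∈ effective gap U (c β (d - I.card))
          (S ⌈Real.exp (β * L)⌉₊ q.1) (q.2 * (Real.exp (β * κ') / 2))
          ((q.2 + 1) * (Real.exp (β * κ') / 2)) ω} = {ω | ∀ p, p ∉ effective gap U
          (c β (d - I.card)) (S ⌈Real.exp (β * L)⌉₊ q.1) (q.2 * (Real.exp (β * κ') / 2))
          ((q.2 + 1) * (Real.exp (β * κ') / 2)) ω} := by
        ext ω
        simp
      rw [hset]
      refine (measure_none_le hinput h0 _ (by positivity) (by nlinarith)).trans
        (ENNReal.ofReal_le_ofReal (Real.exp_le_exp.2 (neg_le_neg ?_)))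
      rw [hScard]
      push_cast
      calc (1 / 2) * Real.exp (β * (I.card * L + κ' - b))
          = Real.exp (-(β * b)) * (Real.exp (β * κ') / 2) * Real.exp (β * L) ^ I.card := by
            have : β * (I.card * L + κ' - b) = -(β * b) + β * κ' + I.card * (β * L) := by ring
            rw [this, Real.exp_add, Real.exp_add, Real.exp_nat_mul]
            ring
        _ ≤ min (c β (d - I.card)) 1 * ((q.2 + 1) * (Real.exp (β * κ') / 2) -
              q.2 * (Real.exp (β * κ') / 2)) * (⌈Real.exp (β * L)⌉₊ : ℝ) ^ I.card := by
            have : (q.2 + 1) * (Real.exp (β * κ') / 2) - q.2 * (Real.exp (β * κ') / 2) =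
              Real.exp (β * κ') / 2 := by ring
            rw [this]
            gcongr
            exact Nat.le_ceil _
  refine hunion.mono ?_
  filter_upwards [eventually_gt_atTop 0] with β hβ ω hω lo hlo s hs hsT
  have hT : 0 < Real.exp (β * κ') / 2 := by positivity
  have hr : 0 < ⌈Real.exp (β * L)⌉₊ := Nat.ceil_pos.2 (Real.exp_pos _)
  have hlo' : lo ∈ centered d ⌈Real.exp (β * C)⌉₊ :=
    hlo ⟨fun j _ => by omega, fun j _ => rfl⟩
  -- Every interval of length exp(βκ') contains a whole window of half that length from the grid.
  set i := ⌈s / (Real.exp (β * κ') / 2)⌉₊ with hi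
  have hi1 : s ≤ i * (Real.exp (β * κ') / 2) := by
    rw [← div_le_iff₀ hT]
    exact Nat.le_ceil _
  have hi2 : i * (Real.exp (β * κ') / 2) ≤ s + Real.exp (β * κ') / 2 := by
    have := (Nat.ceil_lt_add_one (div_nonneg hs hT.le)).le
    rw [← hi] at this
    calc i * (Real.exp (β * κ') / 2)
        ≤ (s / (Real.exp (β * κ') / 2) + 1) * (Real.exp (β * κ') / 2) := by gcongr
      _ = s + Real.exp (β * κ') / 2 := by field_simp
  have hiN : i ∈ Finset.range (N β) := by
    rw [Finset.mem_range, Nat.lt_succ_iff]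
    apply Nat.ceil_mono
    rw [div_le_iff₀ hT, mul_sub, Real.exp_sub]
    have : 2 * (Real.exp (β * κ) / Real.exp (β * κ')) * (Real.exp (β * κ') / 2) =
      Real.exp (β * κ) := by field_simp
    rw [this]
    linarith
  obtain ⟨p, h1, h2, h3, h4⟩ := hω (lo, i) (Finset.mk_mem_product hlo' hiN)
  refine ⟨p, ?_, hi1.trans_lt h2, h3.trans ?_, ?_⟩
  · rw [← hS]
    exact h1
  · dsimp only
    linarith
  · exact (reqOf_le_iff (hc.mono β hβ) _ p (by omega)).2 h4

/-- The occupied set `σ` evolves in `Q` up to time `t₁` according to the requirements `req`. -/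
def Evolves (τ : Site d × ℕ → ℝ) (req : Site d × ℕ → ℕ) (Q : Set (Site d)) (t₁ : ℝ)
    (σ : ℝ → Set (Site d)) : Prop :=
  Monotone σ ∧ ∀ p : Site d × ℕ, p.1 ∈ Q → ∀ s t, 0 ≤ s → s < τ p → τ p ≤ t → t ≤ t₁ →
    req p ≤ nbCount Finset.univ p.1 (σ s) → p.1 ∈ σ t

/-- Cubes of dimension `n` and side `exp (β L)` are filled in a time `exp (β κ')`. -/
theorem whp_fill (hc : RateHypothesis d c Γ) (hinput : IsGraphicalInput P gap U) {C κ : ℝ}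
    (hC : 0 ≤ C) (n : ℕ) (hn : n ≤ d) : ∀ (I : Finset (Fin d)), I.card = n →
    ∀ L κ' : ℝ, 0 ≤ L → kappaCrit Γ n < κ' → Γ n < n * L + κ' →
    Whp P fun β ω => ∀ σ, Evolves (arrival fun x i => gap x i ω)
      (reqOf (c β) fun x i => U x i ω) (centered d ⌈Real.exp (β * C)⌉₊) (Real.exp (β * κ)) σ →
      Fill σ (centered d ⌈Real.exp (β * C)⌉₊) (Real.exp (β * κ)) I ⌈Real.exp (β * L)⌉₊
        (Real.exp (β * κ')) := by
  induction n with
  | zero =>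
    intro I hI L κ' hL hκ hΓ
    obtain rfl := Finset.card_eq_zero.1 hI
    refine (whp_nucleates hc hinput ∅ (C := C) (L := L) (κ := κ) (κ' := κ') hC
      (by simpa using hΓ)).mono (Eventually.of_forall fun β ω h σ hσ => ?_)
    exact fill_empty hσ.2 h
  | succ n ih =>
    intro I hI L κ' hL hκ hΓ
    have hκn : kappaCrit Γ n ≤ Γ (n + 1) :=
      (kappaCrit_le_energy hc.energy_mono (by omega)).trans
        (hc.energy_mono n (n + 1) (by omega) hn)
    -- The balanced exponent: for side exp(βD), the growth exponent `D + κ_n` equals the nucleation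
    -- exponent `Γ_{n+1} - (n+1) D`, and this common value is at most κ_{n+1}.
    set D := (Γ (n + 1) - kappaCrit Γ n) / (n + 2 : ℝ) with hD
    have hD0 : 0 ≤ D := div_nonneg (by linarith) (by positivity)
    -- Cubes larger than the balanced size need not grow from one nucleus: it suffices to fill their
    -- subcubes of the balanced size.
    set L₀ := min L D with hL₀
    have hL₀0 : 0 ≤ L₀ := le_min hL hD0
    have hDκ : D + kappaCrit Γ n ≤ kappaCrit Γ (n + 1) := by
      refine le_trans (le_of_eq ?_) (div_le_kappaCrit_succ n)
      rw [hD]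
      field_simp
      ring
    have hDΓ : Γ (n + 1) ≤ (n + 1 : ℝ) * D + kappaCrit Γ (n + 1) := by
      refine le_trans (le_of_eq ?_) (add_le_add_right hDκ _)
      rw [hD]
      field_simp
      ring
    have hΓ₀ : Γ (n + 1) < (n + 1 : ℝ) * L₀ + κ' := by
      rcases min_choice L D with h | h
      · rw [hL₀, h]
        push_cast at hΓ
        exact hΓ
      · rw [hL₀, h]
        linarith
    set ε := min (κ' - kappaCrit Γ (n + 1)) ((n + 1 : ℝ) * L₀ + κ' - Γ (n + 1)) / 4 with hε
    have hε0 : 0 < ε := by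
      have : 0 < min (κ' - kappaCrit Γ (n + 1)) ((n + 1 : ℝ) * L₀ + κ' - Γ (n + 1)) :=
        lt_min (by linarith) (by linarith)
      positivity
    have hε1 : 4 * ε ≤ κ' - kappaCrit Γ (n + 1) := by
      have := min_le_left (κ' - kappaCrit Γ (n + 1)) ((n + 1 : ℝ) * L₀ + κ' - Γ (n + 1))
      linarith
    have hε2 : 4 * ε ≤ (n + 1 : ℝ) * L₀ + κ' - Γ (n + 1) := by
      have := min_le_right (κ' - kappaCrit Γ (n + 1)) ((n + 1 : ℝ) * L₀ + κ' - Γ (n + 1))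
      linarith
    obtain ⟨K, hK⟩ := exists_nat_gt (L₀ / ε)
    have hKpos : (0 : ℝ) < K := (div_nonneg hL₀0 hε0.le).trans_lt hK
    have hKε : L₀ / K ≤ ε := by
      rw [div_lt_iff₀ hε0] at hK
      rw [div_le_iff₀ hKpos]
      linarith
    -- Exponents of the successive sizes of the nucleus, in `K` steps of at most `ε`, so that
    -- passing from one size to the next loses at most a factor exp(βε).
    set a : ℕ → ℝ := fun k => k * (L₀ / K) with ha
    have ha0 : ∀ k, 0 ≤ a k := fun k => by positivity
    have haK : a K = L₀ := by
      simp only [ha]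
      field_simp
    have haL : ∀ k < K, a k ≤ L₀ := fun k hk => by
      rw [← haK]
      simp only [ha]
      gcongr
    -- Time exponent for a face of side exp(β a_k) in dimension `n`: either its nucleation or κ_n
    -- dominates.
    set E : ℕ → ℝ := fun k => max (Γ n - n * a k) (kappaCrit Γ n) + ε with hE
    have hsum : ∀ k < K, a (k + 1) + E k ≤ κ' - ε := by
      intro k hk
      have h1 : a (k + 1) ≤ a k + ε := by
        simp only [ha]
        push_cast
        linarith
      have h2 : a k + max (Γ n - n * a k) (kappaCrit Γ n) ≤ kappaCrit Γ (n + 1) := by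
        have h3 : a k + kappaCrit Γ n ≤ kappaCrit Γ (n + 1) := by
          have := haL k hk
          have := min_le_right L D
          linarith
        rcases max_choice (Γ n - n * a k) (kappaCrit Γ n) with h | h
        · rw [h]
          -- When nucleation of the face dominates, `a_k + Γ_n - n a_k ≤ Γ_n ≤ κ_{n+1}` as soon as
          -- `n ≥ 1`. For `n = 0` the face is a single site and Γ_0 = κ_0, so the growth bound
          -- applies.
          rcases n with _ | n
          · simpa [kappaCrit] using h3
          · have := energy_le_kappaCrit_succ (Γ := Γ) (n + 1)
            have := mul_nonneg (Nat.cast_nonneg (α := ℝ) n) (ha0 k)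
            push_cast
            linarith
        · rw [h]
          exact h3
      simp only [hE]
      linarith
    have hwN := whp_nucleates hc hinput I (C := C) (L := L₀) (κ := κ) (κ' := κ' - ε) hC
      (by rw [hI]; push_cast; linarith)
    have hwF := whp_ball (P := P) (Finset.range K ×ˢ I) fun (q : ℕ × Fin d) hq =>
      ih (by omega) (I.erase q.2)
        (by rw [Finset.card_erase_of_mem (Finset.mem_product.1 hq).2, hI]; rfl) (a q.1) (E q.1)
        (ha0 _) (by have := le_max_right (Γ n - n * a q.1) (kappaCrit Γ n)
                    simp only [hE]
                    linarith)
        (by have := le_max_left (Γ n - n * a q.1) (kappaCrit Γ n)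
            simp only [hE]
            linarith)
    refine (hwN.and hwF).mono ?_
    filter_upwards [eventually_ge_atTop 0,
      eventually_mul_exp_le (1 + K * (2 * (n + 1))) (by linarith : κ' - ε < κ')]
      with β hβ hβ' ω hω σ hσ
    set r : ℕ → ℕ := fun k => ⌈Real.exp (β * a k)⌉₊ with hr
    have hr0 : r 0 = 1 := by simp [hr, ha]
    have hrmono : Monotone r := by
      intro k k' hkk
      apply Nat.ceil_mono
      apply Real.exp_le_exp.2
      simp only [ha]
      gcongr
    have hrK : r K = ⌈Real.exp (β * L₀)⌉₊ := by simp only [hr, haK]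
    have key := fill_of_scales hσ.1 hσ.2 (I := I) (K := K) (r := r)
      (T := fun k => Real.exp (β * E k)) (T₀ := Real.exp (β * (κ' - ε))) hr0 hrmono
      (fun k => (Real.exp_pos _).le) (Real.exp_pos _).le
      (fun k hk j hj => hω.2 (k, j) (Finset.mk_mem_product (Finset.mem_range.2 hk) hj) σ hσ)
      (by rw [hrK]; exact hω.1)
    refine key.mono_side hσ.1 ?_ (hr0.ge.trans (hrmono (Nat.zero_le K))) ?_
    · rw [hrK]
      apply Nat.ceil_mono
      apply Real.exp_le_exp.2
      gcongr
      exact min_le_left _ _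
    · refine le_trans ?_ hβ'
      rw [add_mul, one_mul]
      refine add_le_add_right ?_ _
      refine (Finset.sum_le_card_nsmul _ _ (2 * (n + 1) * Real.exp (β * (κ' - ε))) ?_).trans ?_
      · intro k hk
        rw [hI]
        have h1 : (r (k + 1) : ℝ) ≤ 2 * Real.exp (β * a (k + 1)) := by
          have h1 := (Nat.ceil_lt_add_one (Real.exp_pos (β * a (k + 1))).le).le
          have h2 : 1 ≤ Real.exp (β * a (k + 1)) := Real.one_le_exp (mul_nonneg hβ (ha0 _))
          simp only [hr]
          linarith
        calc (r (k + 1) : ℝ) * (((n + 1 : ℕ) : ℝ) * Real.exp (β * E k))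
            ≤ 2 * Real.exp (β * a (k + 1)) * (((n + 1 : ℕ) : ℝ) * Real.exp (β * E k)) := by gcongr
          _ = 2 * (n + 1) * Real.exp (β * (a (k + 1) + E k)) := by
            have : Real.exp (β * (a (k + 1) + E k)) =
                Real.exp (β * a (k + 1)) * Real.exp (β * E k) := by
              rw [← Real.exp_add, mul_add]
            rw [this]
            push_cast
            ring
          _ ≤ 2 * (n + 1) * Real.exp (β * (κ' - ε)) := by
            gcongr
            exact hsum k (Finset.mem_range.1 hk)
      · rw [Finset.card_range, nsmul_eq_mul]
        apply le_of_eq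
        ring

/-- The occupied set of the process in `Λ`, as a function of time, evolves in each region
`Q ⊆ Λ`. -/
lemma evolves_run {g u : Site d → ℕ → ℝ} {c : ℕ → ℝ} (Λ : Finset (Site d)) {t : ℝ}
    (hfin : (arrivalsUpTo g Λ t).Finite) {Q : Finset (Site d)} (hQ : Q ⊆ Λ) :
    Evolves (arrival g) (reqOf c u) Q t fun s =>
      run Finset.univ 0 (reqOf c u)
        ((orderedArrivals g Λ t).filter fun p => arrival g p ≤ s) ∅ := by
  obtain ⟨-, hsort, -, hall⟩ := orderedArrivals_sorted g Λ t
  refine ⟨fun s s' hss => ?_, fun p hp s s' hs h1 h2 h3 hreq => ?_⟩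
  · dsimp only
    rw [filter_le_append_filter hsort hss, run_append]
    exact subset_run _ _
  · dsimp only at hreq ⊢
    rw [filter_le_append_filter hsort (h1.le.trans h2), run_append]
    refine mem_run_of_mem ?_ (by simpa using hreq)
    simpa [h1, h2] using hall hfin p (hQ hp) (h2.trans h3)

/-- Above the critical constant, the origin is occupied. -/
theorem whp_mem_infiniteVolume (hc : RateHypothesis d c Γ) (hinput : IsGraphicalInput P gap U)
    {κ : ℝ} (hκ : 0 < κ) (hκd : kappaCrit Γ d < κ) :
    Whp P fun β ω => (0 : Site d) ∈ infiniteVolume (c β) (fun x i => gap x i ω)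
      (fun x i => U x i ω) (Real.exp (β * κ)) := by
  obtain ⟨L, hL0, hL⟩ : ∃ L : ℝ, 0 ≤ L ∧ Γ d < d * L + κ := by
    rcases Nat.eq_zero_or_pos d with rfl | hd
    · exact ⟨0, le_rfl, by simpa [kappaCrit] using hκd⟩
    · have : (1 : ℝ) ≤ d := by exact_mod_cast hd
      refine ⟨Γ d, hc.energy_nonneg le_rfl, ?_⟩
      nlinarith [hc.energy_nonneg le_rfl]
  have hfill := whp_fill hc hinput (C := L) (κ := κ) hL0 d le_rfl Finset.univ (by simp) L κ hL0
    hκd hL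
  have hfin := whp_of_ae (P := P) (A := fun β ω => ∀ Λ : Finset (Site d),
    (arrivalsUpTo (fun x i => gap x i ω) Λ (Real.exp (β * κ))).Finite)
    (Eventually.of_forall fun β => ae_finite_arrivals hinput (Real.exp_pos (β * κ)).le)
  refine (hfill.and hfin).mono ?_
  filter_upwards [eventually_gt_atTop 0] with β hβ ω hω
  refine (eventually_ge_atTop (centered d ⌈Real.exp (β * L)⌉₊)).mono fun Λ hΛ => ?_
  rw [← Finset.mem_coe, finiteVolume, coe_foldl_update (hc.mono β hβ)]
  have hflat : flat Finset.univ ⌈Real.exp (β * L)⌉₊ (0 : Site d) ⊆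
      (centered d ⌈Real.exp (β * L)⌉₊ : Set (Site d)) := by
    intro x hx
    rw [Finset.mem_coe, mem_centered]
    intro j
    have := hx.1 j (Finset.mem_univ j)
    simp only [Pi.zero_apply] at this
    rw [abs_le]
    omega
  -- In full dimension no outside neighbour is required, so the filling of a cube containing the
  -- origin starts at time zero.
  have key := hω.1 _ (evolves_run Λ (hω.2 Λ) hΛ) 0 hflat 0 le_rfl (zero_add _).le
    (fun _ => true) (fun x _ j hj => absurd (Finset.mem_univ j) hj)
  have h0 : (0 : Site d) ∈ flat Finset.univ ⌈Real.exp (β * L)⌉₊ (0 : Site d) := by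
    have : 0 < ⌈Real.exp (β * L)⌉₊ := Nat.ceil_pos.2 (Real.exp_pos _)
    refine ⟨fun j _ => ?_, fun j hj => rfl⟩
    simp only [Pi.zero_apply]
    omega
  have h1 := key h0
  rwa [List.filter_eq_self.2] at h1
  intro p hp
  have := ((orderedArrivals_sorted _ Λ _).2.2.1 p hp).2
  simpa using this

end upper

/-! ### Below the critical exponent: scales and probabilistic estimates -/

section lower

variable {d : ℕ} {c : ℝ → ℕ → ℝ} {Γ : ℕ → ℝ} {Ω : Type*} [MeasurableSpace Ω] {P : Measure Ω}
  [IsProbabilityMeasure P] {gap U : Site d → ℕ → Ω → ℝ}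

/-- The time scales `K n` and the spatial scales `Δ n` for the growth in dimension `n`, below the
critical constant. -/
lemma exists_scales (hΓ : ∀ i j, i ≤ j → j ≤ d → Γ i ≤ Γ j) (n : ℕ) (hn : n ≤ d) :
    ∀ x < kappaCrit Γ n, ∃ (K Δ : ℕ → ℝ) (θ : ℕ → ℕ), K n = x ∧ ∀ m ≤ n, 0 ≤ Δ m ∧ θ m ≤ m ∧
      m * Δ m + K m < Γ (m - θ m) ∧
      (θ m = 1 ∨ (θ m = 0 ∧ (m = 0 ∨ K m ≤ Δ m + K (m - 1)))) := by
  induction n with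
  | zero =>
    intro x hx
    refine ⟨fun _ => x, fun _ => 0, fun _ => 0, rfl, fun m hm => ?_⟩
    obtain rfl := Nat.le_zero.1 hm
    exact ⟨le_rfl, le_rfl, by simpa [kappaCrit] using hx, Or.inr ⟨rfl, Or.inl rfl⟩⟩
  | succ n ih =>
    intro x hx
    have hκ := kappaCrit_le_energy hΓ (i := n) (by omega)
    obtain ⟨y, hy, δ, t, hδ, ht, h1, h2⟩ : ∃ y < kappaCrit Γ n, ∃ (δ : ℝ) (t : ℕ), 0 ≤ δ ∧
        t ≤ 1 ∧ (n + 1 : ℝ) * δ + x < Γ (n + 1 - t) ∧ (t = 1 ∨ (t = 0 ∧ x ≤ δ + y)) := by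
      -- Below Γ_n, points able to start a layer are rare enough to count as nuclei: `θ = 1`, boxes
      -- of exponent zero, and any lower level will do. Otherwise `x` is below the weighted mean,
      -- and growth during `exp (β δ)` windows of exponent `y` is allowed.
      by_cases h : x < Γ n
      · exact ⟨kappaCrit Γ n - 1, by linarith, 0, 1, le_rfl, le_rfl, by simpa using h,
          Or.inl rfl⟩
      · have h' : x < (Γ (n + 1) + ((n + 1 : ℕ) : ℝ) * kappaCrit Γ n) / (((n + 1 : ℕ) : ℝ) + 1) :=
          (lt_max_iff.1 hx).resolve_left h
        have hn1 : (0 : ℝ) < n + 1 := by positivity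
        rw [lt_div_iff₀ (by positivity)] at h'
        push_cast at h'
        -- Half of the available slack, divided by `n + 1`. With `y = κ_n - η` and `δ = x - y`, the
        -- condition `(n + 1) δ + x < Γ_{n+1}` is that the mean exceeds `x`, with room for `(n + 1)
        -- η`; moreover `δ ≥ 0` because `x ≥ Γ_n ≥ κ_n`.
        set η := (Γ (n + 1) + (n + 1 : ℝ) * kappaCrit Γ n - x * (n + 1 + 1)) / (2 * (n + 1)) with hη
        have hη0 : 0 < η := div_pos (by linarith) (by positivity)
        have hη1 : (n + 1 : ℝ) * η < Γ (n + 1) + (n + 1 : ℝ) * kappaCrit Γ n - x * (n + 1 + 1) := by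
          have : (n + 1 : ℝ) * η =
              (Γ (n + 1) + (n + 1 : ℝ) * kappaCrit Γ n - x * (n + 1 + 1)) / 2 := by
            rw [hη]
            field_simp
          rw [this]
          linarith
        refine ⟨kappaCrit Γ n - η, by linarith, x - (kappaCrit Γ n - η), 0, ?_, zero_le_one, ?_,
          Or.inr ⟨rfl, by linarith⟩⟩
        · push Not at h
          linarith
        · rw [Nat.sub_zero]
          linarith
    obtain ⟨K, Δ, θ, hK, hm⟩ := ih (by omega) y hy
    refine ⟨Function.update K (n + 1) x, Function.update Δ (n + 1) δ, Function.update θ (n + 1) t,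
      by simp, fun m hmn => ?_⟩
    rcases Nat.lt_or_ge n m with h | h
    · obtain rfl : m = n + 1 := by omega
      simp only [Function.update_self, Nat.add_sub_cancel, Nat.cast_add, Nat.cast_one,
        Function.update_of_ne (show n ≠ n + 1 by omega), hK]
      refine ⟨hδ, by omega, h1, h2.imp id fun h => ⟨h.1, Or.inr h.2⟩⟩
    · rw [Function.update_of_ne (by omega), Function.update_of_ne (by omega),
        Function.update_of_ne (by omega), Function.update_of_ne (by omega)]
      exact hm m h

/-- The bound for the sides of the occupied boxes, with at most `exp (β ε)` nuclei each and over
`exp (β δ)` successive windows. -/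
def blobSide (ε δ β : ℝ) : ℕ :=
  2 * ⌊Real.exp (β * ε)⌋₊ * (2 * (⌊Real.exp (β * ε)⌋₊ + 1) + 2 +
    2 * (⌊Real.exp (β * ε)⌋₊ + 1) * ⌈Real.exp (β * δ)⌉₊)

lemma blobSide_add_one_le {ε δ β : ℝ} (hε : 0 ≤ ε) (hδ : 0 ≤ δ) (hβ : 0 ≤ β) :
    (blobSide ε δ β : ℝ) + 1 ≤ 29 * Real.exp (β * (δ + 2 * ε)) := by
  have h1 : 1 ≤ Real.exp (β * ε) := Real.one_le_exp (by positivity)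
  have h2 : 1 ≤ Real.exp (β * δ) := Real.one_le_exp (by positivity)
  have h3 := Nat.floor_le (Real.exp_pos (β * ε)).le
  have h4 := (Nat.ceil_lt_add_one (Real.exp_pos (β * δ)).le).le
  have h5 : Real.exp (β * (δ + 2 * ε)) =
      Real.exp (β * δ) * (Real.exp (β * ε) * Real.exp (β * ε)) := by
    rw [← Real.exp_add, ← Real.exp_add]
    congr 1
    ring
  rw [h5]
  set E := Real.exp (β * ε)
  set F := Real.exp (β * δ)
  have h6 : 1 ≤ F * (E * E) := by
    nlinarith [mul_le_mul h1 h1 zero_le_one (by positivity)]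
  unfold blobSide
  push_cast
  calc 2 * (⌊E⌋₊ : ℝ) * (2 * (⌊E⌋₊ + 1) + 2 + 2 * (⌊E⌋₊ + 1) * ⌈F⌉₊) + 1
      ≤ 2 * E * (2 * (E + E) + 2 * E + 2 * (E + E) * (F + F)) + 1 := by
        gcongr <;> linarith
    _ = 12 * (E * E) + 16 * (F * (E * E)) + 1 := by ring
    _ ≤ 29 * (F * (E * E)) := by
      nlinarith [mul_le_mul_of_nonneg_right h2 (by positivity : 0 ≤ E * E)]

lemma card_Icc_le {I : Finset (Fin d)} {lo hi : Site d} {D h : ℕ}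
    (hI : ∀ j ∈ I, hi j - lo j ≤ D) (hI' : ∀ j ∉ I, hi j - lo j < h) :
    (Finset.Icc lo hi).card ≤ (D + 1) ^ I.card * h ^ (d - I.card) := by
  classical
  rw [Pi.card_Icc, ← Finset.prod_mul_prod_compl I]
  have hc : d - I.card = Iᶜ.card := by rw [Finset.card_compl, Fintype.card_fin]
  rw [hc]
  refine Nat.mul_le_mul (Finset.prod_le_pow_card _ _ _ fun j hj => ?_)
    (Finset.prod_le_pow_card _ _ _ fun j hj => ?_)
  · have := hI j hj
    rw [Int.card_Icc]
    omega
  · have := hI' j (Finset.mem_compl.1 hj)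
    rw [Int.card_Icc]
    omega

lemma card_centered_ceil_le {β C : ℝ} (hβ : 0 ≤ β) (hC : 0 ≤ C) :
    ((centered d ⌈Real.exp (β * C)⌉₊).card : ℝ) ≤ 5 ^ d * Real.exp (β * (C * d)) := by
  have h1 : (1 : ℝ) ≤ Real.exp (β * C) := Real.one_le_exp (by positivity)
  have h2 := (Nat.ceil_lt_add_one (Real.exp_pos (β * C)).le).le
  have h3 : Real.exp (β * (C * d)) = Real.exp (β * C) ^ d := by
    rw [← Real.exp_nat_mul]
    congr 1
    ring
  rw [card_centered, h3, ← mul_pow]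
  push_cast
  gcongr
  linarith

/-- In small space-time boxes there are few points. -/
lemma whp_few (hc : RateHypothesis d c Γ) (hinput : IsGraphicalInput P gap U)
    (I : Finset (Fin d)) {n : ℕ} {C κ κ' ε : ℝ} (hC : 0 ≤ C) (hε : 0 < ε) (D : ℝ → ℕ)
    (hvol : ∀ᶠ β in atTop, c β n * (2 * Real.exp (β * κ')) *
      (((D β + 1) ^ I.card * (⌊Real.exp (β * ε)⌋₊ + 1) ^ (d - I.card) : ℕ) : ℝ) ≤ 1)
    (hn : n ≤ d) :
    Whp P fun β ω => ∀ (lo hi : Site d) (s : ℝ) (S : Finset (Site d × ℕ)), 0 ≤ s →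
      s ≤ Real.exp (β * κ) → (∀ j ∈ I, hi j - lo j ≤ D β) →
      (∀ j ∉ I, hi j - lo j < (⌊Real.exp (β * ε)⌋₊ + 1 : ℕ)) →
      (∀ p ∈ S, p.1 ∈ centered d ⌈Real.exp (β * C)⌉₊ ∧ s < arrival (fun x i => gap x i ω) p ∧
        arrival (fun x i => gap x i ω) p ≤ s + Real.exp (β * κ') ∧
        reqOf (c β) (fun x i => U x i ω) p ≤ n ∧ ∀ j, lo j ≤ p.1 j ∧ p.1 j ≤ hi j) →
      S.card ≤ ⌊Real.exp (β * ε)⌋₊ := by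
  -- Grid of starting times with step exp(βκ'); each interval of that length lies in a grid window
  -- of twice the length.
  set N : ℝ → ℕ := fun β => ⌊Real.exp (β * (κ - κ'))⌋₊ + 1 with hN
  have hunion : Whp P fun β ω =>
      ∀ q ∈ (centered d ⌈Real.exp (β * C)⌉₊ ×ˢ centered d ⌈Real.exp (β * C)⌉₊) ×ˢ
        Finset.range (N β),
      (∀ j ∈ I, q.1.2 j - q.1.1 j ≤ D β) →
      (∀ j ∉ I, q.1.2 j - q.1.1 j < (⌊Real.exp (β * ε)⌋₊ + 1 : ℕ)) →
      ¬ ∃ A : Finset (Site d × ℕ), ⌊Real.exp (β * ε)⌋₊ + 1 ≤ A.card ∧ ∀ p ∈ A,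
        p ∈ effective gap U (c β n) (Finset.Icc q.1.1 q.1.2)
          (q.2 * Real.exp (β * κ')) ((q.2 + 2) * Real.exp (β * κ')) ω := by
    -- The expected number of points is at most one, so the moment bound with `z = 2` gives at most
    -- e · 2^{-(k+1)} for more than `k` = ⌊exp(βε)⌋ points, doubly exponentially small.
    refine whp_ball_of_le
      (N := fun β => (5 ^ d * 5 ^ d * 2) * Real.exp (β * (C * d + C * d + max (κ - κ') 0)))
      (f := fun β => Real.exp 1 * Real.exp (-(Real.log 2 * Real.exp (β * ε)))) ?_ ?_
      (Eventually.of_forall fun β => by positivity) ?_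
    · filter_upwards [eventually_ge_atTop 0] with β hβ
      rw [Finset.card_product, Finset.card_product, Finset.card_range]
      push_cast
      have h1 := card_centered_ceil_le (d := d) hβ hC
      have h3 := Nat.floor_le (Real.exp_pos (β * (κ - κ'))).le
      have h4 : Real.exp (β * (κ - κ')) ≤ Real.exp (β * max (κ - κ') 0) := by
        gcongr
        exact le_max_left _ _
      have h5 : 1 ≤ Real.exp (β * max (κ - κ') 0) := Real.one_le_exp (by positivity)
      calc ((centered d ⌈Real.exp (β * C)⌉₊).card : ℝ) * (centered d ⌈Real.exp (β * C)⌉₊).card *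
            (N β : ℝ)
          ≤ (5 ^ d * Real.exp (β * (C * d))) * (5 ^ d * Real.exp (β * (C * d))) *
            (2 * Real.exp (β * max (κ - κ') 0)) := by
            gcongr
            simp only [hN]
            push_cast
            linarith
        _ = (5 ^ d * 5 ^ d * 2) * Real.exp (β * (C * d + C * d + max (κ - κ') 0)) := by
            rw [mul_add β, mul_add β, Real.exp_add, Real.exp_add]
            ring
    · filter_upwards [hvol, eventually_gt_atTop 0] with β hvol hβ q _
      by_cases hq : (∀ j ∈ I, q.1.2 j - q.1.1 j ≤ D β) ∧
          ∀ j ∉ I, q.1.2 j - q.1.1 j < (⌊Real.exp (β * ε)⌋₊ + 1 : ℕ)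
      swap
      · refine le_of_eq_of_le ?_ zero_le
        convert measure_empty (μ := P)
        ext ω
        simp only [Set.mem_ofPred_eq, Set.mem_empty_iff_false, iff_false, not_not]
        exact fun h1 h2 => absurd ⟨h1, h2⟩ hq
      have hT := Real.exp_pos (β * κ')
      have hcn := hc.pos β hβ n (by omega)
      have hsub : {ω | ¬ ((∀ j ∈ I, q.1.2 j - q.1.1 j ≤ D β) →
          (∀ j ∉ I, q.1.2 j - q.1.1 j < (⌊Real.exp (β * ε)⌋₊ + 1 : ℕ)) →
          ¬ ∃ A : Finset (Site d × ℕ), ⌊Real.exp (β * ε)⌋₊ + 1 ≤ A.card ∧ ∀ p ∈ A,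
            p ∈ effective gap U (c β n) (Finset.Icc q.1.1 q.1.2)
              (q.2 * Real.exp (β * κ')) ((q.2 + 2) * Real.exp (β * κ')) ω)} ⊆
          {ω | ∃ A : Finset (Site d × ℕ), ⌊Real.exp (β * ε)⌋₊ + 1 ≤ A.card ∧ ∀ p ∈ A,
            p ∈ effective gap U (c β n) (Finset.Icc q.1.1 q.1.2)
              (q.2 * Real.exp (β * κ')) ((q.2 + 2) * Real.exp (β * κ')) ω} := by
        intro ω hω
        by_contra h
        exact hω fun _ _ => h
      refine (measure_mono hsub).trans ((measure_many_le hinput one_le_two hcn.le _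
        (by positivity) (by nlinarith) _).trans (ENNReal.ofReal_le_ofReal ?_))
      rw [Real.exp_neg, ← div_eq_mul_inv]
      have hcard := card_Icc_le hq.1 hq.2
      gcongr
      · refine le_trans ?_ hvol
        rw [show (2 - 1 : ℝ) = 1 by norm_num, one_mul,
          show ((q.2 : ℝ) + 2) * Real.exp (β * κ') - q.2 * Real.exp (β * κ') =
            2 * Real.exp (β * κ') by ring]
        gcongr
      · rw [← Real.rpow_natCast, Real.rpow_def_of_pos two_pos]
        gcongr
        push_cast
        exact (Nat.lt_floor_add_one _).le
    · have := (tendsto_exp_mul_exp_neg_exp (5 ^ d * 5 ^ d * 2)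
        (C * d + C * d + max (κ - κ') 0) hε (Real.log_pos one_lt_two)).mul_const (Real.exp 1)
      rw [zero_mul] at this
      refine this.congr fun β => ?_
      ring
  refine hunion.mono ?_
  filter_upwards [eventually_gt_atTop 0] with β hβ ω hω lo hi s S hs hsκ hI hI' hS
  have hT := Real.exp_pos (β * κ')
  set R := ⌈Real.exp (β * C)⌉₊ with hR
  by_contra! hlt
  obtain ⟨p₀, hp₀⟩ : S.Nonempty := Finset.card_pos.1 (by omega)
  obtain ⟨h1, -, -, -, h2⟩ := hS p₀ hp₀
  rw [mem_centered] at h1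
  have hi1 := Nat.floor_le (div_nonneg hs hT.le)
  have hi2 := (Nat.lt_floor_add_one (s / Real.exp (β * κ'))).le
  set i := ⌊s / Real.exp (β * κ')⌋₊ with hi'
  rw [le_div_iff₀ hT] at hi1
  rw [div_le_iff₀ hT] at hi2
  -- The box is clipped to the large cube, which loses no points and leaves finitely many boxes for
  -- the union bound.
  refine hω ((fun j => max (lo j) (-R), fun j => min (hi j) R), i) ?_ (fun j hj => ?_)
    (fun j hj => ?_) ⟨S, hlt, fun p hp => ?_⟩
  · refine Finset.mk_mem_product (Finset.mk_mem_product ?_ ?_) ?_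
    · rw [mem_centered]
      intro j
      have := h1 j
      have := h2 j
      rw [abs_le] at *
      omega
    · rw [mem_centered]
      intro j
      have := h1 j
      have := h2 j
      rw [abs_le] at *
      omega
    · rw [Finset.mem_range, Nat.lt_succ_iff, mul_sub, Real.exp_sub]
      apply Nat.floor_mono
      gcongr
  · have := hI j hj
    dsimp only
    omega
  · have := hI' j hj
    dsimp only
    omega
  · obtain ⟨h3, h4, h5, h6, h7⟩ := hS p hp
    rw [mem_centered] at h3
    refine ⟨?_, hi1.trans_lt h4, h5.trans ?_, (reqOf_le_iff (hc.mono β hβ) _ p (by omega)).1 h6⟩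
    · rw [Finset.mem_Icc, Pi.le_def, Pi.le_def, ← forall_and]
      intro j
      have := h3 j
      have := h7 j
      rw [abs_le] at *
      dsimp only
      omega
    · dsimp only
      linarith

/-- Near the origin, no site is occupied without occupied neighbours. -/
lemma whp_no_nucleus (hc : RateHypothesis d c Γ) (hinput : IsGraphicalInput P gap U)
    {κ : ℝ} (D : ℝ → ℕ)
    (hvol : Tendsto (fun β => c β 0 * Real.exp (β * κ) * (2 * (D β : ℝ) + 1) ^ d) atTop (𝓝 0)) :
    Whp P fun β ω => ∀ p : Site d × ℕ, p.1 ∈ centered d (D β) →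
      0 < arrival (fun x i => gap x i ω) p →
      arrival (fun x i => gap x i ω) p ≤ Real.exp (β * κ) →
      ¬ reqOf (c β) (fun x i => U x i ω) p ≤ 0 := by
  have h0 := hvol.mul_const (Real.exp 1)
  rw [zero_mul] at h0
  refine whp_of_le ?_ h0
  filter_upwards [eventually_gt_atTop 0, hvol.eventually (ge_mem_nhds zero_lt_one)] with β hβ h1
  set μ := c β 0 * Real.exp (β * κ) * (2 * (D β : ℝ) + 1) ^ d with hμ
  have hc0 := hc.pos β hβ 0 (by omega)
  have hμ0 : 0 < μ := by positivity
  -- Choosing `z = 1 / μ`, with `μ` the expected number, turns the exponential moment bound for one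
  -- point into `μ * exp (1 - μ)`, at most `μ * exp 1`.
  refine (measure_mono fun ω hω => ?_).trans ((measure_many_le hinput (z := 1 / μ) (c := c β 0)
    ((one_le_div hμ0).2 h1) hc0.le (centered d (D β)) le_rfl (Real.exp_pos (β * κ)).le 1).trans
    (ENNReal.ofReal_le_ofReal ?_))
  · rw [Set.mem_ofPred_eq] at hω
    push Not at hω
    obtain ⟨p, hp1, hp2, hp3, hp4⟩ := hω
    refine ⟨{p}, by simp, fun q hq => ?_⟩
    obtain rfl := Finset.mem_singleton.1 hq
    exact ⟨hp1, hp2, hp3, (reqOf_le_iff (hc.mono β hβ) _ q (by omega)).1 hp4⟩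
  · rw [card_centered]
    have h2 : c β 0 * (Real.exp (β * κ) - 0) * (((2 * D β + 1) ^ d : ℕ) : ℝ) = μ := by
      rw [hμ]
      push_cast
      ring
    rw [h2, pow_one, div_div_eq_mul_div, div_one, mul_comm]
    gcongr
    rw [sub_mul, one_div_mul_cancel hμ0.ne']
    linarith

/-- In none of the windows of a small fixed length there is a long path of sites with arrivals. -/
lemma whp_no_path (hinput : IsGraphicalInput P gap U) {C κ : ℝ} (hC : 0 ≤ C) :
    Whp P fun β ω => ∀ i < ⌈8 * (d + 1) * Real.exp (β * κ)⌉₊,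
      ∀ x ∈ centered d ⌈Real.exp (β * C)⌉₊, ∀ L ∈ paths ⌈Real.exp β⌉₊ x, L.Nodup →
      ¬ ∀ y ∈ L, ∃ p : Site d × ℕ, p.1 = y ∧
        i * (1 / (8 * (d + 1)) : ℝ) < arrival (fun x i => gap x i ω) p ∧
        arrival (fun x i => gap x i ω) p ≤ (i + 1 : ℕ) * (1 / (8 * (d + 1)) : ℝ) := by
  have hz : (8 : ℝ) ≤ 8 * (d + 1) := by
    have := Nat.cast_nonneg (α := ℝ) d
    linarith
  have hlog : 0 < Real.log (4 / 3) := Real.log_pos (by norm_num)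
  have hunion : Whp P fun β ω =>
      ∀ q ∈ Finset.range ⌈8 * (d + 1) * Real.exp (β * κ)⌉₊ ×ˢ centered d ⌈Real.exp (β * C)⌉₊,
      ∀ L ∈ paths ⌈Real.exp β⌉₊ q.2,
      ¬ ∃ A : Finset (Site d × ℕ), ⌈Real.exp β⌉₊ ≤ A.card ∧ ∀ p ∈ A,
        p ∈ effective gap U 1 L.toFinset
          (q.1 * (1 / (8 * (d + 1)))) ((q.1 + 1) * (1 / (8 * (d + 1)))) ω := by
    -- With windows of length `1 / (8 * (d + 1))` and `z` its inverse, one path of `n` sites has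
    -- probability at most (e/(8(d+1)))^n. There are at most (2d)^n paths, so the sum is at most
    -- (3/4)^n, and `n` = ⌈exp β⌉ makes this doubly exponentially small.
    refine whp_ball_of_le
      (N := fun β => (8 * (d + 1) + 1) * 5 ^ d * Real.exp (β * (max κ 0 + C * d)))
      (f := fun β => Real.exp (-(Real.log (4 / 3) * Real.exp (β * 1)))) ?_ ?_
      (Eventually.of_forall fun β => (Real.exp_pos _).le)
      (tendsto_exp_mul_exp_neg_exp _ _ one_pos hlog)
    · filter_upwards [eventually_ge_atTop 0] with β hβ
      rw [Finset.card_product, Finset.card_range]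
      push_cast
      have h3 := (Nat.ceil_lt_add_one (a := 8 * (d + 1) * Real.exp (β * κ)) (by positivity)).le
      have h4 : 8 * (d + 1) * Real.exp (β * κ) ≤ 8 * (d + 1) * Real.exp (β * max κ 0) := by
        gcongr
        exact le_max_left _ _
      have h5 : 1 ≤ Real.exp (β * max κ 0) := Real.one_le_exp (by positivity)
      calc (⌈8 * (d + 1) * Real.exp (β * κ)⌉₊ : ℝ) * (centered d ⌈Real.exp (β * C)⌉₊).card
          ≤ ((8 * (d + 1) + 1) * Real.exp (β * max κ 0)) * (5 ^ d * Real.exp (β * (C * d))) := by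
            gcongr
            · linarith
            · exact card_centered_ceil_le hβ hC
        _ = (8 * (d + 1) + 1) * 5 ^ d * Real.exp (β * (max κ 0 + C * d)) := by
            rw [mul_add β, Real.exp_add]
            ring
    · refine Eventually.of_forall fun β q _ => ?_
      set n := ⌈Real.exp β⌉₊ with hn
      have hsub : {ω | ¬ ∀ L ∈ paths n q.2,
          ¬ ∃ A : Finset (Site d × ℕ), n ≤ A.card ∧ ∀ p ∈ A, p ∈ effective gap U 1 L.toFinset
            (q.1 * (1 / (8 * (d + 1)))) ((q.1 + 1) * (1 / (8 * (d + 1)))) ω} ⊆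
          ⋃ L ∈ paths n q.2, {ω | ∃ A : Finset (Site d × ℕ), n ≤ A.card ∧ ∀ p ∈ A,
            p ∈ effective gap U 1 L.toFinset
            (q.1 * (1 / (8 * (d + 1)))) ((q.1 + 1) * (1 / (8 * (d + 1)))) ω} := by
        intro ω hω
        rw [Set.mem_ofPred_eq] at hω
        push Not at hω
        obtain ⟨L, hL, h⟩ := hω
        exact Set.mem_iUnion₂.2 ⟨L, hL, h⟩
      have hone : ∀ L ∈ paths n q.2, P {ω | ∃ A : Finset (Site d × ℕ), n ≤ A.card ∧ ∀ p ∈ A,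
            p ∈ effective gap U 1 L.toFinset
            (q.1 * (1 / (8 * (d + 1)))) ((q.1 + 1) * (1 / (8 * (d + 1)))) ω} ≤
          ENNReal.ofReal ((Real.exp 1 / (8 * (d + 1))) ^ n) := by
        intro L hL
        refine (measure_many_le hinput (z := 8 * (d + 1)) (by linarith) zero_le_one _
          (by positivity) (by gcongr; linarith) _).trans (ENNReal.ofReal_le_ofReal ?_)
        rw [div_pow, ← Real.exp_nat_mul]
        refine div_le_div_of_nonneg_right (Real.exp_le_exp.2 ?_) (by positivity)
        have hcard : (L.toFinset.card : ℝ) ≤ n := by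
          rw [← length_of_mem_paths hL]
          exact_mod_cast L.toFinset_card_le
        rw [show ((q.1 : ℝ) + 1) * (1 / (8 * (d + 1))) - q.1 * (1 / (8 * (d + 1))) =
          1 / (8 * (d + 1)) by ring, one_mul, mul_one, ← mul_assoc]
        refine (mul_le_of_le_one_left (Nat.cast_nonneg _) ?_).trans hcard
        rw [mul_one_div, div_le_one (by linarith)]
        linarith
      refine (measure_mono hsub).trans ((measure_biUnion_finset_le _ _).trans
        ((Finset.sum_le_card_nsmul _ _ _ hone).trans ?_))
      rw [nsmul_eq_mul, ← ENNReal.ofReal_natCast, ← ENNReal.ofReal_mul (Nat.cast_nonneg _)]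
      apply ENNReal.ofReal_le_ofReal
      calc ((paths n q.2).card : ℝ) * (Real.exp 1 / (8 * (d + 1))) ^ n
          ≤ (2 * d) ^ n * (Real.exp 1 / (8 * (d + 1))) ^ n := by
            gcongr
            exact_mod_cast card_paths_le n q.2
        _ = (2 * d * (Real.exp 1 / (8 * (d + 1)))) ^ n := (mul_pow _ _ _).symm
        _ ≤ (3 / 4) ^ n := by
            gcongr
            rw [mul_div_assoc', div_le_iff₀ (by linarith)]
            have := Real.exp_one_lt_three
            have := Nat.cast_nonneg (α := ℝ) d
            nlinarith
        _ ≤ Real.exp (-(Real.log (4 / 3) * Real.exp (β * 1))) := by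
            rw [← Real.rpow_natCast, Real.rpow_def_of_pos (by norm_num), mul_one,
              show (3 / 4 : ℝ) = (4 / 3)⁻¹ by norm_num, Real.log_inv, neg_mul]
            gcongr
            exact Nat.le_ceil _
  have hmark := whp_of_ae (P := P) (A := fun _ ω => ∀ x i, U x i ω ≤ 1)
    (Eventually.of_forall fun _ => ae_mark_le_one hinput)
  refine (hunion.and hmark).mono (Eventually.of_forall fun β ω hω i hi x hx L hL hnd hall => ?_)
  refine hω.1 (i, x) (Finset.mk_mem_product (Finset.mem_range.2 hi) hx) L hL ?_
  choose! p hp using hall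
  -- The sites of the path are distinct, so their arrivals are `n` distinct points.
  refine ⟨L.toFinset.image p, ?_, fun q hq => ?_⟩
  · rw [Finset.card_image_of_injOn, List.toFinset_card_of_nodup hnd, length_of_mem_paths hL]
    intro y hy y' hy' h
    rw [← (hp y (by simpa using hy)).1, ← (hp y' (by simpa using hy')).1, h]
  · obtain ⟨y, hy, rfl⟩ := Finset.mem_image.1 hq
    have hy' : y ∈ L := List.mem_toFinset.1 hy
    obtain ⟨h1, h2, h3⟩ := hp y hy'
    refine ⟨by rwa [h1], h2, ?_, hω.2 _ _⟩
    push_cast at h3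
    exact h3

end lower

/-! ### Below the critical exponent: the origin is empty -/

section lower

variable {d : ℕ} {c : ℝ → ℕ → ℝ} {Γ : ℕ → ℝ} {Ω : Type*} [MeasurableSpace Ω] {P : Measure Ω}
  [IsProbabilityMeasure P] {gap U : Site d → ℕ → Ω → ℝ}

/-- The origin is empty at time `t` if there are few points in small space-time boxes, no long path
in a short window, and no nucleation near the origin. -/
lemma zero_notMem_infiniteVolume {c : ℕ → ℝ} {g u : Site d → ℕ → ℝ} {t : ℝ} {R k n w : ℕ}
    {T : ℕ → ℝ} {D M θ : ℕ → ℕ} {δ : ℝ}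
    (hmono : ∀ m n, m ≤ n → n ≤ 2 * d → c m ≤ c n) (hg : ∀ x i, 0 < g x i) (ht : 0 ≤ t)
    (hTd : T d = t) (hk : 0 < k) (hT : ∀ n, 0 < T n) (hθle : ∀ n ≤ d, θ n ≤ n)
    (hθ : ∀ n ≤ d, (θ n = 1 ∧ 2 * k * 2 ≤ D n) ∨
      (θ n = 0 ∧ (n = 0 ∨ (T n ≤ M n * T (n - 1) ∧
        2 * k * (2 * (k + 1) + 2 + 2 * (k + 1) * M n) ≤ D n))))
    (hδ : 0 ≤ δ) (hw : t ≤ w * δ) (hR : w * n ≤ R)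
    (hfew : ∀ (I : Finset (Fin d)) (lo hi : Site d) (s : ℝ) (S : Finset (Site d × ℕ)), 0 ≤ s →
      s ≤ t → (∀ j ∈ I, hi j - lo j ≤ D I.card) → (∀ j ∉ I, hi j - lo j < (k + 1 : ℕ)) →
      (∀ p ∈ S, p.1 ∈ centered d R ∧ s < arrival g p ∧ arrival g p ≤ s + T I.card ∧
        reqOf c u p ≤ d - (I.card - θ I.card) ∧ ∀ j, lo j ≤ p.1 j ∧ p.1 j ≤ hi j) →
      S.card ≤ k)
    (hpath : ∀ i < w, ∀ x ∈ centered d R, ∀ L ∈ paths n x, L.Nodup →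
      ¬ ∀ y ∈ L, ∃ p : Site d × ℕ, p.1 = y ∧ i * δ < arrival g p ∧
        arrival g p ≤ (i + 1 : ℕ) * δ)
    (hnuc : ∀ p : Site d × ℕ, p.1 ∈ centered d (D d) → 0 < arrival g p → arrival g p ≤ t →
      ¬ reqOf c u p ≤ 0) :
    (0 : Site d) ∉ infiniteVolume c g u t := by
  intro hmem
  -- One finite volume containing an occupied origin is enough: the assumptions do not depend on
  -- `Λ`.
  obtain ⟨Λ, hΛ⟩ := Filter.Eventually.exists (f := atTop) hmem
  rw [← Finset.mem_coe, finiteVolume, coe_foldl_update hmono] at hΛ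
  obtain ⟨hnd, hsort, hl, -⟩ := orderedArrivals_sorted g Λ t
  have hpos := arrival_pos hg
  have hloc := zero_mem_run_filter (arrival g) hsort (fun p => decide (p.1 ∈ centered d R))
    (X := R) (fun p hp => by simpa [mem_centered] using hp) hδ (by exact_mod_cast hR)
    (fun p _ => hpos p) (fun p hp => (hl p hp).2.trans hw)
    (fun i hi x hx L hL hLn hall => hpath i hi x (mem_centered.2 hx) L hL hLn fun y hy => by
      obtain ⟨p, -, h1, h2, h3, -⟩ := hall y hy
      exact ⟨p, h1, h2, h3⟩) hΛ
  set l := (orderedArrivals g Λ t).filter fun p => decide (p.1 ∈ centered d R) with hldef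
  have hlmem : ∀ p ∈ l, p.1 ∈ centered d R ∧ arrival g p ≤ t := fun p hp => by
    have := List.mem_filter.1 hp
    exact ⟨by simpa using this.2, (hl p this.1).2⟩
  -- The top of the hierarchy: all directions free, no neighbour granted, the whole time interval.
  have hconf := conf_of_sparse (req := reqOf c u) (arrival g) {p | p.1 ∈ centered d R} T
    (fun n => D n) M θ k (k + 1) hk (Nat.lt_succ_self k) hT (fun n hn => by
      rcases hθ n hn with h | ⟨h, h'⟩
      · exact Or.inl ⟨h.1, by exact_mod_cast h.2⟩
      · exact Or.inr ⟨h, h'.imp id fun h' => ⟨h'.1, by exact_mod_cast h'.2⟩⟩) 0 t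
    (fun I lo hi s S h1 h2 h3 h4 hS => hfew I lo hi s S h1 h2 h3 h4 fun p hp => by
      obtain ⟨h5, h6, h7, h8, h9⟩ := hS p hp
      have hI : I.card ≤ d := by simpa using Finset.card_le_univ I
      have := hθle _ hI
      exact ⟨h5, h6, h7, by omega, h9⟩) d Finset.univ (by simp) l 0 0 (hnd.filter _)
    (hsort.filter _) le_rfl (fun p hp => (hlmem p hp).2) ht
    (fun p hp => ⟨(hlmem p hp).1, hpos p, by rw [zero_add, hTd]; exact (hlmem p hp).2,
      fun j hj => absurd (Finset.mem_univ j) hj⟩)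
  rw [Nat.sub_self] at hconf
  obtain ⟨𝓕, hsep, hcov, hE⟩ := hconf
  obtain ⟨E, hE𝓕, h0E⟩ := Set.mem_iUnion₂.1 (hcov hloc)
  -- The box containing the origin holds a point of requirement zero, hence one within its side `D
  -- d` of the origin.
  obtain ⟨p, hp, hpE, hreq⟩ := exists_nucleation hsep hcov hE𝓕 hloc h0E
  refine hnuc p (mem_centered.2 fun j => ?_) (hpos p) (hlmem p hp).2 hreq
  have h1 := (hE E hE𝓕).1 j (Finset.mem_univ j)
  have h2 := h0E j (Finset.mem_univ j)
  have h3 := hpE j (Finset.mem_univ j)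
  rw [Pi.zero_apply] at h2
  rw [abs_le]
  omega

/-- Below the critical constant, the origin is empty. -/
theorem whp_notMem_infiniteVolume (hc : RateHypothesis d c Γ) (hinput : IsGraphicalInput P gap U)
    {κ : ℝ} (hκ : 0 < κ) (hκd : κ < kappaCrit Γ d) :
    Whp P fun β ω => (0 : Site d) ∉ infiniteVolume (c β) (fun x i => gap x i ω)
      (fun x i => U x i ω) (Real.exp (β * κ)) := by
  obtain ⟨K, Δ, θ, hKd, hK⟩ := exists_scales hc.energy_mono d le_rfl κ hκd
  -- The strict inequalities of the scales leave room for the losses: `ε` in the rate, `2 * ε` per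
  -- free direction in the side of the boxes, and `ε` per other direction in the thickness of the
  -- slabs.
  obtain ⟨ε, hεK, hε⟩ : ∃ ε : ℝ, (∀ n ∈ Finset.range (d + 1),
      n * Δ n + K n + (3 * d + 2) * ε < Γ (n - θ n)) ∧ 0 < ε := by
    have h : ∀ᶠ ε : ℝ in 𝓝[>] 0, ∀ n ∈ Finset.range (d + 1),
        n * Δ n + K n + (3 * d + 2) * ε < Γ (n - θ n) := by
      rw [Filter.eventually_all_finset]
      intro n hn
      have hcont : Continuous fun ε : ℝ => n * Δ n + K n + (3 * d + 2) * ε := by fun_prop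
      refine nhdsWithin_le_nhds ((hcont.tendsto 0).eventually (gt_mem_nhds ?_))
      rw [mul_zero, add_zero]
      exact (hK n (by simpa [Nat.lt_succ_iff] using hn)).2.2.1
    exact (h.and self_mem_nhdsWithin).exists
  -- The radius exponent `κ + 2` leaves room for the propagation distance: about exp(βκ) windows, up
  -- to a constant, times exp β steps in each.
  have hfew := whp_ball (P := P) (Finset.univ : Finset (Finset (Fin d))) fun I _ =>
    whp_few hc hinput I (n := d - (I.card - θ I.card)) (C := κ + 2) (κ := κ) (κ' := K I.card)
      (by linarith) hε (fun β => blobSide ε (Δ I.card) β) (by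
        have hI : I.card ≤ d := by simpa using Finset.card_le_univ I
        have hId : (I.card : ℝ) ≤ d := by exact_mod_cast hI
        obtain ⟨hΔ, hθ, -, -⟩ := hK _ hI
        have hex := hεK I.card (by simpa [Nat.lt_succ_iff] using hI)
        set i := I.card - θ I.card
        have ha : -(Γ i - ε) + K I.card + I.card * (Δ I.card + 2 * ε) +
            ((d - I.card : ℕ) : ℝ) * ε < 0 := by
          rw [Nat.cast_sub hI]
          nlinarith
        filter_upwards [hc.le_exp_neg (i := i) (by omega) (sub_lt_self _ hε),
          eventually_ge_atTop 0, eventually_mul_exp_le (2 * 29 ^ I.card * 2 ^ (d - I.card)) ha]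
          with β h1 hβ h2
        rw [mul_zero, Real.exp_zero] at h2
        refine le_trans ?_ h2
        have h3 := blobSide_add_one_le hε.le hΔ hβ
        have h4 : (⌊Real.exp (β * ε)⌋₊ : ℝ) + 1 ≤ 2 * Real.exp (β * ε) := by
          have := Nat.floor_le (Real.exp_pos (β * ε)).le
          have : 1 ≤ Real.exp (β * ε) := Real.one_le_exp (by positivity)
          linarith
        push_cast
        calc c β (d - i) * (2 * Real.exp (β * K I.card)) *
              ((blobSide ε (Δ I.card) β + 1 : ℝ) ^ I.card *
                ((⌊Real.exp (β * ε)⌋₊ : ℝ) + 1) ^ (d - I.card))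
            ≤ Real.exp (-(β * (Γ i - ε))) * (2 * Real.exp (β * K I.card)) *
              ((29 * Real.exp (β * (Δ I.card + 2 * ε))) ^ I.card *
                (2 * Real.exp (β * ε)) ^ (d - I.card)) := by gcongr
          _ = 2 * 29 ^ I.card * 2 ^ (d - I.card) * Real.exp (β * (-(Γ i - ε) + K I.card +
              I.card * (Δ I.card + 2 * ε) + ((d - I.card : ℕ) : ℝ) * ε)) := by
            rw [show β * (-(Γ i - ε) + K I.card + I.card * (Δ I.card + 2 * ε) +
                ((d - I.card : ℕ) : ℝ) * ε) = -(β * (Γ i - ε)) + β * K I.card +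
                I.card * (β * (Δ I.card + 2 * ε)) + ((d - I.card : ℕ) : ℝ) * (β * ε) by ring,
              Real.exp_add, Real.exp_add, Real.exp_add, Real.exp_nat_mul, Real.exp_nat_mul,
              mul_pow, mul_pow]
            ring) (by omega)
  have hnuc := whp_no_nucleus hc hinput (κ := κ) (fun β => blobSide ε (Δ d) β) (by
    obtain ⟨hΔ, hθ, -, -⟩ := hK d le_rfl
    have hex := hεK d (by simp)
    -- The scales control Γ_{d-θ}, whereas a point of requirement zero has the energy Γ_d, which is
    -- at least as large.
    have hΓ := hc.energy_mono (d - θ d) d (by omega) le_rfl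
    have ha : -(Γ d - ε) + κ + d * (Δ d + 2 * ε) < 0 := by
      rw [hKd] at hex
      nlinarith [mul_nonneg (Nat.cast_nonneg (α := ℝ) d) hε.le]
    have h0 : Tendsto (fun β : ℝ => 58 ^ d *
        Real.exp (β * (-(Γ d - ε) + κ + d * (Δ d + 2 * ε)))) atTop (𝓝 0) := by
      rw [← mul_zero (58 ^ d : ℝ)]
      exact (Real.tendsto_exp_atBot.comp (tendsto_id.atTop_mul_const_of_neg ha)).const_mul _
    refine tendsto_of_tendsto_of_tendsto_of_le_of_le' tendsto_const_nhds h0 ?_ ?_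
    · filter_upwards [eventually_gt_atTop 0] with β hβ
      have := hc.pos β hβ 0 (by omega)
      positivity
    · have hle := hc.le_exp_neg (i := d) le_rfl (sub_lt_self _ hε)
      rw [Nat.sub_self] at hle
      filter_upwards [hle, eventually_ge_atTop 0] with β h1 hβ
      have h3 := blobSide_add_one_le hε.le hΔ hβ
      calc c β 0 * Real.exp (β * κ) * (2 * (blobSide ε (Δ d) β : ℝ) + 1) ^ d
          ≤ Real.exp (-(β * (Γ d - ε))) * Real.exp (β * κ) *
            (58 * Real.exp (β * (Δ d + 2 * ε))) ^ d := by
            gcongr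
            linarith
        _ = 58 ^ d * Real.exp (β * (-(Γ d - ε) + κ + d * (Δ d + 2 * ε))) := by
            rw [show β * (-(Γ d - ε) + κ + d * (Δ d + 2 * ε)) = -(β * (Γ d - ε)) + β * κ +
                d * (β * (Δ d + 2 * ε)) by ring, Real.exp_add, Real.exp_add, Real.exp_nat_mul,
              mul_pow]
            ring)
  have hpath := whp_no_path (P := P) hinput (C := κ + 2) (κ := κ) (by linarith)
  have hgap := whp_of_ae (P := P) (A := fun _ ω => ∀ x i, 0 < gap x i ω)
    (Eventually.of_forall fun _ => ae_gap_pos hinput)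
  refine ((hfew.and hnuc).and (hpath.and hgap)).mono ?_
  filter_upwards [eventually_gt_atTop 0,
    eventually_mul_exp_le ((8 * (d + 1) + 1) * 2) (show κ + 1 < κ + 2 by linarith)]
    with β hβ hR ω hω
  obtain ⟨⟨hfew, hnuc⟩, hpath, hgap⟩ := hω
  have h1 : 1 ≤ Real.exp (β * ε) := Real.one_le_exp (by positivity)
  refine zero_notMem_infiniteVolume (R := ⌈Real.exp (β * (κ + 2))⌉₊) (k := ⌊Real.exp (β * ε)⌋₊)
    (T := fun n => Real.exp (β * K n)) (D := fun n => blobSide ε (Δ n) β)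
    (M := fun n => ⌈Real.exp (β * Δ n)⌉₊) (θ := θ) (hc.mono β hβ) hgap (Real.exp_pos _).le
    (by simp only [hKd]) (Nat.floor_pos.2 h1) (fun n => Real.exp_pos _)
    (fun n hn => (hK n hn).2.1) (fun n hn => ?_) (by positivity) ?_ ?_
    (fun I => hfew I (Finset.mem_univ I)) hpath hnuc
  · obtain ⟨-, -, -, h | ⟨h, h'⟩⟩ := hK n hn
    · refine Or.inl ⟨h, Nat.mul_le_mul le_rfl ?_⟩
      omega
    · refine Or.inr ⟨h, h'.imp id fun h' => ⟨?_, le_rfl⟩⟩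
      calc Real.exp (β * K n) ≤ Real.exp (β * Δ n) * Real.exp (β * K (n - 1)) := by
            rw [← Real.exp_add, ← mul_add]
            gcongr
        _ ≤ _ := by
            gcongr
            exact Nat.le_ceil _
  · have hz : (0 : ℝ) < 8 * (d + 1) := by positivity
    rw [mul_one_div, le_div_iff₀ hz, mul_comm]
    exact Nat.le_ceil _
  · rw [← Nat.cast_le (α := ℝ), Nat.cast_mul]
    refine le_trans ?_ (hR.trans (Nat.le_ceil _))
    have h2 := (Nat.ceil_lt_add_one (a := 8 * (d + 1) * Real.exp (β * κ)) (by positivity)).le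
    have h3 := (Nat.ceil_lt_add_one (Real.exp_pos β).le).le
    have h4 : 1 ≤ Real.exp (β * κ) := Real.one_le_exp (by positivity)
    have h5 : 1 ≤ Real.exp β := Real.one_le_exp hβ.le
    calc (⌈8 * (d + 1) * Real.exp (β * κ)⌉₊ : ℝ) * ⌈Real.exp β⌉₊
        ≤ ((8 * (d + 1) + 1) * Real.exp (β * κ)) * (2 * Real.exp β) := by
          gcongr
          · linarith
          · linarith
      _ = (8 * (d + 1) + 1) * 2 * Real.exp (β * (κ + 1)) := by
          rw [mul_add β, mul_one, Real.exp_add]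
          ring

end lower

end IrrevGrowth

end

theorem mainTheorem1 (d : ℕ) (c : ℝ → ℕ → ℝ) (Γ : ℕ → ℝ)
    (hc : IrrevGrowth.RateHypothesis d c Γ)
    {Ω : Type*} [MeasurableSpace Ω] (P : Measure Ω) [IsProbabilityMeasure P]
    (gap U : IrrevGrowth.Site d → ℕ → Ω → ℝ)
    (hinput : IrrevGrowth.IsGraphicalInput P gap U)
    (κ : ℝ) (hκ : 0 < κ) :
    (κ < IrrevGrowth.kappaCrit Γ d →
      Tendsto (fun β : ℝ => P {ω | (0 : IrrevGrowth.Site d) ∈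
          IrrevGrowth.infiniteVolume (c β) (fun x i => gap x i ω) (fun x i => U x i ω)
            (Real.exp (β * κ))}) atTop (𝓝 0)) ∧
    (IrrevGrowth.kappaCrit Γ d < κ →
      Tendsto (fun β : ℝ => P {ω | (0 : IrrevGrowth.Site d) ∉
          IrrevGrowth.infiniteVolume (c β) (fun x i => gap x i ω) (fun x i => U x i ω)
            (Real.exp (β * κ))}) atTop (𝓝 0)) := by
  refine ⟨fun h => ?_, fun h => ?_⟩
  · simpa [IrrevGrowth.Whp] using IrrevGrowth.whp_notMem_infiniteVolume hc hinput hκ h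
  · exact IrrevGrowth.whp_mem_infiniteVolume hc hinput hκ h
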